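/- **Setting.** Let $M$ be a Riemann surface, $n\ge 3$, and let $\langle\cdot,\cdot\rangle$ be the complex bilinear extension of the Minkowski form $-y_0^2+y_1^2+\dots+y_{n+1}^2$ of $\mathbb R^{n+1,1}$; a point $x\in S^n$ is represented by the null line spanned by $(1,x)$. All maps are smooth. A conformal immersion $f:M\to S^n$ is a *Willmore surface* if it is critical for the Willmore functional $\frac14\int(|H|^2-K+1)\,dA$ with respect to all smooth variations through maps into $S^n$ with compact support in a coordinate domain, where the induced conformal structure may vary with the map. In a local complex coordinate $z$, the *canonical lift* $Y$ of a conformal immersion $f$ is the positive multiple of $(1,f)$ with $\langle Y_z,Y_{\bar z}\rangle=\frac12$. Let $N$ be the real null section of $V=\mathrm{Span}\{Y,dY,Y_{z\bar z}\}$ with $\langle Y,N\rangle=-1$ and $\langle Y_z,N\rangle=\langle Y_{\bar z},N\rangle=0$, let $s=2\langle Y_{zz},N\rangle$ and $\kappa=Y_{zz}+\frac s2Y\in V^\perp\otimes\mathbb C$ be the Schwarzian and the Hopf differential, and let $D$ be the connection on $V^\perp$ given by orthogonal projection. For a complex function $\mu$ put $$\widehat Y=\tfrac12|\mu|^2Y+\bar\mu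 Y_z+\mu Y_{\bar z}+N,\quad \theta=\mu_z-\tfrac12\mu^2-s,\quad \rho=\bar\mu_z-2\langle\kappa,\bar\kappa\rangle,\quad \eta=D_{\bar z}\kappa+\tfrac{\bar\mu}2\kappa .$$ A map $\tilde f:M\to S^n$ is an *adjoint transform* of $f$ if in every local coordinate there is a smooth $\mu$ with $\theta=0$ (co-touching) and $\langle\eta,\eta\rangle=0$ (conformality) such that $\widehat Y$ represents $\tilde f$. Such a $\mu$ is unique. **Theorem.** Let $f:M\to S^n$ be a Willmore surface and let $\tilde f:M\to S^n$ be an adjoint transform of $f$ that is an immersion. Then $\tilde f$ is conformal and is again a Willmore surface, and $f$ is in turn an adjoint transform of $\tilde f$. In any local coordinate let $Y,\mu,\rho$ be the data above for $f$ and its adjoint transform $\tilde f$, and let $\tilde Y,\tilde\mu,\tilde\rho$ be the data for $\tilde f$ and its adjoint transform $f$. Then $\widehat Y=\sigma\tilde Y$ for a smooth positive function $\sigma$, and $$-\frac1\sigma=\langle\tilde Y,Y\rangle,\qquad \frac{2\sigma_z}{\sigma}=\tilde\mu+\mu,\qquad \tilde\rho=\bar\rho .$$ -/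

import Mathlib

open scoped ContDiff Manifold ComplexConjugate

noncomputable section

namespace MobiusSurface

/-! ### Coordinate derivatives, `z = u + i v` -/

/-- The coordinate vectors `∂/∂u`, `∂/∂v` of the plane `ℂ`. -/
def coordVec : Fin 2 → ℂ := ![1, Complex.I]

/-- The partial derivative `∂F/∂u` (`i = 0`) or `∂F/∂v` (`i = 1`). -/
def pd {E : Type*} [NormedAddCommGroup E] [NormedSpace ℝ E] (i : Fin 2) (F : ℂ → E) (w : ℂ) : E :=
  fderiv ℝ F w (coordVec i)

/-- The Wirtinger derivative `F_z = (F_u - i F_v) / 2`. -/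
def dz {E : Type*} [NormedAddCommGroup E] [NormedSpace ℂ E] (F : ℂ → E) (w : ℂ) : E :=
  (1 / 2 : ℂ) • (pd 0 F w - Complex.I • pd 1 F w)

/-- The Wirtinger derivative `F_z̄ = (F_u + i F_v) / 2`. -/
def dzbar {E : Type*} [NormedAddCommGroup E] [NormedSpace ℂ E] (F : ℂ → E) (w : ℂ) : E :=
  (1 / 2 : ℂ) • (pd 0 F w + Complex.I • pd 1 F w)

/-! ### The light-cone model -/

/-- The complexification of Minkowski space `ℝ^{n+1,1}`; coordinate `0` is the time coordinate. -/
abbrev CMink (n : ℕ) : Type := Fin (n + 2) → ℂ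

/-- The complex bilinear extension of `⟨y, y⟩ = - y₀² + ∑ yᵢ²`. -/
def mink {n : ℕ} (x y : CMink n) : ℂ :=
  -(x 0 * y 0) + ∑ i : Fin (n + 1), x i.succ * y i.succ

/-- The light-like vector `(1, x)` that represents the point `x` of the sphere. -/
def sphereLift {n : ℕ} (x : EuclideanSpace ℝ (Fin (n + 1))) : CMink n :=
  Fin.cons 1 (fun i => ((x i : ℝ) : ℂ))

/-- The canonical lift `Y` into the forward light cone of a map `f`, conformal with respect to the
coordinate `z`: the positive multiple of `(1, f)` with `|dY|² = |dz|²`. -/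
def canonicalLift {n : ℕ} (f : ℂ → EuclideanSpace ℝ (Fin (n + 1))) (w : ℂ) : CMink n :=
  ((√(2 / (‖pd 0 f w‖ ^ 2 + ‖pd 1 f w‖ ^ 2)) : ℝ) : ℂ) • sphereLift (f w)

/-! ### Moving frame and invariants of a canonical lift `Y` -/

/-- The real light-like section `N` of `V = Span {Y, dY, Y_{zz̄}}` with `⟨Y, N⟩ = -1` and
`⟨Y_z, N⟩ = ⟨Y_z̄, N⟩ = 0`. -/
def frameN {n : ℕ} (Y : ℂ → CMink n) (w : ℂ) : CMink n :=
  (2 : ℂ) • dzbar (dz Y) w + (2 * mink (dzbar (dz Y) w) (dzbar (dz Y) w)) • Y w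

/-- The Schwarzian `s`: the function for which `Y_zz + (s/2) Y` is orthogonal to `V`. -/
def schwarzian {n : ℕ} (Y : ℂ → CMink n) (w : ℂ) : ℂ :=
  2 * mink (dz (dz Y) w) (frameN Y w)

/-- The Hopf differential `κ = Y_zz + (s/2) Y`. -/
def hopf {n : ℕ} (Y : ℂ → CMink n) (w : ℂ) : CMink n :=
  dz (dz Y) w + (schwarzian Y w / 2) • Y w

/-- The orthogonal projection onto the complexified Möbius normal space `V^⊥` at `w`, written in
the frame `Y, Y_z, Y_z̄, N` of `V`. -/
def normalProj {n : ℕ} (Y : ℂ → CMink n) (w : ℂ) (x : CMink n) : CMink n :=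
  x + mink x (frameN Y w) • Y w + mink x (Y w) • frameN Y w
    - (2 * mink x (dzbar Y w)) • dz Y w - (2 * mink x (dz Y w)) • dzbar Y w

/-- The normal connection `D_z̄`. -/
def normalDzbar {n : ℕ} (Y : ℂ → CMink n) (ψ : ℂ → CMink n) (w : ℂ) : CMink n :=
  normalProj Y w (dzbar ψ w)

/-! ### Adjoint transforms in a coordinate -/

/-- `Ŷ = (|μ|²/2) Y + μ̄ Y_z + μ Y_z̄ + N`. -/
def adjointLift {n : ℕ} (Y : ℂ → CMink n) (μ : ℂ → ℂ) (w : ℂ) : CMink n :=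
  (((‖μ w‖ ^ 2 / 2 : ℝ)) : ℂ) • Y w + conj (μ w) • dz Y w + μ w • dzbar Y w + frameN Y w

/-- `θ = μ_z - μ²/2 - s`. -/
def theta {n : ℕ} (Y : ℂ → CMink n) (μ : ℂ → ℂ) (w : ℂ) : ℂ :=
  dz μ w - μ w ^ 2 / 2 - schwarzian Y w

/-- `ρ = μ̄_z - 2 ⟨κ, κ̄⟩`. -/
def rho {n : ℕ} (Y : ℂ → CMink n) (μ : ℂ → ℂ) (w : ℂ) : ℂ :=
  dz (fun x => conj (μ x)) w - 2 * mink (hopf Y w) (star (hopf Y w))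

/-- `η = D_z̄ κ + (μ̄/2) κ`. -/
def eta {n : ℕ} (Y : ℂ → CMink n) (μ : ℂ → ℂ) (w : ℂ) : CMink n :=
  normalDzbar Y (hopf Y) w + (conj (μ w) / 2) • hopf Y w

/-- In the coordinate domain `U`, the map `fh` is the one represented by `Ŷ` for the function `μ`,
and `μ` satisfies the co-touching condition `θ = 0` and the conformality condition `⟨η, η⟩ = 0`
with respect to `f`. -/
structure IsAdjointTransformOn {n : ℕ} (U : Set ℂ)
    (f fh : ℂ → EuclideanSpace ℝ (Fin (n + 1))) (μ : ℂ → ℂ) : Prop where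
  smooth : ContDiffOn ℝ ∞ μ U
  represents : ∀ w ∈ U, ∃ c : ℂ, adjointLift (canonicalLift f) μ w = c • sphereLift (fh w)
  coTouching : ∀ w ∈ U, theta (canonicalLift f) μ w = 0
  conformality : ∀ w ∈ U, mink (eta (canonicalLift f) μ w) (eta (canonicalLift f) μ w) = 0

/-! ### Immersions and the Willmore functional in a coordinate domain -/

/-- A smooth immersion of the coordinate domain `U`. -/
structure IsImmersionOn {n : ℕ} (U : Set ℂ) (f : ℂ → EuclideanSpace ℝ (Fin (n + 1))) : Prop where
  smooth : ContDiffOn ℝ ∞ f U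
  injective : ∀ w ∈ U, Function.Injective (fderiv ℝ f w)

/-- Conformality with respect to the coordinate: `|f_u| = |f_v|` and `f_u ⟂ f_v`. -/
def IsConformalOn {n : ℕ} (U : Set ℂ) (f : ℂ → EuclideanSpace ℝ (Fin (n + 1))) : Prop :=
  ∀ w ∈ U, ‖pd 0 f w‖ = ‖pd 1 f w‖ ∧ inner ℝ (pd 0 f w) (pd 1 f w) = 0

/-- The first fundamental form `g_{ij}` (in an arbitrary coordinate). -/
def firstFF {n : ℕ} (f : ℂ → EuclideanSpace ℝ (Fin (n + 1))) (w : ℂ) :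
    Matrix (Fin 2) (Fin 2) ℝ :=
  Matrix.of fun i j => inner ℝ (pd i f w) (pd j f w)

/-- The component of `x` orthogonal to the tangent plane spanned by `f_u`, `f_v`. -/
def normalPart {n : ℕ} (f : ℂ → EuclideanSpace ℝ (Fin (n + 1))) (w : ℂ)
    (x : EuclideanSpace ℝ (Fin (n + 1))) : EuclideanSpace ℝ (Fin (n + 1)) :=
  x - ∑ k, ∑ l, ((firstFF f w)⁻¹ k l * inner ℝ x (pd k f w)) • pd l f w

/-- The second fundamental form `II_{ij}`, with respect to the Euclidean space that contains the
sphere. -/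
def secondFF {n : ℕ} (f : ℂ → EuclideanSpace ℝ (Fin (n + 1))) (w : ℂ) (i j : Fin 2) :
    EuclideanSpace ℝ (Fin (n + 1)) :=
  normalPart f w (pd i (pd j f) w)

/-- The trace-free part `II°_{ij}` of the second fundamental form. For a map into the unit sphere
it is the same for the sphere and for the surrounding Euclidean space, since the two second
fundamental forms differ by a multiple of `g_{ij}`. -/
def traceFreeFF {n : ℕ} (f : ℂ → EuclideanSpace ℝ (Fin (n + 1))) (w : ℂ) (i j : Fin 2) :
    EuclideanSpace ℝ (Fin (n + 1)) :=
  secondFF f w i j -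
    (firstFF f w i j / 2) • ∑ k, ∑ l, (firstFF f w)⁻¹ k l • secondFF f w k l

/-- The area density of the Möbius metric of an immersion into the unit sphere, in an arbitrary
coordinate: `(1/8) |II°|² dA = (1/4) (|H|² - K + 1) dA`. This is independent of the
coordinate, and in a coordinate that is conformal for `f` it is `⟨κ, κ̄⟩ du dv`. -/
def mobiusDensity {n : ℕ} (f : ℂ → EuclideanSpace ℝ (Fin (n + 1))) (w : ℂ) : ℝ :=
  (1 / 8) * (∑ i, ∑ j, ∑ k, ∑ l, (firstFF f w)⁻¹ i k * (firstFF f w)⁻¹ j l *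
    inner ℝ (traceFreeFF f w i j) (traceFreeFF f w k l)) * √(firstFF f w).det

/-- The Willmore functional over `K`: the area of `K` for the Möbius metric of `f`. -/
def willmoreFunctional {n : ℕ} (K : Set ℂ) (f : ℂ → EuclideanSpace ℝ (Fin (n + 1))) : ℝ :=
  ∫ w in K, mobiusDensity f w

/-- `F` is a smooth variation of `f : U → Sⁿ` through maps into the unit sphere, supported in `K`.
Nothing is required of the conformal structures induced by `F t`; for compact `K` and an
immersion `f`, the maps `F t` are immersions for all small `t`. -/
structure IsVariation {n : ℕ} (U K : Set ℂ) (f : ℂ → EuclideanSpace ℝ (Fin (n + 1)))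
    (F : ℝ → ℂ → EuclideanSpace ℝ (Fin (n + 1))) : Prop where
  smooth : ContDiffOn ℝ ∞ (fun p : ℝ × ℂ => F p.1 p.2) (Set.univ ×ˢ U)
  mem_sphere : ∀ t, ∀ w ∈ U, ‖F t w‖ = 1
  initial : ∀ w ∈ U, F 0 w = f w
  support : ∀ t, ∀ w ∈ U \ K, F t w = f w

/-- `f` is a critical point of the Willmore functional with respect to all variations compactly
supported in `U`. -/
def IsWillmoreCriticalOn {n : ℕ} (U : Set ℂ) (f : ℂ → EuclideanSpace ℝ (Fin (n + 1))) : Prop :=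
  ∀ (K : Set ℂ) (F : ℝ → ℂ → EuclideanSpace ℝ (Fin (n + 1))), IsCompact K → K ⊆ U →
    IsVariation U K f F → HasDerivAt (fun t => willmoreFunctional K (F t)) 0 0

/-! ### Maps from a Riemann surface into the unit sphere -/

/-- The unit sphere `Sⁿ` in `ℝⁿ⁺¹`. -/
abbrev Sph (n : ℕ) : Type := Metric.sphere (0 : EuclideanSpace ℝ (Fin (n + 1))) 1

/-- The map `f` in the local coordinate `φ`. -/
def inCoord {n : ℕ} {M : Type*} [TopologicalSpace M] (φ : OpenPartialHomeomorph M ℂ)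
    (f : M → Sph n) (w : ℂ) : EuclideanSpace ℝ (Fin (n + 1)) :=
  (f (φ.symm w) : EuclideanSpace ℝ (Fin (n + 1)))

/-- The local (holomorphic) coordinates of a Riemann surface. -/
abbrev coords (M : Type*) [TopologicalSpace M] [ChartedSpace ℂ M] :
    Set (OpenPartialHomeomorph M ℂ) :=
  IsManifold.maximalAtlas 𝓘(ℂ) ω M

/-- `f` is a smooth immersion. -/
def IsImmersion {n : ℕ} {M : Type*} [TopologicalSpace M] [ChartedSpace ℂ M]
    (f : M → Sph n) : Prop :=
  ∀ φ ∈ coords M, IsImmersionOn φ.target (inCoord φ f)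

/-- `f` is conformal. -/
def IsConformal {n : ℕ} {M : Type*} [TopologicalSpace M] [ChartedSpace ℂ M]
    (f : M → Sph n) : Prop :=
  ∀ φ ∈ coords M, IsConformalOn φ.target (inCoord φ f)

/-- `f` is a (conformally immersed) Willmore surface: a conformal immersion that is critical for
the Willmore functional with respect to all variations with compact support in a coordinate
domain. -/
structure IsWillmoreSurface {n : ℕ} {M : Type*} [TopologicalSpace M] [ChartedSpace ℂ M]
    (f : M → Sph n) : Prop where
  immersion : IsImmersion f
  conformal : IsConformal f
  critical : ∀ φ ∈ coords M, IsWillmoreCriticalOn φ.target (inCoord φ f)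

/-- `fh` is an adjoint transform of `f`. (The function `μ` in the coordinate `φ` is determined by
`f`, `fh` and `φ`.) -/
def IsAdjointTransform {n : ℕ} {M : Type*} [TopologicalSpace M] [ChartedSpace ℂ M]
    (f fh : M → Sph n) : Prop :=
  ∀ φ ∈ coords M, ∃ μ : ℂ → ℂ, IsAdjointTransformOn φ.target (inCoord φ f) (inCoord φ fh) μ

end MobiusSurface

end

open MobiusSurface

/-! Duality. Beside the null vectors $Y,\hat Y$ with $\langle Y,\hat Y\rangle=-1$ put
$L=Y_z+\frac\mu2Y$ (`contactVec`) and $Z=\hat Y_z-\frac\mu2\hat Y$ (`adjointTangent`). The structure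
equations give $Z=\theta\,\bar L+\rho L+2\eta$, hence $\langle
Z,Z\rangle=\theta\rho+4\langle\eta,\eta\rangle$, so the two defining conditions make $\tilde f$
conformal. They also give $L_{\bar z}=\frac12\hat Y+\frac{\bar\rho}2Y-\frac{\bar\mu}2L$. If
$\theta=0$ and the Willmore tensor $W=D_{\bar z}D_{\bar z}\kappa+\frac{\bar s}2\kappa$ vanishes,
then $Z_{\bar z}=\frac\rho2\hat Y+\frac{\bar\mu}2Z+\langle Z,\bar Z\rangle Y$
(`dzbar_adjointTangent`), an equation of the same shape with $Y$ and $\hat Y$ exchanged.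

Write $\hat Y=\sigma\tilde Y$ and $\nu=2\sigma_z/\sigma-\mu$. Then $Z=\sigma\tilde L$, where $\tilde
L$ is the vector $L$ of $\tilde Y$ and $\nu$. Comparing the two expressions for $\tilde L_{\bar z}$
shows that the adjoint lift of $\tilde Y$ with parameter $\nu$ is $\sigma Y$ (`adjointLift_dual`),
whence $\tilde Z=\sigma L$. All remaining claims are read off from $Z=\sigma\tilde L$, $\tilde
Z=\sigma L$: $\tilde\theta$ and $\tilde\rho$ are pairings of $\tilde Z$ with $\tilde L$ and its
conjugate, $\langle\tilde\eta,\tilde\eta\rangle=0$ because $L$ is null, and $\tilde W=0$ follows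
from the normal part of $(\sigma L)_{\bar z}$ (`willmoreTensor_dual`).

Criticality. It remains to show that being critical for the functional is the same as $W=0$
(`isWillmoreCriticalOn_iff`). The variations may change the conformal structure, so the density is
differentiated as a function of the two-jet at a conformal jet (`hasDerivAt_jetDensity`). The
derivative is rewritten in complex form for the lift $(1,f)$ (`conformalVariation_sphereLift`),
rescaled to the canonical lift (`liftVariation_smul`), and found to be $2\langle\psi,W\rangle$ plus
a divergence (`liftVariation_eq`). The fundamental lemma of the calculus of variations then applies,
$W$ being real by Codazzi (`star_willmoreTensor`). -/

noncomputable section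

namespace MobiusSurface

/-! ### Calculus of the coordinate derivatives -/

section Calculus

open Filter Topology

variable {E F G : Type*} [NormedAddCommGroup E] [NormedAddCommGroup F] [NormedAddCommGroup G]

/-! ### Partial derivatives over the reals -/

section Real

variable [NormedSpace ℝ E] [NormedSpace ℝ F] [NormedSpace ℝ G]
  {U : Set ℂ} {w : ℂ} {f g : ℂ → E} {h : ℂ → F}

theorem SmoothOn.differentiableAt (hU : IsOpen U) (hf : ContDiffOn ℝ ∞ f U) (hw : w ∈ U) :
    DifferentiableAt ℝ f w :=
  (hf.contDiffAt (hU.mem_nhds hw)).differentiableAt (by simp)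

theorem SmoothOn.pd (hU : IsOpen U) (hf : ContDiffOn ℝ ∞ f U) (i : Fin 2) :
    ContDiffOn ℝ ∞ (pd i f) U :=
  (hf.fderiv_of_isOpen hU (by simp)).clm_apply contDiffOn_const

theorem pd_congr (hU : IsOpen U) (hfg : Set.EqOn f g U) (hw : w ∈ U) (i : Fin 2) :
    pd i f w = pd i g w := by
  have : f =ᶠ[𝓝 w] g := hfg.eventuallyEq_of_mem (hU.mem_nhds hw)
  simp [pd, this.fderiv_eq]

theorem pd_add (hf : DifferentiableAt ℝ f w) (hg : DifferentiableAt ℝ g w) (i : Fin 2) :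
    pd i (fun x => f x + g x) w = pd i f w + pd i g w := by
  simp [pd, fderiv_fun_add hf hg]

theorem pd_const (c : E) (i : Fin 2) : pd i (fun _ : ℂ => c) w = 0 := by
  simp [pd]

theorem pd_clm (C : E →L[ℝ] F) (hf : DifferentiableAt ℝ f w) (i : Fin 2) :
    pd i (fun x => C (f x)) w = C (pd i f w) := by
  have := (C.hasFDerivAt.comp w hf.hasFDerivAt).fderiv
  simp only [Function.comp_def] at this
  simp [pd, this]

theorem pd_bilin (B : E →L[ℝ] F →L[ℝ] G) (hf : DifferentiableAt ℝ f w)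
    (hh : DifferentiableAt ℝ h w) (i : Fin 2) :
    pd i (fun x => B (f x) (h x)) w = B (pd i f w) (h w) + B (f w) (pd i h w) := by
  simp [pd, B.fderiv_of_bilinear hf hh, add_comm]

theorem pd_comm (hU : IsOpen U) (hf : ContDiffOn ℝ ∞ f U) (hw : w ∈ U) (i j : Fin 2) :
    pd i (pd j f) w = pd j (pd i f) w := by
  have hsymm : IsSymmSndFDerivAt ℝ f w :=
    (hf.contDiffAt (hU.mem_nhds hw)).isSymmSndFDerivAt
      (by rw [minSmoothness_of_isRCLikeNormedField]; exact ENat.LEInfty.out)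
  have hd : DifferentiableAt ℝ (fderiv ℝ f) w :=
    ((hf.fderiv_of_isOpen hU (m := ∞) (by simp)).contDiffAt (hU.mem_nhds hw)).differentiableAt
      (by simp)
  have key : ∀ a b : ℂ, fderiv ℝ (fun x => fderiv ℝ f x b) w a = fderiv ℝ (fderiv ℝ f) w a b := by
    intro a b
    rw [fderiv_clm_apply hd (differentiableAt_const b)]
    simp
  simp only [MobiusSurface.pd]
  change fderiv ℝ (fun x => fderiv ℝ f x (coordVec j)) w _
    = fderiv ℝ (fun x => fderiv ℝ f x (coordVec i)) w _
  rw [key, key, hsymm.eq]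

end Real

/-! ### Wirtinger derivatives: product rule, commutation, conjugation -/

section Wirtinger

variable [NormedSpace ℂ E] [NormedSpace ℂ F] [NormedSpace ℂ G]
  {U : Set ℂ} {w : ℂ} {f g : ℂ → E} {h : ℂ → F}

theorem SmoothOn.dz (hU : IsOpen U) (hf : ContDiffOn ℝ ∞ f U) : ContDiffOn ℝ ∞ (dz f) U :=
  contDiffOn_const.smul ((SmoothOn.pd hU hf 0).sub (contDiffOn_const.smul (SmoothOn.pd hU hf 1)))

theorem SmoothOn.dzbar (hU : IsOpen U) (hf : ContDiffOn ℝ ∞ f U) : ContDiffOn ℝ ∞ (dzbar f) U :=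
  contDiffOn_const.smul ((SmoothOn.pd hU hf 0).add (contDiffOn_const.smul (SmoothOn.pd hU hf 1)))

theorem SmoothOn.smul {a : ℂ → ℂ} (ha : ContDiffOn ℝ ∞ a U) (hf : ContDiffOn ℝ ∞ f U) :
    ContDiffOn ℝ ∞ (fun x => a x • f x) U := ContDiffOn.smul ha hf

theorem dz_congr (hU : IsOpen U) (hfg : Set.EqOn f g U) (hw : w ∈ U) : dz f w = dz g w := by
  simp [dz, pd_congr hU hfg hw]

theorem dzbar_congr (hU : IsOpen U) (hfg : Set.EqOn f g U) (hw : w ∈ U) :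
    dzbar f w = dzbar g w := by
  simp [dzbar, pd_congr hU hfg hw]

theorem dz_add (hf : DifferentiableAt ℝ f w) (hg : DifferentiableAt ℝ g w) :
    dz (fun x => f x + g x) w = dz f w + dz g w := by
  simp only [dz, pd_add hf hg]; module

theorem dzbar_add (hf : DifferentiableAt ℝ f w) (hg : DifferentiableAt ℝ g w) :
    dzbar (fun x => f x + g x) w = dzbar f w + dzbar g w := by
  simp only [dzbar, pd_add hf hg]; module

theorem dz_const (c : E) : dz (fun _ : ℂ => c) w = 0 := by simp [dz, pd_const]

theorem dzbar_const (c : E) : dzbar (fun _ : ℂ => c) w = 0 := by simp [dzbar, pd_const]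

theorem dz_bilin (B : E →L[ℝ] F →L[ℝ] G) (hB₁ : ∀ (c : ℂ) x y, B (c • x) y = c • B x y)
    (hB₂ : ∀ (c : ℂ) x y, B x (c • y) = c • B x y) (hf : DifferentiableAt ℝ f w)
    (hh : DifferentiableAt ℝ h w) :
    dz (fun x => B (f x) (h x)) w = B (dz f w) (h w) + B (f w) (dz h w) := by
  simp only [dz, pd_bilin B hf hh, hB₁, hB₂, map_sub, sub_apply]
  module

theorem dzbar_bilin (B : E →L[ℝ] F →L[ℝ] G) (hB₁ : ∀ (c : ℂ) x y, B (c • x) y = c • B x y)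
    (hB₂ : ∀ (c : ℂ) x y, B x (c • y) = c • B x y) (hf : DifferentiableAt ℝ f w)
    (hh : DifferentiableAt ℝ h w) :
    dzbar (fun x => B (f x) (h x)) w = B (dzbar f w) (h w) + B (f w) (dzbar h w) := by
  simp only [dzbar, pd_bilin B hf hh, hB₁, hB₂, map_add, add_apply]
  module

theorem dz_smul {a : ℂ → ℂ} (ha : DifferentiableAt ℝ a w) (hf : DifferentiableAt ℝ f w) :
    dz (fun x => a x • f x) w = dz a w • f w + a w • dz f w :=
  dz_bilin (ContinuousLinearMap.lsmul ℝ ℂ) (fun c x y => mul_smul c x y)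
    (fun c x y => smul_comm x c y) ha hf

theorem dzbar_smul {a : ℂ → ℂ} (ha : DifferentiableAt ℝ a w) (hf : DifferentiableAt ℝ f w) :
    dzbar (fun x => a x • f x) w = dzbar a w • f w + a w • dzbar f w :=
  dzbar_bilin (ContinuousLinearMap.lsmul ℝ ℂ) (fun c x y => mul_smul c x y)
    (fun c x y => smul_comm x c y) ha hf

theorem dz_mul {a b : ℂ → ℂ} (ha : DifferentiableAt ℝ a w) (hb : DifferentiableAt ℝ b w) :
    dz (fun x => a x * b x) w = dz a w * b w + a w * dz b w := dz_smul ha hb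

theorem dz_const_smul (c : ℂ) (hf : DifferentiableAt ℝ f w) :
    dz (fun x => c • f x) w = c • dz f w := by
  rw [dz_smul (differentiableAt_const c) hf, dz_const]; simp

theorem dzbar_const_smul (c : ℂ) (hf : DifferentiableAt ℝ f w) :
    dzbar (fun x => c • f x) w = c • dzbar f w := by
  rw [dzbar_smul (differentiableAt_const c) hf, dzbar_const]; simp

theorem dz_dzbar_comm (hU : IsOpen U) (hf : ContDiffOn ℝ ∞ f U) (hw : w ∈ U) :
    dz (dzbar f) w = dzbar (dz f) w := by
  have h0 := SmoothOn.differentiableAt hU (SmoothOn.pd hU hf 0) hw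
  have h1 := SmoothOn.differentiableAt hU (SmoothOn.pd hU hf 1) hw
  have hs : ∀ c : ℂ, DifferentiableAt ℝ (fun x => c • pd 1 f x) w := fun c => h1.const_smul c
  have ha : ∀ c : ℂ, DifferentiableAt ℝ (fun x => pd 0 f x + c • pd 1 f x) w :=
    fun c => h0.add (hs c)
  have e1 : dzbar f = fun x => (1 / 2 : ℂ) • (pd 0 f x + Complex.I • pd 1 f x) := rfl
  have e2 : dz f = fun x => (1 / 2 : ℂ) • (pd 0 f x + (-Complex.I) • pd 1 f x) := by
    funext x; simp [dz, sub_eq_add_neg]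
  rw [e1, e2, dz_const_smul _ (ha _), dzbar_const_smul _ (ha _), dz_add h0 (hs _), dzbar_add h0 (hs _),
    dz_const_smul _ h1, dzbar_const_smul _ h1]
  simp only [dz, dzbar, pd_comm hU hf hw 1 0]
  module

variable [StarAddMonoid E] [StarModule ℂ E] [ContinuousStar E]

theorem SmoothOn.star (hf : ContDiffOn ℝ ∞ f U) : ContDiffOn ℝ ∞ (fun x => star (f x)) U := by
  exact (starL' ℝ : E ≃L[ℝ] E).contDiff.comp_contDiffOn hf

theorem pd_star (hf : DifferentiableAt ℝ f w) (i : Fin 2) :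
    pd i (fun x => star (f x)) w = star (pd i f w) := by
  exact pd_clm ((starL' ℝ : E ≃L[ℝ] E) : E →L[ℝ] E) hf i

theorem dz_star (hf : DifferentiableAt ℝ f w) :
    dz (fun x => star (f x)) w = star (dzbar f w) := by
  simp [dz, dzbar, pd_star hf, star_smul, sub_eq_add_neg]

theorem dzbar_star (hf : DifferentiableAt ℝ f w) :
    dzbar (fun x => star (f x)) w = star (dz f w) := by
  simp [dz, dzbar, pd_star hf, star_smul, sub_eq_add_neg]

end Wirtinger

end Calculus

/-! ### The bilinear form -/

section Mink

variable {n : ℕ}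

theorem mink_comm (x y : CMink n) : mink x y = mink y x := by
  simp [mink, mul_comm]

theorem mink_add_left (x y z : CMink n) : mink (x + y) z = mink x z + mink y z := by
  simp only [mink, Pi.add_apply, add_mul, Finset.sum_add_distrib]; ring

theorem mink_add_right (x y z : CMink n) : mink z (x + y) = mink z x + mink z y := by
  rw [mink_comm, mink_add_left, mink_comm x, mink_comm y]

theorem mink_smul_left (c : ℂ) (x y : CMink n) : mink (c • x) y = c * mink x y := by
  simp only [mink, Pi.smul_apply, smul_eq_mul, mul_add, Finset.mul_sum]
  simp [mul_assoc]

theorem mink_smul_right (c : ℂ) (x y : CMink n) : mink x (c • y) = c * mink x y := by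
  rw [mink_comm, mink_smul_left, mink_comm]

theorem mink_neg_left (x y : CMink n) : mink (-x) y = -mink x y := by
  simpa using mink_smul_left (-1) x y

theorem mink_neg_right (x y : CMink n) : mink x (-y) = -mink x y := by
  simpa using mink_smul_right (-1) x y

theorem mink_sub_left (x y z : CMink n) : mink (x - y) z = mink x z - mink y z := by
  rw [sub_eq_add_neg, mink_add_left, mink_neg_left, sub_eq_add_neg]

theorem mink_sub_right (x y z : CMink n) : mink z (x - y) = mink z x - mink z y := by
  rw [sub_eq_add_neg, mink_add_right, mink_neg_right, sub_eq_add_neg]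

theorem mink_zero_left (x : CMink n) : mink 0 x = 0 := by simp [mink]

theorem mink_zero_right (x : CMink n) : mink x 0 = 0 := by simp [mink]

theorem mink_star (x y : CMink n) : star (mink x y) = mink (star x) (star y) := by
  simp [mink]

/-- The form `mink` as a continuous bilinear map over `ℝ`. -/
def minkL (n : ℕ) : CMink n →L[ℝ] CMink n →L[ℝ] ℂ :=
  (LinearMap.mk₂ ℝ mink mink_add_left
    (fun c x y => by simpa using mink_smul_left (c : ℂ) x y)
    (fun x y z => mink_add_right y z x)
    (fun c x y => by simpa using mink_smul_right (c : ℂ) x y)).toContinuousBilinearMap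

variable {U : Set ℂ} {w : ℂ} {f g : ℂ → CMink n}

theorem SmoothOn.mink (hf : ContDiffOn ℝ ∞ f U) (hg : ContDiffOn ℝ ∞ g U) :
    ContDiffOn ℝ ∞ (fun x => mink (f x) (g x)) U :=
  (((minkL n).contDiff).comp_contDiffOn hf).clm_apply hg

theorem dz_mink (hf : DifferentiableAt ℝ f w) (hg : DifferentiableAt ℝ g w) :
    dz (fun x => mink (f x) (g x)) w = mink (dz f w) (g w) + mink (f w) (dz g w) :=
  dz_bilin (minkL n) mink_smul_left (fun c x y => mink_smul_right c x y) hf hg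

theorem dzbar_mink (hf : DifferentiableAt ℝ f w) (hg : DifferentiableAt ℝ g w) :
    dzbar (fun x => mink (f x) (g x)) w = mink (dzbar f w) (g w) + mink (f w) (dzbar g w) :=
  dzbar_bilin (minkL n) mink_smul_left (fun c x y => mink_smul_right c x y) hf hg

/-- The source of almost all frame products below: differentiating a constant product moves the
derivative to the other factor with a sign. -/
theorem mink_dz_of_const (hU : IsOpen U) (hf : ContDiffOn ℝ ∞ f U) (hg : ContDiffOn ℝ ∞ g U)
    {c : ℂ} (h : ∀ x ∈ U, mink (f x) (g x) = c) (hw : w ∈ U) :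
    mink (dz f w) (g w) = -mink (f w) (dz g w) := by
  have := dz_congr hU (f := fun x => mink (f x) (g x)) (g := fun _ => c) h hw
  rw [dz_mink (SmoothOn.differentiableAt hU hf hw) (SmoothOn.differentiableAt hU hg hw),
    dz_const] at this
  exact eq_neg_of_add_eq_zero_left this

theorem mink_dzbar_of_const (hU : IsOpen U) (hf : ContDiffOn ℝ ∞ f U) (hg : ContDiffOn ℝ ∞ g U)
    {c : ℂ} (h : ∀ x ∈ U, mink (f x) (g x) = c) (hw : w ∈ U) :
    mink (dzbar f w) (g w) = -mink (f w) (dzbar g w) := by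
  have := dzbar_congr hU (f := fun x => mink (f x) (g x)) (g := fun _ => c) h hw
  rw [dzbar_mink (SmoothOn.differentiableAt hU hf hw) (SmoothOn.differentiableAt hU hg hw),
    dzbar_const] at this
  exact eq_neg_of_add_eq_zero_left this

end Mink

/-! ### The moving frame of a canonical lift -/

/-- A real smooth lift into the light cone, normalized with respect to the coordinate. -/
structure IsCanonical {n : ℕ} (U : Set ℂ) (Y : ℂ → CMink n) : Prop where
  isOpen : IsOpen U
  smooth : ContDiffOn ℝ ∞ Y U
  real : ∀ w ∈ U, star (Y w) = Y w
  null : ∀ w ∈ U, mink (Y w) (Y w) = 0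
  conformal : ∀ w ∈ U, mink (dz Y w) (dz Y w) = 0
  normalized : ∀ w ∈ U, mink (dz Y w) (dzbar Y w) = 1 / 2

/-- The Willmore tensor `D_z̄ D_z̄ κ + (s̄/2) κ`. -/
def willmoreTensor {n : ℕ} (Y : ℂ → CMink n) (w : ℂ) : CMink n :=
  normalDzbar Y (normalDzbar Y (hopf Y)) w + (conj (schwarzian Y w) / 2) • hopf Y w

theorem normalProj_add {n : ℕ} (Y : ℂ → CMink n) (w : ℂ) (x y : CMink n) :
    normalProj Y w (x + y) = normalProj Y w x + normalProj Y w y := by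
  simp only [normalProj, mink_add_left]; module

theorem normalProj_smul {n : ℕ} (Y : ℂ → CMink n) (w : ℂ) (c : ℂ) (x : CMink n) :
    normalProj Y w (c • x) = c • normalProj Y w x := by
  simp only [normalProj, mink_smul_left]; module

theorem eq_normalProj_add {n : ℕ} (Y : ℂ → CMink n) (w : ℂ) (x : CMink n) :
    x = normalProj Y w x - mink x (frameN Y w) • Y w - mink x (Y w) • frameN Y w
      + (2 * mink x (dzbar Y w)) • dz Y w + (2 * mink x (dz Y w)) • dzbar Y w := by
  simp only [normalProj]; module

namespace IsCanonical

variable {n : ℕ} {U : Set ℂ} {Y : ℂ → CMink n} (h : IsCanonical U Y) {w : ℂ}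
include h

theorem smooth_dz : ContDiffOn ℝ ∞ (dz Y) U := SmoothOn.dz h.isOpen h.smooth

theorem smooth_dzbar : ContDiffOn ℝ ∞ (dzbar Y) U := SmoothOn.dzbar h.isOpen h.smooth

theorem smooth_dzdz : ContDiffOn ℝ ∞ (dz (dz Y)) U := SmoothOn.dz h.isOpen h.smooth_dz

theorem smooth_dzbardz : ContDiffOn ℝ ∞ (dzbar (dz Y)) U := SmoothOn.dzbar h.isOpen h.smooth_dz

theorem smooth_frameN : ContDiffOn ℝ ∞ (frameN Y) U :=
  ((contDiffOn_const (c := (2 : ℂ))).smul h.smooth_dzbardz).add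
    (((contDiffOn_const (c := (2 : ℂ))).mul (SmoothOn.mink h.smooth_dzbardz h.smooth_dzbardz)).smul h.smooth)

theorem smooth_schwarzian : ContDiffOn ℝ ∞ (schwarzian Y) U :=
  contDiffOn_const.mul (SmoothOn.mink h.smooth_dzdz h.smooth_frameN)

theorem smooth_hopf : ContDiffOn ℝ ∞ (hopf Y) U :=
  h.smooth_dzdz.add ((h.smooth_schwarzian.div_const 2).smul h.smooth)

theorem smooth_normalProj {f : ℂ → CMink n} (hf : ContDiffOn ℝ ∞ f U) :
    ContDiffOn ℝ ∞ (fun w => normalProj Y w (f w)) U := by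
  have := h.smooth_frameN
  have := h.smooth_dz
  have := h.smooth_dzbar
  exact (((hf.add ((SmoothOn.mink hf h.smooth_frameN).smul h.smooth)).add
    ((SmoothOn.mink hf h.smooth).smul h.smooth_frameN)).sub
    ((contDiffOn_const.mul (SmoothOn.mink hf h.smooth_dzbar)).smul h.smooth_dz)).sub
    ((contDiffOn_const.mul (SmoothOn.mink hf h.smooth_dz)).smul h.smooth_dzbar)

theorem smooth_normalDzbar {f : ℂ → CMink n} (hf : ContDiffOn ℝ ∞ f U) :
    ContDiffOn ℝ ∞ (normalDzbar Y f) U :=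
  h.smooth_normalProj (SmoothOn.dzbar h.isOpen hf)

theorem diff {E : Type*} [NormedAddCommGroup E] [NormedSpace ℝ E] {f : ℂ → E}
    (hf : ContDiffOn ℝ ∞ f U) (hw : w ∈ U) : DifferentiableAt ℝ f w :=
  SmoothOn.differentiableAt h.isOpen hf hw

theorem star_dz (hw : w ∈ U) : star (dz Y w) = dzbar Y w := by
  rw [← dzbar_star (h.diff h.smooth hw)]
  exact dzbar_congr h.isOpen h.real hw

theorem star_dzbar (hw : w ∈ U) : star (dzbar Y w) = dz Y w := by
  rw [← h.star_dz hw, star_star]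

theorem dz_dzbar (hw : w ∈ U) : dz (dzbar Y) w = dzbar (dz Y) w :=
  dz_dzbar_comm h.isOpen h.smooth hw

theorem star_dzbardz (hw : w ∈ U) : star (dzbar (dz Y) w) = dzbar (dz Y) w := by
  rw [← dz_star (h.diff h.smooth_dz hw), ← h.dz_dzbar hw]
  exact dz_congr h.isOpen (fun x hx => h.star_dz hx) hw

theorem star_dzdz (hw : w ∈ U) : star (dz (dz Y) w) = dzbar (dzbar Y) w := by
  rw [← dzbar_star (h.diff h.smooth_dz hw)]
  exact dzbar_congr h.isOpen (fun x hx => h.star_dz hx) hw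

theorem mink_dz_self (hw : w ∈ U) : mink (dz Y w) (Y w) = 0 := by
  have := mink_dz_of_const h.isOpen h.smooth h.smooth h.null hw
  rw [mink_comm (Y w)] at this
  linear_combination this / 2

theorem mink_dzbar_self (hw : w ∈ U) : mink (dzbar Y w) (Y w) = 0 := by
  have := mink_dzbar_of_const h.isOpen h.smooth h.smooth h.null hw
  rw [mink_comm (Y w)] at this
  linear_combination this / 2

theorem mink_dzbar_dzbar (hw : w ∈ U) : mink (dzbar Y w) (dzbar Y w) = 0 := by
  rw [← h.star_dz hw, ← mink_star, h.conformal w hw, star_zero]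

theorem mink_dzbardz_self (hw : w ∈ U) : mink (dzbar (dz Y) w) (Y w) = -(1 / 2) := by
  rw [mink_dzbar_of_const h.isOpen h.smooth_dz h.smooth (fun x hx => h.mink_dz_self hx) hw,
    h.normalized w hw]

theorem mink_dzbardz_dz (hw : w ∈ U) : mink (dzbar (dz Y) w) (dz Y w) = 0 := by
  have := mink_dzbar_of_const h.isOpen h.smooth_dz h.smooth_dz h.conformal hw
  rw [mink_comm (dz Y w)] at this
  linear_combination this / 2

theorem mink_dzbardz_dzbar (hw : w ∈ U) : mink (dzbar (dz Y) w) (dzbar Y w) = 0 := by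
  rw [← h.star_dz hw, ← h.star_dzbardz hw, ← mink_star, h.mink_dzbardz_dz hw, star_zero]

theorem mink_dzdz_self (hw : w ∈ U) : mink (dz (dz Y) w) (Y w) = 0 := by
  rw [mink_dz_of_const h.isOpen h.smooth_dz h.smooth (fun x hx => h.mink_dz_self hx) hw,
    h.conformal w hw, neg_zero]

theorem mink_dzdz_dz (hw : w ∈ U) : mink (dz (dz Y) w) (dz Y w) = 0 := by
  have := mink_dz_of_const h.isOpen h.smooth_dz h.smooth_dz h.conformal hw
  rw [mink_comm (dz Y w)] at this
  linear_combination this / 2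

theorem mink_dzdz_dzbar (hw : w ∈ U) : mink (dz (dz Y) w) (dzbar Y w) = 0 := by
  rw [mink_dz_of_const h.isOpen h.smooth_dz h.smooth_dzbar h.normalized hw, h.dz_dzbar hw,
    mink_comm, h.mink_dzbardz_dz hw, neg_zero]

theorem star_frameN (hw : w ∈ U) : star (frameN Y w) = frameN Y w := by
  simp [frameN, star_smul, mink_star, h.star_dzbardz hw, h.real w hw]

theorem mink_self_frameN (hw : w ∈ U) : mink (Y w) (frameN Y w) = -1 := by
  rw [mink_comm]
  simp only [frameN, mink_add_left, mink_smul_left, h.mink_dzbardz_self hw, h.null w hw]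
  ring

theorem mink_dz_frameN (hw : w ∈ U) : mink (dz Y w) (frameN Y w) = 0 := by
  simp only [frameN, mink_add_right, mink_smul_right, h.mink_dz_self hw, mink_comm (dz Y w)
    (dzbar _ _), h.mink_dzbardz_dz hw]
  ring

theorem mink_dzbar_frameN (hw : w ∈ U) : mink (dzbar Y w) (frameN Y w) = 0 := by
  simp only [frameN, mink_add_right, mink_smul_right, h.mink_dzbar_self hw, mink_comm (dzbar Y w)
    (dzbar _ _), h.mink_dzbardz_dzbar hw]
  ring

theorem mink_frameN_frameN (hw : w ∈ U) : mink (frameN Y w) (frameN Y w) = 0 := by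
  simp only [frameN, mink_add_right, mink_add_left, mink_smul_left, mink_smul_right,
    h.mink_dzbardz_self hw, mink_comm (Y w) (dzbar _ _), h.null w hw]
  ring

/-- Differentiating $\langle Y_{zz},Y_{\bar z}\rangle=0$ by $\bar z$ and $\langle Y_{z\bar
z},Y_{\bar z}\rangle=0$ by $z$ produces the same third-order term, so $\langle Y_{zz},Y_{\bar z\bar
z}\rangle=\langle Y_{z\bar z},Y_{z\bar z}\rangle$. Replacing $Y_{zz}$ by $\kappa$ changes it only by
multiples of $Y$, which do not contribute. -/
theorem mink_dzbardz_dzbardz (hw : w ∈ U) :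
    mink (dzbar (dz Y) w) (dzbar (dz Y) w) = mink (hopf Y w) (star (hopf Y w)) := by
  have h1 := mink_dzbar_of_const h.isOpen h.smooth_dzdz h.smooth_dzbar
    (fun x hx => h.mink_dzdz_dzbar hx) hw
  have h2 := mink_dz_of_const h.isOpen h.smooth_dzbardz h.smooth_dzbar
    (fun x hx => h.mink_dzbardz_dzbar hx) hw
  rw [h.dz_dzbar hw, dz_dzbar_comm h.isOpen h.smooth_dz hw] at h2
  have h3 : mink (Y w) (dzbar (dzbar Y) w) = 0 := by
    rw [← h.star_dzdz hw, ← h.real w hw, ← mink_star, mink_comm, h.mink_dzdz_self hw, star_zero]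
  have h4 := h.mink_dzdz_self hw
  simp only [hopf, star_add, star_smul, h.star_dzdz hw, h.real w hw, mink_add_left,
    mink_add_right, mink_smul_left, mink_smul_right, h.null w hw, h3, h4]
  linear_combination h2 - h1

theorem dzbardz_eq (hw : w ∈ U) : dzbar (dz Y) w
    = (1 / 2 : ℂ) • frameN Y w - mink (hopf Y w) (star (hopf Y w)) • Y w := by
  rw [← h.mink_dzbardz_dzbardz hw, frameN]
  module

omit h in
theorem dzdz_eq : dz (dz Y) w = hopf Y w - (schwarzian Y w / 2) • Y w := by
  simp [hopf]

theorem mink_hopf_self (hw : w ∈ U) : mink (hopf Y w) (Y w) = 0 := by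
  simp [hopf, mink_add_left, mink_smul_left, h.mink_dzdz_self hw, h.null w hw]

theorem mink_hopf_dz (hw : w ∈ U) : mink (hopf Y w) (dz Y w) = 0 := by
  simp [hopf, mink_add_left, mink_smul_left, h.mink_dzdz_dz hw, mink_comm (Y w),
    h.mink_dz_self hw]

theorem mink_hopf_dzbar (hw : w ∈ U) : mink (hopf Y w) (dzbar Y w) = 0 := by
  simp [hopf, mink_add_left, mink_smul_left, h.mink_dzdz_dzbar hw, mink_comm (Y w),
    h.mink_dzbar_self hw]

theorem mink_hopf_frameN (hw : w ∈ U) : mink (hopf Y w) (frameN Y w) = 0 := by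
  simp only [hopf, mink_add_left, mink_smul_left, h.mink_self_frameN hw, schwarzian]
  ring

omit h in
theorem normalProj_of_orthogonal {x : CMink n} (h1 : mink x (Y w) = 0) (h2 : mink x (dz Y w) = 0)
    (h3 : mink x (dzbar Y w) = 0) (h4 : mink x (frameN Y w) = 0) : normalProj Y w x = x := by
  simp [normalProj, h1, h2, h3, h4]

theorem normalProj_hopf (hw : w ∈ U) : normalProj Y w (hopf Y w) = hopf Y w :=
  normalProj_of_orthogonal (h.mink_hopf_self hw) (h.mink_hopf_dz hw) (h.mink_hopf_dzbar hw)
    (h.mink_hopf_frameN hw)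

theorem normalProj_self (hw : w ∈ U) : normalProj Y w (Y w) = 0 := by
  simp [normalProj, h.null w hw, h.mink_self_frameN hw, mink_comm (Y w), h.mink_dz_self hw,
    h.mink_dzbar_self hw]

theorem normalProj_dz (hw : w ∈ U) : normalProj Y w (dz Y w) = 0 := by
  simp [normalProj, h.mink_dz_self hw, h.mink_dz_frameN hw, h.conformal w hw, h.normalized w hw]

theorem normalProj_dzbar (hw : w ∈ U) : normalProj Y w (dzbar Y w) = 0 := by
  simp [normalProj, h.mink_dzbar_self hw, h.mink_dzbar_frameN hw, h.mink_dzbar_dzbar hw,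
    mink_comm (dzbar Y w) (dz Y w), h.normalized w hw]

theorem normalProj_frameN (hw : w ∈ U) : normalProj Y w (frameN Y w) = 0 := by
  simp [normalProj, h.mink_frameN_frameN hw, mink_comm (frameN Y w), h.mink_self_frameN hw,
    h.mink_dz_frameN hw, h.mink_dzbar_frameN hw]

theorem normalProj_dzbardz (hw : w ∈ U) : normalProj Y w (dzbar (dz Y) w) = 0 := by
  rw [h.dzbardz_eq hw, sub_eq_add_neg, ← neg_smul, normalProj_add, normalProj_smul, normalProj_smul]
  simp [h.normalProj_self hw, h.normalProj_frameN hw]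

theorem mink_normalProj_self (hw : w ∈ U) (x : CMink n) : mink (normalProj Y w x) (Y w) = 0 := by
  simp only [normalProj, mink_add_left, mink_sub_left, mink_smul_left, h.null w hw,
    h.mink_dz_self hw, h.mink_dzbar_self hw, mink_comm (frameN Y w) (Y w), h.mink_self_frameN hw]
  ring

theorem mink_normalProj_dz (hw : w ∈ U) (x : CMink n) :
    mink (normalProj Y w x) (dz Y w) = 0 := by
  simp only [normalProj, mink_add_left, mink_sub_left, mink_smul_left, mink_comm (Y w) (dz Y w),
    h.mink_dz_self hw, h.conformal w hw, mink_comm (dzbar Y w) (dz Y w), h.normalized w hw,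
    mink_comm (frameN Y w) (dz Y w), h.mink_dz_frameN hw]
  ring

theorem mink_normalProj_dzbar (hw : w ∈ U) (x : CMink n) :
    mink (normalProj Y w x) (dzbar Y w) = 0 := by
  simp only [normalProj, mink_add_left, mink_sub_left, mink_smul_left,
    mink_comm (Y w) (dzbar Y w), h.mink_dzbar_self hw, h.mink_dzbar_dzbar hw, h.normalized w hw,
    mink_comm (frameN Y w) (dzbar Y w), h.mink_dzbar_frameN hw]
  ring

theorem mink_normalProj_frameN (hw : w ∈ U) (x : CMink n) :
    mink (normalProj Y w x) (frameN Y w) = 0 := by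
  simp only [normalProj, mink_add_left, mink_sub_left, mink_smul_left, h.mink_self_frameN hw,
    h.mink_frameN_frameN hw, h.mink_dz_frameN hw, h.mink_dzbar_frameN hw]
  ring

theorem normalProj_normalProj (hw : w ∈ U) (x : CMink n) :
    normalProj Y w (normalProj Y w x) = normalProj Y w x :=
  normalProj_of_orthogonal (h.mink_normalProj_self hw x) (h.mink_normalProj_dz hw x)
    (h.mink_normalProj_dzbar hw x) (h.mink_normalProj_frameN hw x)

theorem star_normalProj (hw : w ∈ U) (x : CMink n) :
    star (normalProj Y w x) = normalProj Y w (star x) := by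
  simp only [normalProj, star_add, star_sub, star_smul, star_mul', mink_star, h.real w hw,
    h.star_frameN hw, h.star_dz hw, h.star_dzbar hw, star_ofNat]
  abel

omit h in
/-- A vector is determined by its normal part and its products with the frame. -/
theorem eq_smul_self_of {x : CMink n} (h0 : normalProj Y w x = 0)
    (h1 : mink x (Y w) = 0) (h2 : mink x (dz Y w) = 0) (h3 : mink x (dzbar Y w) = 0) :
    x = (-mink x (frameN Y w)) • Y w := by
  conv_lhs => rw [eq_normalProj_add Y w x, h0, h1, h2, h3]
  simp

/-- Tangential coefficients come from differentiating the products of $N$ with the frame. The normal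
one comes from $N\equiv 2Y_{z\bar z}$ modulo $Y$ together with $Y_{z\bar zz}=Y_{zz\bar z}$, whose
normal part is $D_{\bar z}\kappa$. -/
theorem dz_frameN_eq (hw : w ∈ U) : dz (frameN Y) w
    = (2 : ℂ) • normalDzbar Y (hopf Y) w - (2 * mink (hopf Y w) (star (hopf Y w))) • dz Y w
      - schwarzian Y w • dzbar Y w := by
  have hM := h.diff h.smooth_dzbardz hw
  have hmm := h.diff (SmoothOn.mink h.smooth_dzbardz h.smooth_dzbardz) hw
  have hY := h.diff h.smooth hw
  have e1 : dz (frameN Y) w = (2 : ℂ) • dz (dzbar (dz Y)) w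
      + (dz (fun x => 2 * mink (dzbar (dz Y) x) (dzbar (dz Y) x)) w • Y w
        + (2 * mink (dzbar (dz Y) w) (dzbar (dz Y) w)) • dz Y w) := by
    have : frameN Y = fun x => (2 : ℂ) • dzbar (dz Y) x
        + (2 * mink (dzbar (dz Y) x) (dzbar (dz Y) x)) • Y x := rfl
    have h2mm := hmm.const_mul (2 : ℂ)
    rw [this, dz_add (hM.fun_const_smul _) (h2mm.fun_smul hY), dz_const_smul _ hM, dz_smul h2mm hY]
  have e2 : dzbar (hopf Y) w = dzbar (dz (dz Y)) w
      + (dzbar (fun x => schwarzian Y x / 2) w • Y w + (schwarzian Y w / 2) • dzbar Y w) := by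
    have hs := h.diff (h.smooth_schwarzian.div_const 2) hw
    have : hopf Y = fun x => dz (dz Y) x + (schwarzian Y x / 2) • Y x := rfl
    rw [this, dzbar_add (h.diff h.smooth_dzdz hw) (hs.fun_smul hY), dzbar_smul hs hY]
  have e3 : normalProj Y w (dz (frameN Y) w) = (2 : ℂ) • normalDzbar Y (hopf Y) w := by
    rw [normalDzbar, e1, e2, dz_dzbar_comm h.isOpen h.smooth_dz hw]
    simp [normalProj_add, normalProj_smul, h.normalProj_self hw, h.normalProj_dz hw,
      h.normalProj_dzbar hw]
  have p1 : mink (dz (frameN Y) w) (frameN Y w) = 0 := by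
    have := mink_dz_of_const h.isOpen h.smooth_frameN h.smooth_frameN
      (fun x hx => h.mink_frameN_frameN hx) hw
    rw [mink_comm (frameN Y w)] at this
    linear_combination this / 2
  have p2 : mink (dz (frameN Y) w) (Y w) = 0 := by
    have := mink_dz_of_const h.isOpen h.smooth h.smooth_frameN
      (fun x hx => h.mink_self_frameN hx) hw
    rw [h.mink_dz_frameN hw, mink_comm] at this
    linear_combination this
  have p3 : mink (dz (frameN Y) w) (dzbar Y w) = -mink (hopf Y w) (star (hopf Y w)) := by
    have := mink_dz_of_const h.isOpen h.smooth_dzbar h.smooth_frameN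
      (fun x hx => h.mink_dzbar_frameN hx) hw
    rw [h.dz_dzbar hw, mink_comm (dzbar Y w), h.dzbardz_eq hw] at this
    simp only [mink_sub_left, mink_smul_left, h.mink_frameN_frameN hw,
      h.mink_self_frameN hw] at this
    linear_combination this
  have p4 : mink (dz (frameN Y) w) (dz Y w) = -(schwarzian Y w / 2) := by
    have := mink_dz_of_const h.isOpen h.smooth_dz h.smooth_frameN
      (fun x hx => h.mink_dz_frameN hx) hw
    rw [mink_comm (dz Y w)] at this
    rw [schwarzian]
    linear_combination this
  conv_lhs => rw [eq_normalProj_add Y w (dz (frameN Y) w), e3, p1, p2, p3, p4]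
  module

theorem normalDzbar_add {f g : ℂ → CMink n} (hf : ContDiffOn ℝ ∞ f U) (hg : ContDiffOn ℝ ∞ g U)
    (hw : w ∈ U) :
    normalDzbar Y (fun x => f x + g x) w = normalDzbar Y f w + normalDzbar Y g w := by
  rw [normalDzbar, dzbar_add (h.diff hf hw) (h.diff hg hw), normalProj_add]
  rfl

theorem normalDzbar_smul {a : ℂ → ℂ} {f : ℂ → CMink n} (ha : ContDiffOn ℝ ∞ a U)
    (hf : ContDiffOn ℝ ∞ f U) (hw : w ∈ U) :
    normalDzbar Y (fun x => a x • f x) w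
      = dzbar a w • normalProj Y w (f w) + a w • normalDzbar Y f w := by
  rw [normalDzbar, dzbar_smul (h.diff ha hw) (h.diff hf hw), normalProj_add, normalProj_smul,
    normalProj_smul]
  rfl

theorem normalDzbar_congr {f g : ℂ → CMink n} (hfg : Set.EqOn f g U) (hw : w ∈ U) :
    normalDzbar Y f w = normalDzbar Y g w := by
  rw [normalDzbar, dzbar_congr h.isOpen hfg hw, normalDzbar]

theorem normalDzbar_smul_self {a : ℂ → ℂ} (ha : ContDiffOn ℝ ∞ a U) (hw : w ∈ U) :
    normalDzbar Y (fun x => a x • Y x) w = 0 := by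
  rw [h.normalDzbar_smul ha h.smooth hw, normalDzbar, h.normalProj_self hw,
    h.normalProj_dzbar hw, smul_zero, smul_zero, add_zero]

theorem normalDzbar_smul_dz {a : ℂ → ℂ} (ha : ContDiffOn ℝ ∞ a U) (hw : w ∈ U) :
    normalDzbar Y (fun x => a x • dz Y x) w = 0 := by
  rw [h.normalDzbar_smul ha h.smooth_dz hw, normalDzbar, h.normalProj_dz hw,
    h.normalProj_dzbardz hw, smul_zero, smul_zero, add_zero]

/-- Terms in $Y$ and $Y_z$ are invisible to $D_{\bar z}$ because $Y_{\bar z}$ and $Y_{z\bar z}$ lie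
in $V$. A term in $Y_{\bar z}$ would not be, since $Y_{\bar z\bar z}$ contains $\bar\kappa$. -/
theorem normalDzbar_add_tangential {f : ℂ → CMink n} {a b : ℂ → ℂ} (hf : ContDiffOn ℝ ∞ f U)
    (ha : ContDiffOn ℝ ∞ a U) (hb : ContDiffOn ℝ ∞ b U) (hw : w ∈ U) :
    normalDzbar Y (fun x => f x + (a x • Y x + b x • dz Y x)) w = normalDzbar Y f w := by
  rw [h.normalDzbar_add hf ((SmoothOn.smul ha h.smooth).add (SmoothOn.smul hb h.smooth_dz)) hw,
    h.normalDzbar_add (SmoothOn.smul ha h.smooth) (SmoothOn.smul hb h.smooth_dz) hw, h.normalDzbar_smul_self ha hw,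
    h.normalDzbar_smul_dz hb hw, add_zero, add_zero]

theorem dzbardzbar_eq (hw : w ∈ U) :
    dzbar (dzbar Y) w = star (hopf Y w) - (conj (schwarzian Y w) / 2) • Y w := by
  rw [← h.star_dzdz hw, dzdz_eq]
  simp [star_smul, h.real w hw]

theorem star_normalProj_hopf (hw : w ∈ U) : normalProj Y w (star (hopf Y w)) = star (hopf Y w) := by
  rw [← h.star_normalProj hw, h.normalProj_hopf hw]

theorem mink_star_hopf_self (hw : w ∈ U) : mink (star (hopf Y w)) (Y w) = 0 := by
  rw [← h.real w hw, ← mink_star, h.mink_hopf_self hw, star_zero]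

theorem star_dz_frameN (hw : w ∈ U) : dzbar (frameN Y) w = star (dz (frameN Y) w) := by
  rw [← dzbar_star (h.diff h.smooth_frameN hw)]
  exact dzbar_congr h.isOpen (fun x hx => (h.star_frameN hx).symm) hw

theorem dzbar_hopf_eq (hw : w ∈ U) : dzbar (hopf Y) w = normalDzbar Y (hopf Y) w
    + ((2 * mink (hopf Y w) (star (normalDzbar Y (hopf Y) w))) • Y w
      + (-(2 * mink (hopf Y w) (star (hopf Y w)))) • dz Y w) := by
  have p1 : mink (dzbar (hopf Y) w) (frameN Y w)
      = -(2 * mink (hopf Y w) (star (normalDzbar Y (hopf Y) w))) := by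
    rw [mink_dzbar_of_const h.isOpen h.smooth_hopf h.smooth_frameN
      (fun x hx => h.mink_hopf_frameN hx) hw, h.star_dz_frameN hw, h.dz_frameN_eq hw]
    simp [star_smul, mink_sub_right, mink_smul_right, h.star_dz hw, h.star_dzbar hw,
      h.mink_hopf_dzbar hw, h.mink_hopf_dz hw]
  have p2 : mink (dzbar (hopf Y) w) (Y w) = 0 := by
    rw [mink_dzbar_of_const h.isOpen h.smooth_hopf h.smooth
      (fun x hx => h.mink_hopf_self hx) hw, h.mink_hopf_dzbar hw, neg_zero]
  have p3 : mink (dzbar (hopf Y) w) (dzbar Y w) = -mink (hopf Y w) (star (hopf Y w)) := by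
    rw [mink_dzbar_of_const h.isOpen h.smooth_hopf h.smooth_dzbar
      (fun x hx => h.mink_hopf_dzbar hx) hw, h.dzbardzbar_eq hw, mink_sub_right, mink_smul_right,
      h.mink_hopf_self hw]
    ring
  have p4 : mink (dzbar (hopf Y) w) (dz Y w) = 0 := by
    rw [mink_dzbar_of_const h.isOpen h.smooth_hopf h.smooth_dz
      (fun x hx => h.mink_hopf_dz hx) hw, h.dzbardz_eq hw, mink_sub_right, mink_smul_right,
      mink_smul_right, h.mink_hopf_self hw, h.mink_hopf_frameN hw]
    ring
  conv_lhs => rw [eq_normalProj_add Y w (dzbar (hopf Y) w), p1, p2, p3, p4]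
  rw [normalDzbar]
  module

theorem normalDzbar_dzbar_hopf (hw : w ∈ U) :
    normalDzbar Y (dzbar (hopf Y)) w = normalDzbar Y (normalDzbar Y (hopf Y)) w := by
  have hD := h.smooth_normalDzbar h.smooth_hopf
  rw [h.normalDzbar_congr (fun x hx => h.dzbar_hopf_eq hx) hw]
  exact h.normalDzbar_add_tangential hD
    (contDiffOn_const.mul (SmoothOn.mink h.smooth_hopf (SmoothOn.star hD)))
    (contDiffOn_const.mul (SmoothOn.mink h.smooth_hopf (SmoothOn.star h.smooth_hopf))).neg hw

/-- The Codazzi equation: the Willmore tensor is real. -/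
theorem star_willmoreTensor (hw : w ∈ U) : star (willmoreTensor Y w) = willmoreTensor Y w := by
  have hs := h.smooth_schwarzian.div_const 2
  have hsY : ContDiffOn ℝ ∞ (fun x => -(schwarzian Y x / 2) • Y x) U := hs.neg.smul h.smooth
  -- $W$ is the normal part of $Y_{zz\bar z\bar z}$ plus $\frac s2\bar\kappa+\frac{\bar s}2\kappa$;
  -- both are visibly real once mixed derivatives commute.
  have key : willmoreTensor Y w = normalProj Y w (dzbar (dzbar (dz (dz Y))) w)
      + (schwarzian Y w / 2) • star (hopf Y w) + (conj (schwarzian Y w) / 2) • hopf Y w := by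
    have e1 : Set.EqOn (dzbar (dz (dz Y)))
        (fun x => dzbar (hopf Y) x + (dzbar (fun x => -(schwarzian Y x / 2)) x • Y x
          + -(schwarzian Y x / 2) • dzbar Y x)) U := by
      intro x hx
      have : dz (dz Y) = fun x => hopf Y x + -(schwarzian Y x / 2) • Y x := by
        funext y; rw [dzdz_eq]; module
      rw [this, dzbar_add (h.diff h.smooth_hopf hx) (h.diff hsY hx),
        dzbar_smul (h.diff hs.neg hx) (h.diff h.smooth hx)]
    have e2 : normalProj Y w (dzbar (dzbar (dz (dz Y))) w)
        = normalDzbar Y (dzbar (hopf Y)) w + -(schwarzian Y w / 2) • star (hopf Y w) := by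
      change normalDzbar Y (dzbar (dz (dz Y))) w = _
      have hk := SmoothOn.dzbar h.isOpen h.smooth_hopf
      have hds := SmoothOn.dzbar h.isOpen hs.neg
      rw [h.normalDzbar_congr e1 hw, h.normalDzbar_add hk
        ((SmoothOn.smul hds h.smooth).add (SmoothOn.smul hs.neg h.smooth_dzbar)) hw,
        h.normalDzbar_add (SmoothOn.smul hds h.smooth) (SmoothOn.smul hs.neg h.smooth_dzbar) hw,
        h.normalDzbar_smul_self hds hw, h.normalDzbar_smul hs.neg h.smooth_dzbar hw,
        h.normalProj_dzbar hw, normalDzbar, normalDzbar, h.dzbardzbar_eq hw, sub_eq_add_neg,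
        ← neg_smul, normalProj_add, normalProj_smul, h.normalProj_self hw,
        h.star_normalProj_hopf hw]
      simp
    rw [e2, h.normalDzbar_dzbar_hopf hw, willmoreTensor]
    module
  have hreal : star (dzbar (dzbar (dz (dz Y))) w) = dzbar (dzbar (dz (dz Y))) w := by
    have c1 : ∀ x ∈ U, star (dzbar (dz (dz Y)) x) = dz (dzbar (dzbar Y)) x := by
      intro x hx
      rw [← dz_star (h.diff h.smooth_dzdz hx)]
      exact dz_congr h.isOpen (fun y hy => h.star_dzdz hy) hx
    have c2 : Set.EqOn (dz (dzbar (dzbar Y))) (dzbar (dzbar (dz Y))) U := by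
      intro x hx
      rw [dz_dzbar_comm h.isOpen h.smooth_dzbar hx]
      exact dzbar_congr h.isOpen (fun y hy => h.dz_dzbar hy) hx
    have c3 : Set.EqOn (dz (dzbar (dz Y))) (dzbar (dz (dz Y))) U := fun x hx =>
      dz_dzbar_comm h.isOpen h.smooth_dz hx
    rw [← dz_star (h.diff (SmoothOn.dzbar h.isOpen h.smooth_dzdz) hw)]
    rw [dz_congr h.isOpen (fun x hx => c1 x hx) hw, dz_congr h.isOpen c2 hw,
      dz_dzbar_comm h.isOpen h.smooth_dzbardz hw, dzbar_congr h.isOpen c3 hw]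
  rw [key]
  simp only [star_add, h.star_normalProj hw, hreal, star_smul, star_star]
  simp only [RCLike.star_def, map_div₀, Complex.conj_conj, map_ofNat]
  module

end IsCanonical

/-! ### Adjoint transforms of a canonical lift -/

/-- The light-like vector `Y_z + (μ/2) Y`, which is orthogonal to the adjoint lift. -/
def contactVec {n : ℕ} (Y : ℂ → CMink n) (μ : ℂ → ℂ) (w : ℂ) : CMink n :=
  dz Y w + (μ w / 2) • Y w

/-- The vector `Ŷ_z - (μ/2) Ŷ`. -/
def adjointTangent {n : ℕ} (Y : ℂ → CMink n) (μ : ℂ → ℂ) (w : ℂ) : CMink n :=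
  dz (adjointLift Y μ) w + (-(μ w / 2)) • adjointLift Y μ w

theorem adjointLift_eq {n : ℕ} (Y : ℂ → CMink n) (μ : ℂ → ℂ) (w : ℂ) :
    adjointLift Y μ w
      = (μ w * star (μ w) / 2) • Y w + (star (μ w) • dz Y w + (μ w • dzbar Y w + frameN Y w)) := by
  have : (((‖μ w‖ ^ 2 / 2 : ℝ)) : ℂ) = μ w * star (μ w) / 2 := by
    push_cast
    rw [← Complex.mul_conj']
    rfl
  rw [adjointLift, this, add_assoc, add_assoc]
  rfl

namespace IsCanonical

variable {n : ℕ} {U : Set ℂ} {Y : ℂ → CMink n} (h : IsCanonical U Y) {w : ℂ} {μ : ℂ → ℂ}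
  (hμ : ContDiffOn ℝ ∞ μ U)
include h

section

include hμ

theorem smooth_adjointLift : ContDiffOn ℝ ∞ (adjointLift Y μ) U := by
  have : adjointLift Y μ = fun w => (μ w * star (μ w) / 2) • Y w
      + (star (μ w) • dz Y w + (μ w • dzbar Y w + frameN Y w)) := funext (adjointLift_eq Y μ)
  rw [this]
  exact (SmoothOn.smul ((hμ.mul (SmoothOn.star hμ)).div_const 2) h.smooth).add
    ((SmoothOn.smul (SmoothOn.star hμ) h.smooth_dz).add
      ((SmoothOn.smul hμ h.smooth_dzbar).add h.smooth_frameN))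

theorem smooth_contactVec : ContDiffOn ℝ ∞ (contactVec Y μ) U :=
  h.smooth_dz.add (SmoothOn.smul (hμ.div_const 2) h.smooth)

theorem smooth_adjointTangent : ContDiffOn ℝ ∞ (adjointTangent Y μ) U :=
  (SmoothOn.dz h.isOpen (h.smooth_adjointLift hμ)).add
    (SmoothOn.smul (hμ.div_const 2).neg (h.smooth_adjointLift hμ))

theorem smooth_eta : ContDiffOn ℝ ∞ (eta Y μ) U :=
  (h.smooth_normalDzbar h.smooth_hopf).add
    (SmoothOn.smul ((SmoothOn.star hμ).div_const 2) h.smooth_hopf)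

theorem smooth_rho : ContDiffOn ℝ ∞ (rho Y μ) U :=
  (SmoothOn.dz h.isOpen (SmoothOn.star hμ)).sub
    (contDiffOn_const.mul (SmoothOn.mink h.smooth_hopf (SmoothOn.star h.smooth_hopf)))

end

omit h in
theorem star_mink_hopf : star (mink (hopf Y w) (star (hopf Y w)))
    = mink (hopf Y w) (star (hopf Y w)) := by
  rw [mink_star, star_star, mink_comm]

theorem star_adjointLift (hw : w ∈ U) : star (adjointLift Y μ w) = adjointLift Y μ w := by
  rw [adjointLift_eq]
  simp only [star_add, star_smul, h.real w hw, h.star_dz hw, h.star_dzbar hw, h.star_frameN hw,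
    star_star, star_div₀, star_mul', star_ofNat]
  module

theorem mink_self_adjointLift (hw : w ∈ U) : mink (Y w) (adjointLift Y μ w) = -1 := by
  simp [adjointLift, mink_add_right, mink_smul_right, h.null w hw, h.mink_self_frameN hw,
    mink_comm (Y w) (dz Y w), mink_comm (Y w) (dzbar Y w), h.mink_dz_self hw,
    h.mink_dzbar_self hw]

theorem mink_dz_adjointLift (hw : w ∈ U) : mink (dz Y w) (adjointLift Y μ w) = μ w / 2 := by
  simp only [adjointLift, mink_add_right, mink_smul_right, h.mink_dz_self hw, h.conformal w hw,
    h.normalized w hw, h.mink_dz_frameN hw]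
  ring

theorem mink_dzbar_adjointLift (hw : w ∈ U) :
    mink (dzbar Y w) (adjointLift Y μ w) = star (μ w) / 2 := by
  rw [← h.star_dz hw, ← h.star_adjointLift hw, ← mink_star, h.mink_dz_adjointLift hw]
  simp

theorem mink_frameN_adjointLift (hw : w ∈ U) :
    mink (frameN Y w) (adjointLift Y μ w) = -(μ w * star (μ w) / 2) := by
  rw [adjointLift_eq]
  simp only [mink_add_right, mink_smul_right, h.mink_frameN_frameN hw, mink_comm (frameN Y w) (Y w),
    h.mink_self_frameN hw, mink_comm (frameN Y w) (dz Y w), h.mink_dz_frameN hw,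
    mink_comm (frameN Y w) (dzbar Y w), h.mink_dzbar_frameN hw]
  ring

theorem mink_adjointLift_adjointLift (hw : w ∈ U) :
    mink (adjointLift Y μ w) (adjointLift Y μ w) = 0 := by
  have key : ∀ x, mink (adjointLift Y μ w) x = mink ((μ w * star (μ w) / 2) • Y w
      + (star (μ w) • dz Y w + (μ w • dzbar Y w + frameN Y w))) x := by
    intro x; rw [← adjointLift_eq]
  rw [key]
  simp only [mink_add_left, mink_smul_left, h.mink_frameN_adjointLift hw,
    h.mink_self_adjointLift hw, h.mink_dz_adjointLift hw, h.mink_dzbar_adjointLift hw]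
  ring

/-- With the next three lemmas: $Y,\hat Y$ and $L,\bar L$ form a null frame of $V\otimes\mathbb C$
made of two orthogonal hyperbolic pairs. -/
theorem mink_contactVec_adjointLift (hw : w ∈ U) :
    mink (contactVec Y μ w) (adjointLift Y μ w) = 0 := by
  simp only [contactVec, mink_add_left, mink_smul_left, h.mink_dz_adjointLift hw,
    h.mink_self_adjointLift hw]
  ring

theorem mink_contactVec_self (hw : w ∈ U) : mink (contactVec Y μ w) (Y w) = 0 := by
  simp [contactVec, mink_add_left, mink_smul_left, h.mink_dz_self hw, h.null w hw]

theorem mink_contactVec_contactVec (hw : w ∈ U) :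
    mink (contactVec Y μ w) (contactVec Y μ w) = 0 := by
  simp [contactVec, mink_add_left, mink_smul_left, mink_add_right, mink_smul_right,
    h.mink_dz_self hw, h.null w hw, h.conformal w hw, mink_comm (Y w)]

theorem mink_contactVec_star (hw : w ∈ U) :
    mink (contactVec Y μ w) (star (contactVec Y μ w)) = 1 / 2 := by
  simp [contactVec, mink_add_left, mink_smul_left, mink_add_right, mink_smul_right, star_smul,
    h.mink_dz_self hw, h.null w hw, h.normalized w hw, h.star_dz hw, h.real w hw,
    mink_comm (Y w) (dzbar Y w), h.mink_dzbar_self hw]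

theorem normalProj_contactVec (hw : w ∈ U) : normalProj Y w (contactVec Y μ w) = 0 := by
  rw [contactVec, normalProj_add, normalProj_smul, h.normalProj_self hw, h.normalProj_dz hw]
  simp

theorem normalProj_adjointLift (hw : w ∈ U) : normalProj Y w (adjointLift Y μ w) = 0 := by
  rw [adjointLift]
  simp only [normalProj_add, normalProj_smul, h.normalProj_self hw, h.normalProj_dz hw,
    h.normalProj_dzbar hw, h.normalProj_frameN hw]
  simp

theorem normalProj_eta (hw : w ∈ U) : normalProj Y w (eta Y μ w) = eta Y μ w := by
  rw [eta, normalProj_add, normalProj_smul, h.normalProj_hopf hw, normalDzbar,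
    h.normalProj_normalProj hw]

theorem mink_eta_self (hw : w ∈ U) : mink (eta Y μ w) (Y w) = 0 := by
  rw [← h.normalProj_eta hw, h.mink_normalProj_self hw]

theorem mink_eta_dz (hw : w ∈ U) : mink (eta Y μ w) (dz Y w) = 0 := by
  rw [← h.normalProj_eta hw, h.mink_normalProj_dz hw]

theorem mink_eta_dzbar (hw : w ∈ U) : mink (eta Y μ w) (dzbar Y w) = 0 := by
  rw [← h.normalProj_eta hw, h.mink_normalProj_dzbar hw]

include hμ

theorem star_rho (hw : w ∈ U) :
    star (rho Y μ w) = dzbar μ w - 2 * mink (hopf Y w) (star (hopf Y w)) := by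
  have : dz (fun x => conj (μ x)) w = star (dzbar μ w) := dz_star (h.diff hμ hw)
  rw [rho, this, star_sub, star_mul', star_star, star_mink_hopf]
  simp

theorem dzbar_contactVec (hw : w ∈ U) : dzbar (contactVec Y μ) w
    = (1 / 2 : ℂ) • adjointLift Y μ w + (star (rho Y μ w) / 2) • Y w
      - (star (μ w) / 2) • contactVec Y μ w := by
  have hm := h.diff (hμ.div_const 2) hw
  have hY := h.diff h.smooth hw
  have e : dzbar (fun x => μ x / 2) w = dzbar μ w / 2 := by
    have : (fun x => μ x / 2) = fun x => (1 / 2 : ℂ) • μ x := by funext x; simp; ring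
    rw [this, dzbar_const_smul _ (h.diff hμ hw)]; simp; ring
  have : contactVec Y μ = fun x => dz Y x + (μ x / 2) • Y x := rfl
  rw [this, dzbar_add (h.diff h.smooth_dz hw) (hm.fun_smul hY), dzbar_smul hm hY, e,
    h.dzbardz_eq hw, adjointLift_eq, h.star_rho hμ hw]
  module

/-- The definitions of $\theta,\rho,\eta$ are chosen so that they are the coefficients of $\hat Y_z$
in this frame; the proof only substitutes the structure equations. -/
theorem dz_adjointLift (hw : w ∈ U) : dz (adjointLift Y μ) w
    = (μ w / 2) • adjointLift Y μ w + theta Y μ w • (dzbar Y w + (star (μ w) / 2) • Y w)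
      + rho Y μ w • contactVec Y μ w + (2 : ℂ) • eta Y μ w := by
  have hY := h.diff h.smooth hw
  have hYz := h.diff h.smooth_dz hw
  have hYb := h.diff h.smooth_dzbar hw
  have hm := h.diff hμ hw
  have hs := h.diff (SmoothOn.star hμ) hw
  have hms : DifferentiableAt ℝ (fun x => μ x * star (μ x) / 2) w :=
    h.diff ((hμ.mul (SmoothOn.star hμ)).div_const 2) hw
  have e : dz (fun x => μ x * star (μ x) / 2) w
      = (dz μ w * star (μ w) + μ w * dz (fun x => star (μ x)) w) / 2 := by
    have : (fun x => μ x * star (μ x) / 2) = fun x => (1 / 2 : ℂ) • (μ x * star (μ x)) := by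
      funext x; simp; ring
    rw [this, dz_const_smul _ (hm.fun_mul hs), dz_mul hm hs, smul_eq_mul]; ring
  have : adjointLift Y μ = fun w => (μ w * star (μ w) / 2) • Y w
      + (star (μ w) • dz Y w + (μ w • dzbar Y w + frameN Y w)) := funext (adjointLift_eq Y μ)
  rw [this, dz_add (hms.fun_smul hY) ((hs.fun_smul hYz).fun_add
      ((hm.fun_smul hYb).fun_add (h.diff h.smooth_frameN hw))),
    dz_add (hs.fun_smul hYz) ((hm.fun_smul hYb).fun_add (h.diff h.smooth_frameN hw)),
    dz_add (hm.fun_smul hYb) (h.diff h.smooth_frameN hw), dz_smul hms hY, dz_smul hs hYz,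
    dz_smul hm hYb, e, h.dz_dzbar hw, h.dzbardz_eq hw, h.dz_frameN_eq hw, dzdz_eq]
  simp only [theta, rho, eta, contactVec, starRingEnd_apply]
  module

theorem adjointTangent_eq (hw : w ∈ U) : adjointTangent Y μ w
    = theta Y μ w • (dzbar Y w + (star (μ w) / 2) • Y w)
      + rho Y μ w • contactVec Y μ w + (2 : ℂ) • eta Y μ w := by
  rw [adjointTangent, h.dz_adjointLift hμ hw]
  module

theorem mink_adjointTangent_self (hw : w ∈ U) : mink (adjointTangent Y μ w) (Y w) = 0 := by
  rw [h.adjointTangent_eq hμ hw]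
  simp [mink_add_left, mink_smul_left, h.mink_eta_self hw, h.mink_contactVec_self hw,
    h.mink_dzbar_self hw, h.null w hw]

/-- This and the next lemma express $\theta$ and $\rho$ as pairings of $Z$ with $L$ and $\bar L$, a
form in which the two surfaces can be exchanged. -/
theorem mink_adjointTangent_contactVec (hw : w ∈ U) :
    mink (adjointTangent Y μ w) (contactVec Y μ w) = theta Y μ w / 2 := by
  rw [h.adjointTangent_eq hμ hw]
  simp only [mink_add_left, mink_smul_left, h.mink_contactVec_contactVec hw]
  simp [contactVec, mink_add_right, mink_smul_right, h.mink_eta_self hw,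
    h.mink_dzbar_self hw, h.null w hw, h.mink_eta_dz hw, mink_comm (dzbar Y w) (dz Y w),
    h.normalized w hw, mink_comm (Y w) (dz Y w), h.mink_dz_self hw]
  ring

theorem mink_adjointTangent_star_contactVec (hw : w ∈ U) :
    mink (adjointTangent Y μ w) (star (contactVec Y μ w)) = rho Y μ w / 2 := by
  rw [h.adjointTangent_eq hμ hw]
  simp only [mink_add_left, mink_smul_left, h.mink_contactVec_star hw]
  simp [contactVec, mink_add_right, mink_smul_right, h.mink_eta_self hw, star_smul,
    h.mink_dzbar_self hw, h.null w hw, h.star_dz hw, h.real w hw, h.mink_eta_dzbar hw,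
    h.mink_dzbar_dzbar hw, mink_comm (Y w) (dzbar Y w)]
  ring

/-- Since $\hat Y$ is null, $\langle Z,Z\rangle=\langle\hat Y_z,\hat Y_z\rangle$; this is why
$\langle\eta,\eta\rangle=0$ together with $\theta=0$ is the conformality condition. -/
theorem mink_adjointTangent_adjointTangent (hw : w ∈ U) :
    mink (adjointTangent Y μ w) (adjointTangent Y μ w)
      = theta Y μ w * rho Y μ w + 4 * mink (eta Y μ w) (eta Y μ w) := by
  have a1 : mink (eta Y μ w) (contactVec Y μ w) = 0 := by
    simp [contactVec, mink_add_right, mink_smul_right, h.mink_eta_self hw, h.mink_eta_dz hw]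
  have a2 : mink (eta Y μ w) (adjointTangent Y μ w) = 2 * mink (eta Y μ w) (eta Y μ w) := by
    rw [h.adjointTangent_eq hμ hw]
    simp [mink_add_right, mink_smul_right, a1, h.mink_eta_self hw, h.mink_eta_dzbar hw]
  have a3 : mink (dzbar Y w + (star (μ w) / 2) • Y w) (adjointTangent Y μ w) = rho Y μ w / 2 := by
    rw [← h.mink_adjointTangent_star_contactVec hμ hw, mink_comm, contactVec]
    simp [star_smul, h.star_dz hw, h.real w hw]
  have key : ∀ x, mink (adjointTangent Y μ w) x = mink (theta Y μ w • (dzbar Y w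
      + (star (μ w) / 2) • Y w) + rho Y μ w • contactVec Y μ w + (2 : ℂ) • eta Y μ w) x := by
    intro x; rw [← h.adjointTangent_eq hμ hw]
  rw [key]
  simp only [mink_add_left, mink_smul_left] at a3 ⊢
  rw [a2, mink_comm (contactVec Y μ w), h.mink_adjointTangent_contactVec hμ hw]
  linear_combination theta Y μ w * a3

theorem mink_adjointTangent_adjointLift (hw : w ∈ U) :
    mink (adjointTangent Y μ w) (adjointLift Y μ w) = 0 := by
  have hA := h.smooth_adjointLift hμ
  have := mink_dz_of_const h.isOpen hA hA
    (fun x hx => h.mink_adjointLift_adjointLift hx) hw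
  rw [mink_comm (adjointLift Y μ w)] at this
  rw [adjointTangent, mink_add_left, mink_smul_left, h.mink_adjointLift_adjointLift hw]
  linear_combination this / 2

omit h hμ in
theorem dz_adjointLift_eq : dz (adjointLift Y μ) w
    = adjointTangent Y μ w + (μ w / 2) • adjointLift Y μ w := by
  rw [adjointTangent]; module

theorem dzbar_adjointLift_eq (hw : w ∈ U) : dzbar (adjointLift Y μ) w
    = star (adjointTangent Y μ w) + (star (μ w) / 2) • adjointLift Y μ w := by
  have : dzbar (adjointLift Y μ) w = star (dz (adjointLift Y μ) w) := by
    rw [← dzbar_star (h.diff (h.smooth_adjointLift hμ) hw)]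
    exact dzbar_congr h.isOpen (fun x hx => (h.star_adjointLift hx).symm) hw
  rw [this, dz_adjointLift_eq]
  simp [star_smul, h.star_adjointLift hw]

/-! ### Consequences of co-touching and of the Willmore equation -/

section CoTouching

variable (hθ : ∀ x ∈ U, theta Y μ x = 0)
include hθ

/-- Co-touching is a Riccati equation: its conjugate $\bar\mu_{\bar z}=\frac12\bar\mu^2+\bar s$
supplies the term $\frac{\bar s}2\kappa$ that completes $D_{\bar z}D_{\bar z}\kappa$ to $W$. -/
theorem normalDzbar_eta (hw : w ∈ U) :
    normalDzbar Y (eta Y μ) w = willmoreTensor Y w + (star (μ w) / 2) • eta Y μ w := by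
  have hD := h.smooth_normalDzbar h.smooth_hopf
  have hs := (SmoothOn.star hμ).div_const 2
  have e : dzbar (fun x => star (μ x) / 2) w
      = star (μ w) ^ 2 / 4 + star (schwarzian Y w) / 2 := by
    have e1 : (fun x => star (μ x) / 2) = fun x => (1 / 2 : ℂ) • star (μ x) := by
      funext x; simp; ring
    have e2 : dz μ w = μ w ^ 2 / 2 + schwarzian Y w := by
      have := hθ w hw
      rw [theta] at this
      linear_combination this
    rw [e1, dzbar_const_smul _ (h.diff (SmoothOn.star hμ) hw), dzbar_star (h.diff hμ hw), e2]
    simp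
    ring
  have : eta Y μ = fun x => normalDzbar Y (hopf Y) x + (star (μ x) / 2) • hopf Y x := rfl
  rw [this, h.normalDzbar_add hD (SmoothOn.smul hs h.smooth_hopf) hw,
    h.normalDzbar_smul hs h.smooth_hopf hw, e, h.normalProj_hopf hw, willmoreTensor]
  simp only [starRingEnd_apply]
  module

theorem normalDzbar_adjointTangent (hw : w ∈ U) :
    normalDzbar Y (adjointTangent Y μ) w = (2 : ℂ) • normalDzbar Y (eta Y μ) w := by
  have e : Set.EqOn (adjointTangent Y μ)
      (fun x => (2 : ℂ) • eta Y μ x + ((rho Y μ x * (μ x / 2)) • Y x + rho Y μ x • dz Y x)) U := by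
    intro x hx
    simp only [h.adjointTangent_eq hμ hx, hθ x hx, contactVec]
    module
  have hr := h.smooth_rho hμ
  rw [h.normalDzbar_congr e hw, h.normalDzbar_add_tangential (SmoothOn.smul contDiffOn_const
    (h.smooth_eta hμ)) (hr.mul (hμ.div_const 2)) hr hw, h.normalDzbar_smul contDiffOn_const
    (h.smooth_eta hμ) hw, dzbar_const]
  simp

theorem normalProj_adjointTangent (hw : w ∈ U) :
    normalProj Y w (adjointTangent Y μ w) = (2 : ℂ) • eta Y μ w := by
  rw [h.adjointTangent_eq hμ hw, hθ w hw, zero_smul, zero_add, normalProj_add, normalProj_smul,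
    normalProj_smul, h.normalProj_contactVec hw, h.normalProj_eta hw, smul_zero, zero_add]

/-- The heart of the duality, and the place where $W=0$ enters. The remainder $Q=Z_{\bar
z}-\frac\rho2\hat Y-\frac{\bar\mu}2Z$ has no normal part and is orthogonal to $Y,Y_z,Y_{\bar z}$, so
it is a multiple of $Y$. -/
theorem dzbar_adjointTangent (hW : ∀ x ∈ U, willmoreTensor Y x = 0) (hw : w ∈ U) :
    dzbar (adjointTangent Y μ) w = (rho Y μ w / 2) • adjointLift Y μ w
      + (star (μ w) / 2) • adjointTangent Y μ w
      + mink (adjointTangent Y μ w) (star (adjointTangent Y μ w)) • Y w := by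
  have hZ := h.smooth_adjointTangent hμ
  have hA := h.smooth_adjointLift hμ
  obtain ⟨Q, hQ⟩ : ∃ Q, dzbar (adjointTangent Y μ) w = Q + ((rho Y μ w / 2) • adjointLift Y μ w
      + (star (μ w) / 2) • adjointTangent Y μ w) := ⟨_, (sub_add_cancel _ _).symm⟩
  have hQ' : Q = dzbar (adjointTangent Y μ) w + (-(rho Y μ w / 2)) • adjointLift Y μ w
      + (-(star (μ w) / 2)) • adjointTangent Y μ w := by rw [hQ]; module
  have hAL := h.mink_contactVec_adjointLift (μ := μ) hw
  rw [mink_comm] at hAL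
  have hZL := h.mink_adjointTangent_contactVec hμ hw
  rw [hθ w hw, zero_div] at hZL
  have hZY := h.mink_adjointTangent_self hμ hw
  have hZA := h.mink_adjointTangent_adjointLift hμ hw
  have hYA := h.mink_self_adjointLift (μ := μ) hw
  -- The normal part of $Z_{\bar z}$ is $2D_{\bar z}\eta=2W+\bar\mu\eta$, and $W=0$.
  have q1 : normalProj Y w Q = 0 := by
    have : normalProj Y w (dzbar (adjointTangent Y μ) w) = star (μ w) • eta Y μ w := by
      change normalDzbar Y (adjointTangent Y μ) w = _
      rw [h.normalDzbar_adjointTangent hμ hθ hw, h.normalDzbar_eta hμ hθ hw, hW w hw]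
      module
    rw [hQ', normalProj_add, normalProj_add, normalProj_smul, normalProj_smul, this,
      h.normalProj_adjointLift hw, h.normalProj_adjointTangent hμ hθ hw]
    module
  have q2 : mink Q (Y w) = 0 := by
    have e1 := mink_dzbar_of_const h.isOpen hZ h.smooth
      (fun x hx => h.mink_adjointTangent_self hμ hx) hw
    have e2 := h.mink_adjointTangent_star_contactVec hμ hw
    rw [contactVec, star_add, star_smul, h.star_dz hw, h.real w hw, mink_add_right,
      mink_smul_right, hZY] at e2
    rw [hQ']
    simp only [mink_add_left, mink_smul_left, hZY, mink_comm (adjointLift Y μ w) (Y w), hYA]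
    linear_combination e1 - e2
  have q3 : mink Q (contactVec Y μ w) = 0 := by
    have e1 := mink_dzbar_of_const h.isOpen hZ (h.smooth_contactVec hμ) (c := 0)
      (fun x hx => by rw [h.mink_adjointTangent_contactVec hμ hx, hθ x hx, zero_div]) hw
    rw [h.dzbar_contactVec hμ hw] at e1
    simp only [mink_add_right, mink_sub_right, mink_smul_right, hZA, hZY, hZL] at e1
    rw [hQ']
    simp only [mink_add_left, mink_smul_left, hAL, hZL, e1]
    ring
  -- Orthogonality to $Y_{\bar z}$ is not available directly; it follows from that to $Y_z$ because
  -- $Q$ is real. Reality holds since $Q$ differs from the real vector $\hat Y_{z\bar z}$ by a real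
  -- multiple of $\hat Y$ and by $\frac{\bar\mu}2Z$ plus its conjugate.
  have q4 : star Q = Q := by
    have r1 : dzbar (dz (adjointLift Y μ)) w = dzbar (adjointTangent Y μ) w
        + (dzbar (fun x => μ x / 2) w • adjointLift Y μ w
          + (μ w / 2) • dzbar (adjointLift Y μ) w) := by
      rw [← dzbar_smul (h.diff (hμ.div_const 2) hw) (h.diff hA hw), ← dzbar_add (h.diff hZ hw)
        ((h.diff (hμ.div_const 2) hw).fun_smul (h.diff hA hw))]
      exact dzbar_congr h.isOpen (fun x hx => dz_adjointLift_eq) hw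
    have r2 : star (dzbar (dz (adjointLift Y μ)) w) = dzbar (dz (adjointLift Y μ)) w := by
      rw [← dz_star (h.diff (SmoothOn.dz h.isOpen hA) hw), ← dz_dzbar_comm h.isOpen hA hw]
      refine dz_congr h.isOpen (fun x hx => ?_) hw
      rw [← dzbar_star (h.diff hA hx)]
      exact dzbar_congr h.isOpen (fun y hy => h.star_adjointLift hy) hx
    have r3 : dzbar (fun x => μ x / 2) w
        = star (rho Y μ w) / 2 + mink (hopf Y w) (star (hopf Y w)) := by
      have : (fun x => μ x / 2) = fun x => (1 / 2 : ℂ) • μ x := by funext x; simp; ring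
      rw [this, dzbar_const_smul _ (h.diff hμ hw), h.star_rho hμ hw, smul_eq_mul]; ring
    have r4 : Q = dzbar (dz (adjointLift Y μ)) w - (rho Y μ w / 2 + star (rho Y μ w) / 2
        + mink (hopf Y w) (star (hopf Y w)) + μ w * star (μ w) / 4) • adjointLift Y μ w
        - (star (μ w) / 2) • adjointTangent Y μ w
        - (μ w / 2) • star (adjointTangent Y μ w) := by
      rw [r1, hQ', r3, h.dzbar_adjointLift_eq hμ hw]
      module
    rw [r4]
    simp only [star_sub, r2, star_smul, star_add, star_div₀, star_mul', star_star, star_ofNat,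
      star_mink_hopf, h.star_adjointLift hw]
    module
  have q5 : mink Q (dz Y w) = 0 := by
    rw [contactVec, mink_add_right, mink_smul_right, q2] at q3
    linear_combination q3
  have q6 : mink Q (dzbar Y w) = 0 := by
    rw [← h.star_dz hw, ← q4, ← mink_star, q5, star_zero]
  -- The coefficient is found by pairing with $\hat Y$, whose product with $Z$ vanishes identically;
  -- on $Q$, $\hat Y$ and $N$ act alike.
  have q7 : mink Q (frameN Y w)
      = -mink (adjointTangent Y μ w) (star (adjointTangent Y μ w)) := by
    have e1 := mink_dzbar_of_const h.isOpen hZ hA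
      (fun x hx => h.mink_adjointTangent_adjointLift hμ hx) hw
    rw [h.dzbar_adjointLift_eq hμ hw, mink_add_right, mink_smul_right, hZA] at e1
    have e2 : mink Q (adjointLift Y μ w) = mink Q (frameN Y w) := by
      simp [adjointLift, mink_add_right, mink_smul_right, q2, q5, q6]
    rw [← e2, hQ']
    simp only [mink_add_left, mink_smul_left, hZA, h.mink_adjointLift_adjointLift hw, e1]
    ring
  have q8 := eq_smul_self_of q1 q2 q5 q6
  rw [q7, neg_neg] at q8
  rw [hQ, q8]
  abel

end CoTouching

end IsCanonical

/-! ### The dual adjoint transform -/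

/-- The canonical lift `Yt` of the adjoint transform of `Y` with parameter `μ`, with
`Ŷ = σ Yt`. -/
structure IsAdjointPair {n : ℕ} (U : Set ℂ) (Y Yt : ℂ → CMink n) (μ σ : ℂ → ℂ) : Prop where
  canonical : IsCanonical U Y
  canonical_adjoint : IsCanonical U Yt
  smooth_μ : ContDiffOn ℝ ∞ μ U
  smooth_σ : ContDiffOn ℝ ∞ σ U
  ne_zero : ∀ w ∈ U, σ w ≠ 0
  real : ∀ w ∈ U, star (σ w) = σ w
  adjoint : ∀ w ∈ U, adjointLift Y μ w = σ w • Yt w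
  coTouching : ∀ w ∈ U, theta Y μ w = 0
  willmore : ∀ w ∈ U, willmoreTensor Y w = 0

/-- The parameter of the dual adjoint transform. -/
def dualParam (μ σ : ℂ → ℂ) (w : ℂ) : ℂ := 2 * dz σ w / σ w - μ w

namespace IsAdjointPair

variable {n : ℕ} {U : Set ℂ} {Y Yt : ℂ → CMink n} {μ σ : ℂ → ℂ} (h : IsAdjointPair U Y Yt μ σ)
  {w : ℂ}
include h

theorem smooth_dualParam : ContDiffOn ℝ ∞ (dualParam μ σ) U := by
  have : dualParam μ σ = fun w => 2 * dz σ w * (σ w)⁻¹ - μ w := by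
    funext w; rw [dualParam, div_eq_mul_inv]
  rw [this]
  exact ((contDiffOn_const.mul (SmoothOn.dz h.canonical.isOpen h.smooth_σ)).mul
    (h.smooth_σ.inv h.ne_zero)).sub h.smooth_μ

theorem diff {E : Type*} [NormedAddCommGroup E] [NormedSpace ℝ E] {f : ℂ → E}
    (hf : ContDiffOn ℝ ∞ f U) (hw : w ∈ U) : DifferentiableAt ℝ f w :=
  SmoothOn.differentiableAt h.canonical.isOpen hf hw

theorem star_dz_σ (hw : w ∈ U) : star (dz σ w) = dzbar σ w := by
  rw [← dzbar_star (h.diff h.smooth_σ hw)]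
  exact dzbar_congr h.canonical.isOpen h.real hw

/-- This identity dictates the dual parameter: $(\sigma\tilde Y)_z-\frac\mu2\sigma\tilde
Y=\sigma\bigl(\tilde Y_z+(\frac{\sigma_z}\sigma-\frac\mu2)\tilde Y\bigr)$. -/
theorem adjointTangent_eq (hw : w ∈ U) :
    adjointTangent Y μ w = σ w • contactVec Yt (dualParam μ σ) w := by
  have h0 := h.ne_zero w hw
  rw [adjointTangent, dz_congr h.canonical.isOpen h.adjoint hw, h.adjoint w hw,
    dz_smul (h.diff h.smooth_σ hw) (h.diff h.canonical_adjoint.smooth hw), contactVec, dualParam]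
  match_scalars
  · field_simp; ring
  · ring

theorem contactVec_dual (hw : w ∈ U) :
    contactVec Yt (dualParam μ σ) w = (σ w)⁻¹ • adjointTangent Y μ w := by
  rw [h.adjointTangent_eq hw, smul_smul, inv_mul_cancel₀ (h.ne_zero w hw), one_smul]

theorem dzbar_adjointTangent_eq (hw : w ∈ U) : dzbar (adjointTangent Y μ) w
    = (2 : ℂ)⁻¹ • (star (σ w) • (star (dualParam μ σ w + μ w)) • contactVec Yt (dualParam μ σ) w)
      + σ w • dzbar (contactVec Yt (dualParam μ σ)) w := by
  have h0 := h.ne_zero w hw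
  rw [dzbar_congr h.canonical.isOpen (fun x hx => h.adjointTangent_eq hx) hw,
    dzbar_smul (h.diff h.smooth_σ hw)
      (h.diff (h.canonical_adjoint.smooth_contactVec h.smooth_dualParam) hw), dualParam,
    sub_add_cancel, star_div₀, star_mul', h.star_dz_σ hw, h.real w hw, star_ofNat]
  match_scalars
  · field_simp
  · ring

/-- The original surface is represented by the adjoint lift of the dual parameter. -/
theorem adjointLift_dual (hw : w ∈ U) : adjointLift Yt (dualParam μ σ) w = σ w • Y w := by
  have h0 := h.ne_zero w hw
  have hY := h.canonical
  have hYt := h.canonical_adjoint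
  have hν := h.smooth_dualParam
  -- The value of $\langle Z,\bar Z\rangle$ uses that $\tilde Y$ is normalized, through
  -- $\langle\tilde L,\bar{\tilde L}\rangle=\frac12$.
  have hZ : mink (adjointTangent Y μ w) (star (adjointTangent Y μ w)) = σ w * σ w / 2 := by
    rw [h.adjointTangent_eq hw, star_smul, h.real w hw, mink_smul_left, mink_smul_right,
      hYt.mink_contactVec_star hw]
    ring
  have e1 := hY.dzbar_adjointTangent h.smooth_μ h.coTouching h.willmore hw
  rw [h.dzbar_adjointTangent_eq hw, hYt.dzbar_contactVec hν hw, hZ, h.adjoint w hw,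
    h.adjointTangent_eq hw] at e1
  -- Equating the two formulas for $Z_{\bar z}$, the $\tilde L$ terms cancel and
  -- $c=\rho-\bar{\tilde\rho}$ is left.
  obtain ⟨c, hc⟩ : ∃ c : ℂ, adjointLift Yt (dualParam μ σ) w = σ w • Y w + c • Yt w := by
    refine ⟨rho Y μ w - star (rho Yt (dualParam μ σ) w), ?_⟩
    have e2 := congrArg (fun x => (2 * (σ w)⁻¹) • x) e1
    rw [h.real w hw, star_add] at e2
    have e3 : adjointLift Yt (dualParam μ σ) w
        = (2 * (σ w)⁻¹) • ((2 : ℂ)⁻¹ • (σ w • (star (dualParam μ σ w) + star (μ w)) •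
            contactVec Yt (dualParam μ σ) w) + σ w • ((1 / 2 : ℂ) • adjointLift Yt (dualParam μ σ) w
            + (star (rho Yt (dualParam μ σ) w) / 2) • Yt w
            - (star (dualParam μ σ w) / 2) • contactVec Yt (dualParam μ σ) w))
          - star (rho Yt (dualParam μ σ) w) • Yt w
          - star (μ w) • contactVec Yt (dualParam μ σ) w := by
      match_scalars <;> field_simp <;> ring
    rw [e3, e2]
    match_scalars <;> field_simp <;> ring
  have n1 := hYt.mink_adjointLift_adjointLift (μ := dualParam μ σ) hw
  have n2 : mink (Yt w) (Y w) = -(σ w)⁻¹ := by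
    have := hY.mink_self_adjointLift (μ := μ) hw
    rw [h.adjoint w hw, mink_smul_right, mink_comm] at this
    field_simp
    linear_combination this
  -- Nullity of the left side gives $0=2c\sigma\langle Y,\tilde Y\rangle=-2c$.
  have n3 : c = 0 := by
    rw [hc] at n1
    simp only [mink_add_left, mink_add_right, mink_smul_left, mink_smul_right, hY.null w hw,
      hYt.null w hw, mink_comm (Y w) (Yt w), n2] at n1
    field_simp at n1
    linear_combination -n1 / 2
  rw [hc, n3, zero_smul, add_zero]

theorem dz_adjointLift_dual (hw : w ∈ U) :
    dz (adjointLift Yt (dualParam μ σ)) w = dz σ w • Y w + σ w • dz Y w := by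
  rw [dz_congr h.canonical.isOpen (fun x hx => h.adjointLift_dual hx) hw,
    dz_smul (h.diff h.smooth_σ hw) (h.diff h.canonical.smooth hw)]

/-- The mirror image of $Z=\sigma\tilde L$; it holds since the two parameters add up to
$2\sigma_z/\sigma$. -/
theorem adjointTangent_dual (hw : w ∈ U) :
    adjointTangent Yt (dualParam μ σ) w = σ w • contactVec Y μ w := by
  have h0 := h.ne_zero w hw
  rw [adjointTangent, h.dz_adjointLift_dual hw, h.adjointLift_dual hw, contactVec, dualParam]
  match_scalars
  · field_simp; ring
  · ring

/-- $\tilde\theta=2\langle\tilde Z,\tilde L\rangle=2\langle\sigma L,\sigma^{-1}Z\rangle=\theta$. -/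
theorem theta_dual (hw : w ∈ U) : theta Yt (dualParam μ σ) w = 0 := by
  have h0 := h.ne_zero w hw
  have := h.canonical_adjoint.mink_adjointTangent_contactVec h.smooth_dualParam hw
  rw [h.adjointTangent_dual hw, h.contactVec_dual hw, mink_smul_left, mink_smul_right, mink_comm,
    h.canonical.mink_adjointTangent_contactVec h.smooth_μ hw, h.coTouching w hw] at this
  linear_combination -2 * this

/-- $\tilde\rho=2\langle\tilde Z,\bar{\tilde L}\rangle=2\langle L,\bar Z\rangle$, the conjugate of
$2\langle Z,\bar L\rangle=\rho$. -/
theorem rho_dual (hw : w ∈ U) : rho Yt (dualParam μ σ) w = star (rho Y μ w) := by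
  have h0 := h.ne_zero w hw
  have := h.canonical_adjoint.mink_adjointTangent_star_contactVec h.smooth_dualParam hw
  have e := congrArg star (h.canonical.mink_adjointTangent_star_contactVec h.smooth_μ hw)
  rw [mink_star, star_star, star_div₀, star_ofNat, mink_comm] at e
  rw [h.adjointTangent_dual hw, h.contactVec_dual hw, mink_smul_left, star_smul, mink_smul_right,
    e, star_inv₀, h.real w hw] at this
  field_simp at this
  exact this.symm

/-- $4\langle\tilde\eta,\tilde\eta\rangle=\langle\tilde Z,\tilde Z\rangle=\sigma^2\langle
L,L\rangle=0$. The conformality condition on $\eta$ has been used only through the conformality of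
$\tilde f$. -/
theorem eta_dual (hw : w ∈ U) :
    mink (eta Yt (dualParam μ σ) w) (eta Yt (dualParam μ σ) w) = 0 := by
  have := h.canonical_adjoint.mink_adjointTangent_adjointTangent h.smooth_dualParam hw
  rw [h.adjointTangent_dual hw, mink_smul_left, mink_smul_right,
    h.canonical.mink_contactVec_contactVec hw, h.theta_dual hw] at this
  linear_combination -this / 4

/-- The Willmore tensor of the adjoint transform vanishes. -/
theorem willmoreTensor_dual (hw : w ∈ U) : willmoreTensor Yt w = 0 := by
  have h0 := h.ne_zero w hw
  have hY := h.canonical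
  have hYt := h.canonical_adjoint
  have hν := h.smooth_dualParam
  have hL := hY.smooth_contactVec h.smooth_μ
  have p1 : normalProj Yt w (Y w) = 0 := by
    have := hYt.normalProj_adjointLift (μ := dualParam μ σ) hw
    rw [h.adjointLift_dual hw, normalProj_smul] at this
    exact (smul_eq_zero.1 this).resolve_left h0
  have p2 : normalProj Yt w (contactVec Y μ w)
      = (2 * (σ w)⁻¹) • eta Yt (dualParam μ σ) w := by
    have := hYt.normalProj_adjointTangent hν (fun x hx => h.theta_dual hx) hw
    rw [h.adjointTangent_dual hw, normalProj_smul] at this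
    rw [mul_comm, ← smul_smul, ← this, smul_smul, inv_mul_cancel₀ h0, one_smul]
  -- The normal part of $\tilde Z_{\bar z}$ is computed twice: as $2\tilde W+\bar\nu\tilde\eta$, and
  -- from $\tilde Z=\sigma L$. In the formula for $L_{\bar z}$ both $Y$ and $\hat Y$ are tangential
  -- to $\tilde Y$'s frame, and $L$ has normal part $\frac2\sigma\tilde\eta$, so the second value is
  -- $(2\sigma_{\bar z}/\sigma-\bar\mu)\tilde\eta=\bar\nu\tilde\eta$.
  have e1 := hYt.normalDzbar_adjointTangent hν (fun x hx => h.theta_dual hx) hw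
  rw [hYt.normalDzbar_eta hν (fun x hx => h.theta_dual hx) hw,
    hYt.normalDzbar_congr (fun x hx => h.adjointTangent_dual hx) hw,
    hYt.normalDzbar_smul h.smooth_σ hL hw, normalDzbar, hY.dzbar_contactVec h.smooth_μ hw,
    h.adjoint w hw, sub_eq_add_neg, ← neg_smul] at e1
  simp only [normalProj_add, normalProj_smul, hYt.normalProj_self hw, p1, p2, smul_zero,
    zero_add, ← h.star_dz_σ hw, dualParam, star_sub, star_div₀, star_mul', star_ofNat,
    h.real w hw] at e1
  have e2 : willmoreTensor Yt w = (2 : ℂ)⁻¹ • ((2 : ℂ) • (willmoreTensor Yt w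
      + ((2 * star (dz σ w) / σ w - star (μ w)) / 2) • eta Yt (dualParam μ σ) w))
      - ((2 * star (dz σ w) / σ w - star (μ w)) / 2) • eta Yt (dualParam μ σ) w := by
    module
  rw [e2, ← e1]
  match_scalars
  field_simp
  ring

end IsAdjointPair

/-! ### The first variation in terms of a canonical lift -/

/-- The integrand of the first variation, up to complex conjugation, for the variation field `ψ`
of a canonical lift `Y`. -/
def liftVariation {n : ℕ} (Y ψ : ℂ → CMink n) (w : ℂ) : ℂ :=
  mink (dz (dz ψ) w) (star (dz (dz Y) w))
    - 4 * mink (star (dz (dz Y) w)) (dzbar (dz Y) w) * mink (dz ψ w) (dz Y w)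
    - 2 * mink (dz (dz Y) w) (star (dz (dz Y) w)) * mink (dz ψ w) (dzbar Y w)

/-- The flux whose divergence appears in the first variation. -/
def variationFlux {n : ℕ} (Y ψ : ℂ → CMink n) (w : ℂ) : ℂ :=
  mink (dz ψ w) (star (hopf Y w)) - mink (ψ w) (star (normalDzbar Y (hopf Y) w))

namespace IsCanonical

variable {n : ℕ} {U : Set ℂ} {Y ψ : ℂ → CMink n} (h : IsCanonical U Y) {w : ℂ}
include h

theorem smooth_variationFlux (hψ : ContDiffOn ℝ ∞ ψ U) : ContDiffOn ℝ ∞ (variationFlux Y ψ) U :=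
  (SmoothOn.mink (SmoothOn.dz h.isOpen hψ) (SmoothOn.star h.smooth_hopf)).sub
    (SmoothOn.mink hψ (SmoothOn.star (h.smooth_normalDzbar h.smooth_hopf)))

/-- The coefficient of $Y$ stays unspecified because this derivative is only paired with fields
orthogonal to $Y$. -/
theorem dzbar_normalDzbar_hopf_eq (hw : w ∈ U) : ∃ c : ℂ, dzbar (normalDzbar Y (hopf Y)) w
    = normalDzbar Y (normalDzbar Y (hopf Y)) w + c • Y w
      + (-(2 * mink (normalDzbar Y (hopf Y) w) (star (hopf Y w)))) • dz Y w := by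
  have hD := h.smooth_normalDzbar h.smooth_hopf
  have p2 : mink (dzbar (normalDzbar Y (hopf Y)) w) (Y w) = 0 := by
    rw [mink_dzbar_of_const h.isOpen hD h.smooth
      (fun x hx => h.mink_normalProj_self hx _) hw, normalDzbar, h.mink_normalProj_dzbar hw,
      neg_zero]
  have p3 : mink (dzbar (normalDzbar Y (hopf Y)) w) (dzbar Y w)
      = -mink (normalDzbar Y (hopf Y) w) (star (hopf Y w)) := by
    rw [mink_dzbar_of_const h.isOpen hD h.smooth_dzbar
      (fun x hx => h.mink_normalProj_dzbar hx _) hw, h.dzbardzbar_eq hw, mink_sub_right,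
      mink_smul_right]
    rw [normalDzbar, h.mink_normalProj_self hw]
    ring
  have p4 : mink (dzbar (normalDzbar Y (hopf Y)) w) (dz Y w) = 0 := by
    rw [mink_dzbar_of_const h.isOpen hD h.smooth_dz
      (fun x hx => h.mink_normalProj_dz hx _) hw, h.dzbardz_eq hw, mink_sub_right, mink_smul_right,
      mink_smul_right, normalDzbar, h.mink_normalProj_self hw, h.mink_normalProj_frameN hw]
    ring
  refine ⟨-mink (dzbar (normalDzbar Y (hopf Y)) w) (frameN Y w), ?_⟩
  conv_lhs => rw [eq_normalProj_add Y w (dzbar (normalDzbar Y (hopf Y)) w), p2, p3, p4]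
  rw [normalDzbar.eq_1 Y (normalDzbar Y (hopf Y))]
  module

/-- The first variation is the pairing with the Willmore tensor up to a divergence. -/
theorem liftVariation_eq (hψ : ContDiffOn ℝ ∞ ψ U) (hreal : ∀ x ∈ U, star (ψ x) = ψ x)
    (horth : ∀ x ∈ U, mink (ψ x) (Y x) = 0) (hw : w ∈ U) :
    liftVariation Y ψ w + star (liftVariation Y ψ w)
      = dz (variationFlux Y ψ) w + star (dz (variationFlux Y ψ) w)
        + 2 * mink (ψ w) (willmoreTensor Y w) := by
  have hdψ := SmoothOn.dz h.isOpen hψ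
  have hD := h.smooth_normalDzbar h.smooth_hopf
  have hκ := h.smooth_hopf
  have o1 : ∀ x ∈ U, mink (dz ψ x) (Y x) = -mink (ψ x) (dz Y x) := fun x hx =>
    mink_dz_of_const h.isOpen hψ h.smooth horth hx
  -- The relation $\langle\psi,Y\rangle=0$ differentiated twice, with $Y_{zz}=\kappa-\frac s2Y$.
  have o2 : mink (dz (dz ψ) w) (Y w) = -(2 * mink (dz ψ w) (dz Y w)) - mink (ψ w) (hopf Y w) := by
    have e : Set.EqOn (fun x => mink (dz ψ x) (Y x) + mink (ψ x) (dz Y x)) (fun _ => 0) U := by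
      intro x hx; simp [o1 x hx]
    have := dz_congr h.isOpen e hw
    rw [dz_const, dz_add (h.diff (SmoothOn.mink hdψ h.smooth) hw)
      (h.diff (SmoothOn.mink hψ h.smooth_dz) hw), dz_mink (h.diff hdψ hw) (h.diff h.smooth hw),
      dz_mink (h.diff hψ hw) (h.diff h.smooth_dz hw), dzdz_eq (Y := Y), mink_sub_right, mink_smul_right,
      horth w hw] at this
    linear_combination this
  have m1 : mink (star (dz (dz Y) w)) (dzbar (dz Y) w) = star (schwarzian Y w) / 4 := by
    rw [dzdz_eq, star_sub, star_smul, h.real w hw, h.dzbardz_eq hw]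
    simp only [mink_sub_left, mink_sub_right, mink_smul_left, mink_smul_right,
      h.mink_star_hopf_self hw, h.null w hw, h.mink_self_frameN hw]
    have : mink (star (hopf Y w)) (frameN Y w) = 0 := by
      rw [← h.star_frameN hw, ← mink_star, h.mink_hopf_frameN hw, star_zero]
    rw [this, star_div₀, star_ofNat]
    ring
  have m2 : mink (dz (dz Y) w) (star (dz (dz Y) w)) = mink (hopf Y w) (star (hopf Y w)) := by
    rw [dzdz_eq, star_sub, star_smul, h.real w hw]
    simp only [mink_sub_left, mink_sub_right, mink_smul_left, mink_smul_right,
      mink_comm (Y w) (star _), h.mink_star_hopf_self hw, h.null w hw, h.mink_hopf_self hw]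
    ring
  have e1 : liftVariation Y ψ w = mink (dz (dz ψ) w) (star (hopf Y w))
      + star (schwarzian Y w) / 2 * mink (ψ w) (hopf Y w)
      - 2 * mink (hopf Y w) (star (hopf Y w)) * mink (dz ψ w) (dzbar Y w) := by
    rw [liftVariation, m1, m2]
    conv_lhs => rw [dzdz_eq (Y := Y), star_sub, star_smul, h.real w hw, mink_sub_right,
      mink_smul_right, o2]
    rw [star_div₀, star_ofNat]
    ring
  obtain ⟨c, hc⟩ := h.dzbar_normalDzbar_hopf_eq hw
  have e2 : dz (variationFlux Y ψ) w = mink (dz (dz ψ) w) (star (hopf Y w))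
      - 2 * mink (star (hopf Y w)) (normalDzbar Y (hopf Y) w) * mink (ψ w) (dz Y w)
      - 2 * mink (hopf Y w) (star (hopf Y w)) * mink (dz ψ w) (dzbar Y w)
      - mink (ψ w) (star (normalDzbar Y (normalDzbar Y (hopf Y)) w))
      + 2 * mink (star (normalDzbar Y (hopf Y) w)) (hopf Y w) * mink (ψ w) (dzbar Y w) := by
    have : variationFlux Y ψ = fun x => mink (dz ψ x) (star (hopf Y x))
        + (-1 : ℂ) • mink (ψ x) (star (normalDzbar Y (hopf Y) x)) := by
      funext x; simp [variationFlux, sub_eq_add_neg]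
    have d1 := h.diff (SmoothOn.mink hψ (SmoothOn.star hD)) hw
    rw [this, dz_add (h.diff (SmoothOn.mink hdψ (SmoothOn.star hκ)) hw) (d1.fun_const_smul _),
      dz_const_smul _ d1, dz_mink (h.diff hdψ hw) (h.diff (SmoothOn.star hκ) hw),
      dz_mink (h.diff hψ hw) (h.diff (SmoothOn.star hD) hw), dz_star (h.diff hκ hw),
      dz_star (h.diff hD hw), h.dzbar_hopf_eq hw, hc]
    simp only [star_add, star_smul, star_neg, star_mul', star_ofNat, mink_star, star_star,
      h.real w hw, h.star_dz hw, mink_add_right, mink_smul_right, o1 w hw, horth w hw,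
      mink_comm (star (hopf Y w)) (hopf Y w), smul_eq_mul]
    ring
  have t1 : star (mink (star (hopf Y w)) (normalDzbar Y (hopf Y) w))
      = mink (star (normalDzbar Y (hopf Y) w)) (hopf Y w) := by
    rw [mink_star, star_star, mink_comm]
  have t2 : star (mink (star (normalDzbar Y (hopf Y) w)) (hopf Y w))
      = mink (star (hopf Y w)) (normalDzbar Y (hopf Y) w) := by rw [← t1, star_star]
  have t3 : star (mink (ψ w) (dz Y w)) = mink (ψ w) (dzbar Y w) := by
    rw [mink_star, hreal w hw, h.star_dz hw]
  have t4 : star (mink (ψ w) (dzbar Y w)) = mink (ψ w) (dz Y w) := by rw [← t3, star_star]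
  have t5 : star (mink (ψ w) (star (normalDzbar Y (normalDzbar Y (hopf Y)) w)))
      = mink (ψ w) (normalDzbar Y (normalDzbar Y (hopf Y)) w) := by
    rw [mink_star, hreal w hw, star_star]
  -- Codazzi makes the pairing real, so it splits evenly between the expression and its conjugate.
  have e3 : 2 * mink (ψ w) (willmoreTensor Y w)
      = mink (ψ w) (willmoreTensor Y w) + star (mink (ψ w) (willmoreTensor Y w)) := by
    rw [mink_star, hreal w hw, h.star_willmoreTensor hw]; ring
  rw [e3, e1, e2]
  simp only [willmoreTensor, mink_add_right, mink_smul_right, star_add, star_sub, star_mul', t1,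
    t2, t3, t4, t5, star_div₀, star_ofNat, star_star, starRingEnd_apply]
  have t6 : star (mink (ψ w) (normalDzbar Y (normalDzbar Y (hopf Y)) w))
      = mink (ψ w) (star (normalDzbar Y (normalDzbar Y (hopf Y)) w)) := by rw [← t5, star_star]
  rw [t6]
  ring

end IsCanonical

/-! ### The density in terms of the two-jet -/

section Jet

variable {V : Type*} [NormedAddCommGroup V] [InnerProductSpace ℝ V]

/-- The determinant of the first fundamental form. -/
def gramDet (p q : V) : ℝ := inner ℝ p p * inner ℝ q q - inner ℝ p q ^ 2

/-- The product of the components of `x` and `y` orthogonal to `p` and `q`. -/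
def projInner (p q x y : V) : ℝ :=
  inner ℝ x y - (inner ℝ q q * (inner ℝ x p * inner ℝ y p)
    - inner ℝ p q * (inner ℝ x p * inner ℝ y q + inner ℝ x q * inner ℝ y p)
    + inner ℝ p p * (inner ℝ x q * inner ℝ y q)) / gramDet p q

/-- The Möbius density of a map with first derivatives `p, q` and second derivatives `r, s, v`. -/
def jetDensity (p q r s v : V) : ℝ :=
  √(gramDet p q) / 8 * ((inner ℝ q q ^ 2 * projInner p q r r
      + 4 * inner ℝ p q ^ 2 * projInner p q s s + inner ℝ p p ^ 2 * projInner p q v v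
      - 4 * inner ℝ p q * inner ℝ q q * projInner p q r s
      + 2 * inner ℝ p p * inner ℝ q q * projInner p q r v
      - 4 * inner ℝ p p * inner ℝ p q * projInner p q s v) / (2 * gramDet p q ^ 2)
    - 2 * (projInner p q r v - projInner p q s s) / gramDet p q)

end Jet

theorem firstFF_det {n : ℕ} (f : ℂ → EuclideanSpace ℝ (Fin (n + 1))) (w : ℂ) :
    (firstFF f w).det = gramDet (pd 0 f w) (pd 1 f w) := by
  simp [firstFF, Matrix.det_fin_two, gramDet, real_inner_comm (pd 0 f w) (pd 1 f w)]
  ring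

theorem firstFF_inv {n : ℕ} (f : ℂ → EuclideanSpace ℝ (Fin (n + 1))) (w : ℂ) :
    (firstFF f w)⁻¹ 0 0 = inner ℝ (pd 1 f w) (pd 1 f w) / gramDet (pd 0 f w) (pd 1 f w) ∧
    (firstFF f w)⁻¹ 0 1 = -inner ℝ (pd 0 f w) (pd 1 f w) / gramDet (pd 0 f w) (pd 1 f w) ∧
    (firstFF f w)⁻¹ 1 0 = -inner ℝ (pd 0 f w) (pd 1 f w) / gramDet (pd 0 f w) (pd 1 f w) ∧
    (firstFF f w)⁻¹ 1 1 = inner ℝ (pd 0 f w) (pd 0 f w) / gramDet (pd 0 f w) (pd 1 f w) := by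
  rw [Matrix.inv_def, firstFF_det, Ring.inverse_eq_inv', Matrix.adjugate_fin_two]
  simp [firstFF, div_eq_inv_mul, real_inner_comm (pd 0 f w) (pd 1 f w)]

/-- Cramer's rule for the Gram matrix of the tangent plane; nondegeneracy is needed to clear its
determinant. -/
theorem inner_normalPart {n : ℕ} (f : ℂ → EuclideanSpace ℝ (Fin (n + 1))) (w : ℂ)
    (hΔ : gramDet (pd 0 f w) (pd 1 f w) ≠ 0) (x y : EuclideanSpace ℝ (Fin (n + 1))) :
    inner ℝ (normalPart f w x) (normalPart f w y)
      = projInner (pd 0 f w) (pd 1 f w) x y := by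
  obtain ⟨h00, h01, h10, h11⟩ := firstFF_inv f w
  simp only [normalPart, Fin.sum_univ_two, h00, h01, h10, h11]
  generalize pd 0 f w = p at *
  generalize pd 1 f w = q at *
  have hΔ' : inner ℝ p p * inner ℝ q q - inner ℝ p q ^ 2 ≠ 0 := hΔ
  simp only [inner_sub_left, inner_sub_right, inner_add_left, inner_add_right,
    real_inner_smul_left, real_inner_smul_right, projInner, gramDet]
  rw [real_inner_comm y p, real_inner_comm y q, real_inner_comm p q]
  field_simp
  ring

/-- In dimension two $|II^\circ|^2=\frac12|\mathrm{tr}\,II|^2-2(\langle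
II_{00},II_{11}\rangle-|II_{01}|^2)/\det g$, which removes the fourfold sum. Equality of mixed
derivatives leaves three second derivatives. -/
theorem mobiusDensity_eq {n : ℕ} (f : ℂ → EuclideanSpace ℝ (Fin (n + 1))) (w : ℂ)
    (hΔ : gramDet (pd 0 f w) (pd 1 f w) ≠ 0) (hsymm : pd 1 (pd 0 f) w = pd 0 (pd 1 f) w) :
    mobiusDensity f w = jetDensity (pd 0 f w) (pd 1 f w) (pd 0 (pd 0 f) w) (pd 0 (pd 1 f) w)
      (pd 1 (pd 1 f) w) := by
  obtain ⟨h00, h01, h10, h11⟩ := firstFF_inv f w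
  have g00 : firstFF f w 0 0 = inner ℝ (pd 0 f w) (pd 0 f w) := rfl
  have g01 : firstFF f w 0 1 = inner ℝ (pd 0 f w) (pd 1 f w) := rfl
  have g10 : firstFF f w 1 0 = inner ℝ (pd 0 f w) (pd 1 f w) :=
    real_inner_comm (pd 0 f w) (pd 1 f w)
  have g11 : firstFF f w 1 1 = inner ℝ (pd 1 f w) (pd 1 f w) := rfl
  simp only [mobiusDensity, traceFreeFF, Fin.sum_univ_two, h00, h01, h10, h11, g00, g01, g10, g11,
    firstFF_det, secondFF, hsymm, jetDensity, ← inner_normalPart f w hΔ]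
  generalize normalPart f w (pd 0 (pd 0 f) w) = a
  generalize normalPart f w (pd 0 (pd 1 f) w) = b
  generalize normalPart f w (pd 1 (pd 1 f) w) = c
  generalize hD : gramDet (pd 0 f w) (pd 1 f w) = D at *
  rw [gramDet] at hD
  generalize inner ℝ (pd 0 f w) (pd 0 f w) = e at *
  generalize inner ℝ (pd 0 f w) (pd 1 f w) = k at *
  generalize inner ℝ (pd 1 f w) (pd 1 f w) = g at *
  simp only [inner_sub_left, inner_sub_right, inner_add_left, inner_add_right,
    real_inner_smul_left, real_inner_smul_right]
  simp only [real_inner_comm a b, real_inner_comm a c, real_inner_comm b c]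
  generalize √D = S
  generalize inner ℝ a a = aa
  generalize inner ℝ a b = ab
  generalize inner ℝ a c = ac
  generalize inner ℝ b b = bb
  generalize inner ℝ b c = bc
  generalize inner ℝ c c = cc
  field_simp
  rw [← hD]
  ring

/-! ### The derivative of the density at a conformal jet -/

section JetDerivative

variable {V : Type*} [NormedAddCommGroup V] [InnerProductSpace ℝ V]
  {p q r s v x y : ℝ → V} {p' q' r' s' v' x' y' : V} {e : ℝ}

theorem hasDerivAt_gramDet (hp : HasDerivAt p p' 0) (hq : HasDerivAt q q' 0)
    (hpp : inner ℝ (p 0) (p 0) = e) (hqq : inner ℝ (q 0) (q 0) = e)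
    (hpq : inner ℝ (p 0) (q 0) = 0) :
    HasDerivAt (fun t => gramDet (p t) (q t))
      (e * (2 * inner ℝ p' (p 0) + 2 * inner ℝ q' (q 0))) 0 := by
  refine (((hp.inner ℝ hp).fun_mul (hq.inner ℝ hq)).fun_sub
    ((hp.inner ℝ hq).fun_pow 2)).congr_deriv ?_
  rw [hpp, hqq, hpq, real_inner_comm (p 0) p', real_inner_comm (q 0) q']
  ring

theorem gramDet_of_conformal {p q : V} (hpp : inner ℝ p p = e) (hqq : inner ℝ q q = e)
    (hpq : inner ℝ p q = 0) : gramDet p q = e ^ 2 := by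
  rw [gramDet, hpp, hqq, hpq]; ring

theorem projInner_of_conformal {p q : V} (he : e ≠ 0) (hpp : inner ℝ p p = e)
    (hqq : inner ℝ q q = e) (hpq : inner ℝ p q = 0) (x y : V) : projInner p q x y
      = inner ℝ x y - (inner ℝ x p * inner ℝ y p + inner ℝ x q * inner ℝ y q) / e := by
  rw [projInner, gramDet_of_conformal hpp hqq hpq, hpp, hqq, hpq]
  field_simp
  ring

theorem hasDerivAt_projInner (he : e ≠ 0) (hp : HasDerivAt p p' 0) (hq : HasDerivAt q q' 0)
    (hx : HasDerivAt x x' 0) (hy : HasDerivAt y y' 0)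
    (hpp : inner ℝ (p 0) (p 0) = e) (hqq : inner ℝ (q 0) (q 0) = e)
    (hpq : inner ℝ (p 0) (q 0) = 0) :
    HasDerivAt (fun t => projInner (p t) (q t) (x t) (y t))
      (inner ℝ x' (y 0) + inner ℝ (x 0) y'
        - ((inner ℝ x' (p 0) + inner ℝ (x 0) p') * inner ℝ (y 0) (p 0)
          + inner ℝ (x 0) (p 0) * (inner ℝ y' (p 0) + inner ℝ (y 0) p')
          + (inner ℝ x' (q 0) + inner ℝ (x 0) q') * inner ℝ (y 0) (q 0)
          + inner ℝ (x 0) (q 0) * (inner ℝ y' (q 0) + inner ℝ (y 0) q')) / e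
        + (2 * inner ℝ p' (p 0) * (inner ℝ (x 0) (p 0) * inner ℝ (y 0) (p 0))
          + 2 * inner ℝ q' (q 0) * (inner ℝ (x 0) (q 0) * inner ℝ (y 0) (q 0))
          + (inner ℝ p' (q 0) + inner ℝ q' (p 0))
            * (inner ℝ (x 0) (p 0) * inner ℝ (y 0) (q 0)
              + inner ℝ (x 0) (q 0) * inner ℝ (y 0) (p 0))) / e ^ 2) 0 := by
  have hg0 := gramDet_of_conformal hpp hqq hpq
  have hd := hasDerivAt_gramDet hp hq hpp hqq hpq
  have hne : gramDet (p 0) (q 0) ≠ 0 := by rw [hg0]; positivity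
  refine ((hx.inner ℝ hy).fun_sub (((((hq.inner ℝ hq).fun_mul
    ((hx.inner ℝ hp).fun_mul (hy.inner ℝ hp))).fun_sub ((hp.inner ℝ hq).fun_mul
    (((hx.inner ℝ hp).fun_mul (hy.inner ℝ hq)).fun_add
      ((hx.inner ℝ hq).fun_mul (hy.inner ℝ hp))))).fun_add
    ((hp.inner ℝ hp).fun_mul ((hx.inner ℝ hq).fun_mul (hy.inner ℝ hq)))).fun_div hd hne)).congr_deriv ?_
  rw [hg0, hpp, hqq, hpq, real_inner_comm (p 0) p', real_inner_comm (q 0) q',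
    real_inner_comm q' (p 0)]
  field_simp
  ring

/-- The base jet is conformal, and $a,b$ parametrize the tangential parts that differentiated
conformality allows for second derivatives. The primed vectors are arbitrary: the last two terms
measure the first-order change of conformal structure. -/
theorem hasDerivAt_jetDensity (he : 0 < e) (hp : HasDerivAt p p' 0) (hq : HasDerivAt q q' 0)
    (hr : HasDerivAt r r' 0) (hs : HasDerivAt s s' 0) (hv : HasDerivAt v v' 0)
    (hpp : inner ℝ (p 0) (p 0) = e) (hqq : inner ℝ (q 0) (q 0) = e)
    (hpq : inner ℝ (p 0) (q 0) = 0) {a b : ℝ}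
    (hrp : inner ℝ (r 0) (p 0) = a) (hsp : inner ℝ (s 0) (p 0) = b)
    (hvp : inner ℝ (v 0) (p 0) = -a) (hrq : inner ℝ (r 0) (q 0) = -b)
    (hsq : inner ℝ (s 0) (q 0) = a) (hvq : inner ℝ (v 0) (q 0) = b) :
    HasDerivAt (fun t => jetDensity (p t) (q t) (r t) (s t) (v t))
      (-((inner ℝ p' (p 0) + inner ℝ q' (q 0)) / (16 * e ^ 2)) *
          (inner ℝ (r 0) (r 0) - 2 * inner ℝ (r 0) (v 0) + inner ℝ (v 0) (v 0)
            + 4 * inner ℝ (s 0) (s 0) - 16 * (a ^ 2 + b ^ 2) / e)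
        + (inner ℝ r' (r 0) - inner ℝ r' (v 0) - inner ℝ v' (r 0) + inner ℝ v' (v 0)
            + 4 * inner ℝ s' (s 0)) / (8 * e)
        - (a * (inner ℝ r' (p 0) + inner ℝ (r 0) p' - inner ℝ v' (p 0) - inner ℝ (v 0) p')
            - b * (inner ℝ r' (q 0) + inner ℝ (r 0) q' - inner ℝ v' (q 0) - inner ℝ (v 0) q')
            + 2 * b * (inner ℝ s' (p 0) + inner ℝ (s 0) p')
            + 2 * a * (inner ℝ s' (q 0) + inner ℝ (s 0) q')) / (4 * e ^ 2)
        - (inner ℝ p' (p 0) - inner ℝ q' (q 0)) / (8 * e ^ 2)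
            * (inner ℝ (r 0) (r 0) - inner ℝ (v 0) (v 0))
        - (inner ℝ p' (q 0) + inner ℝ q' (p 0)) / (4 * e ^ 2)
            * (inner ℝ (r 0) (s 0) + inner ℝ (s 0) (v 0))) 0 := by
  have he' := he.ne'
  have hg0 := gramDet_of_conformal hpp hqq hpq
  have hd := hasDerivAt_gramDet hp hq hpp hqq hpq
  have hne : gramDet (p 0) (q 0) ≠ 0 := by rw [hg0]; positivity
  have hS := hd.sqrt hne
  have P := fun {x y : ℝ → V} {x' y' : V} (hx : HasDerivAt x x' 0) (hy : HasDerivAt y y' 0) =>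
    hasDerivAt_projInner he' hp hq hx hy hpp hqq hpq
  have hE := hp.inner ℝ hp
  have hF := hp.inner ℝ hq
  have hG := hq.inner ℝ hq
  have hN := ((((((hG.fun_pow 2).fun_mul (P hr hr)).fun_add
    (((hF.fun_pow 2).const_mul 4).fun_mul (P hs hs))).fun_add
    ((hE.fun_pow 2).fun_mul (P hv hv))).fun_sub
    (((hF.const_mul 4).fun_mul hG).fun_mul (P hr hs))).fun_add
    (((hE.const_mul 2).fun_mul hG).fun_mul (P hr hv))).fun_sub
    (((hE.const_mul 4).fun_mul hF).fun_mul (P hs hv))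
  have hne2 : 2 * gramDet (p 0) (q 0) ^ 2 ≠ 0 := by positivity
  have key := (hS.div_const 8).fun_mul ((hN.fun_div ((hd.fun_pow 2).const_mul 2) hne2).fun_sub
    ((((P hr hv).fun_sub (P hs hs)).const_mul 2).fun_div hd hne))
  refine key.congr_deriv ?_
  simp only [projInner_of_conformal he' hpp hqq hpq, hg0, Real.sqrt_sq he.le, hpp, hqq, hpq, hrp, hsp, hvp,
    hrq, hsq, hvq, real_inner_comm p' (p 0), real_inner_comm q' (q 0), real_inner_comm q' (p 0),
    real_inner_comm r' (r 0), real_inner_comm s' (s 0), real_inner_comm v' (v 0),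
    real_inner_comm v' (r 0), real_inner_comm s' (r 0), real_inner_comm v' (s 0)]
  field_simp
  ring

end JetDerivative

/-! ### Conformal invariance of the first variation -/

/-- A real conformal lift into the light cone. -/
structure IsConformalLift {n : ℕ} (U : Set ℂ) (X : ℂ → CMink n) : Prop where
  isOpen : IsOpen U
  smooth : ContDiffOn ℝ ∞ X U
  real : ∀ w ∈ U, star (X w) = X w
  null : ∀ w ∈ U, mink (X w) (X w) = 0
  conformal : ∀ w ∈ U, mink (dz X w) (dz X w) = 0

/-- The integrand of the first variation, up to complex conjugation, in terms of an arbitrary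
conformal lift `X`. -/
def conformalVariation {n : ℕ} (X χ : ℂ → CMink n) (w : ℂ) : ℂ :=
  1 / (2 * mink (dz X w) (dzbar X w)) * (mink (dz (dz χ) w) (star (dz (dz X) w))
    - star (mink (dz (dz X) w) (dzbar X w)) / mink (dz X w) (dzbar X w)
      * mink (dz (dz χ) w) (dzbar X w)
    - mink (dz (dz X) w) (dzbar X w) / mink (dz X w) (dzbar X w)
      * mink (dz χ w) (star (dz (dz X) w))
    + 2 * (mink (dz (dz X) w) (dzbar X w) * star (mink (dz (dz X) w) (dzbar X w))
      / mink (dz X w) (dzbar X w) ^ 2) * mink (dz χ w) (dzbar X w))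
  - 1 / mink (dz X w) (dzbar X w) ^ 2 * mink (star (dz (dz X) w)) (dzbar (dz X) w)
      * mink (dz χ w) (dz X w)
  - 1 / (2 * mink (dz X w) (dzbar X w) ^ 2) * mink (dz (dz X) w) (star (dz (dz X) w))
      * mink (dz χ w) (dzbar X w)

namespace IsConformalLift

variable {n : ℕ} {U : Set ℂ} {X χ : ℂ → CMink n} (h : IsConformalLift U X) {w : ℂ} {a : ℂ → ℂ}
include h

theorem smooth_dz : ContDiffOn ℝ ∞ (dz X) U := SmoothOn.dz h.isOpen h.smooth

theorem smooth_dzbar : ContDiffOn ℝ ∞ (dzbar X) U := SmoothOn.dzbar h.isOpen h.smooth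

theorem diff {E : Type*} [NormedAddCommGroup E] [NormedSpace ℝ E] {f : ℂ → E}
    (hf : ContDiffOn ℝ ∞ f U) (hw : w ∈ U) : DifferentiableAt ℝ f w :=
  SmoothOn.differentiableAt h.isOpen hf hw

theorem star_dz (hw : w ∈ U) : star (dz X w) = dzbar X w := by
  rw [← dzbar_star (h.diff h.smooth hw)]
  exact dzbar_congr h.isOpen h.real hw

theorem star_dzbar (hw : w ∈ U) : star (dzbar X w) = dz X w := by
  rw [← h.star_dz hw, star_star]

theorem dz_dzbar (hw : w ∈ U) : dz (dzbar X) w = dzbar (dz X) w :=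
  dz_dzbar_comm h.isOpen h.smooth hw

theorem star_dzbardz (hw : w ∈ U) : star (dzbar (dz X) w) = dzbar (dz X) w := by
  rw [← dz_star (h.diff h.smooth_dz hw), ← h.dz_dzbar hw]
  exact dz_congr h.isOpen (fun _ hx => h.star_dz hx) hw

theorem mink_dz_self (hw : w ∈ U) : mink (dz X w) (X w) = 0 := by
  have := mink_dz_of_const h.isOpen h.smooth h.smooth h.null hw
  rw [mink_comm (X w)] at this
  linear_combination this / 2

theorem mink_dzbar_self (hw : w ∈ U) : mink (dzbar X w) (X w) = 0 := by
  rw [← h.star_dz hw, ← h.real w hw, ← mink_star, h.mink_dz_self hw, star_zero]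

theorem mink_dzbar_dzbar (hw : w ∈ U) : mink (dzbar X w) (dzbar X w) = 0 := by
  rw [← h.star_dz hw, ← mink_star, h.conformal w hw, star_zero]

theorem mink_dzbardz_self (hw : w ∈ U) :
    mink (dzbar (dz X) w) (X w) = -mink (dz X w) (dzbar X w) :=
  mink_dzbar_of_const h.isOpen h.smooth_dz h.smooth (fun _ hx => h.mink_dz_self hx) hw

theorem mink_dzbardz_dz (hw : w ∈ U) : mink (dzbar (dz X) w) (dz X w) = 0 := by
  have := mink_dzbar_of_const h.isOpen h.smooth_dz h.smooth_dz h.conformal hw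
  rw [mink_comm (dz X w)] at this
  linear_combination this / 2

theorem mink_dzbardz_dzbar (hw : w ∈ U) : mink (dzbar (dz X) w) (dzbar X w) = 0 := by
  rw [← h.star_dz hw, ← h.star_dzbardz hw, ← mink_star, h.mink_dzbardz_dz hw, star_zero]

theorem mink_dzdz_self (hw : w ∈ U) : mink (dz (dz X) w) (X w) = 0 := by
  rw [mink_dz_of_const h.isOpen h.smooth_dz h.smooth (fun x hx => h.mink_dz_self hx) hw,
    h.conformal w hw, neg_zero]

theorem mink_dzdz_dz (hw : w ∈ U) : mink (dz (dz X) w) (dz X w) = 0 := by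
  have := mink_dz_of_const h.isOpen h.smooth_dz h.smooth_dz h.conformal hw
  rw [mink_comm (dz X w)] at this
  linear_combination this / 2

theorem dz_smul_eq (ha : ContDiffOn ℝ ∞ a U) (hχ : ContDiffOn ℝ ∞ χ U) (hw : w ∈ U) :
    dz (fun x => a x • χ x) w = dz a w • χ w + a w • dz χ w :=
  dz_smul (h.diff ha hw) (h.diff hχ hw)

theorem dzbar_smul_eq (ha : ContDiffOn ℝ ∞ a U) (hχ : ContDiffOn ℝ ∞ χ U) (hw : w ∈ U) :
    dzbar (fun x => a x • χ x) w = dzbar a w • χ w + a w • dzbar χ w :=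
  dzbar_smul (h.diff ha hw) (h.diff hχ hw)

theorem dz_dz_smul_eq (ha : ContDiffOn ℝ ∞ a U) (hχ : ContDiffOn ℝ ∞ χ U) (hw : w ∈ U) :
    dz (dz (fun x => a x • χ x)) w
      = dz (dz a) w • χ w + (2 * dz a w) • dz χ w + a w • dz (dz χ) w := by
  have hda := SmoothOn.dz h.isOpen ha
  have hdχ := SmoothOn.dz h.isOpen hχ
  rw [dz_congr h.isOpen (fun _ hx => h.dz_smul_eq ha hχ hx) hw,
    dz_add (h.diff (SmoothOn.smul hda hχ) hw) (h.diff (SmoothOn.smul ha hdχ) hw),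
    h.dz_smul_eq hda hχ hw, h.dz_smul_eq ha hdχ hw]
  module

theorem dzbar_dz_smul_eq (ha : ContDiffOn ℝ ∞ a U) (hχ : ContDiffOn ℝ ∞ χ U) (hw : w ∈ U) :
    dzbar (dz (fun x => a x • χ x)) w = dzbar (dz a) w • χ w + dz a w • dzbar χ w
      + dzbar a w • dz χ w + a w • dzbar (dz χ) w := by
  have hda := SmoothOn.dz h.isOpen ha
  have hdχ := SmoothOn.dz h.isOpen hχ
  rw [dzbar_congr h.isOpen (fun x hx => h.dz_smul_eq ha hχ hx) hw,
    dzbar_add (h.diff (SmoothOn.smul hda hχ) hw) (h.diff (SmoothOn.smul ha hdχ) hw),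
    h.dzbar_smul_eq hda hχ hw, h.dzbar_smul_eq ha hdχ hw]
  module

/-- Normalizing a conformal lift gives a canonical lift. -/
theorem isCanonical_smul (ha : ContDiffOn ℝ ∞ a U) (hreal : ∀ x ∈ U, star (a x) = a x)
    (hB : ∀ x ∈ U, a x ^ 2 * mink (dz X x) (dzbar X x) = 1 / 2) :
    IsCanonical U (fun x => a x • X x) where
  isOpen := h.isOpen
  smooth := SmoothOn.smul ha h.smooth
  real w hw := by rw [star_smul, hreal w hw, h.real w hw]
  null w hw := by rw [mink_smul_left, mink_smul_right, h.null w hw]; ring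
  conformal w hw := by
    rw [h.dz_smul_eq ha h.smooth hw]
    simp only [mink_add_left, mink_add_right, mink_smul_left, mink_smul_right, h.null w hw,
      h.conformal w hw, mink_comm (X w) (dz X w), h.mink_dz_self hw]
    ring
  normalized w hw := by
    rw [h.dz_smul_eq ha h.smooth hw, h.dzbar_smul_eq ha h.smooth hw, ← hB w hw]
    simp only [mink_add_left, mink_add_right, mink_smul_left, mink_smul_right, h.null w hw,
      mink_comm (X w) (dzbar X w), h.mink_dz_self hw, h.mink_dzbar_self hw]
    ring

/-- Conformal invariance of the first variation. In `conformalVariation` the scale appears only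
through $\langle X_z,X_{\bar z}\rangle$ and $\langle X_{zz},X_{\bar z}\rangle$; when these are
$\frac12$ and $0$ it reduces to `liftVariation`. Conjugates are added because only the real parts
are compared. -/
theorem liftVariation_smul (hχ : ContDiffOn ℝ ∞ χ U) (hχr : ∀ x ∈ U, star (χ x) = χ x)
    (horth : ∀ x ∈ U, mink (χ x) (X x) = 0) (ha : ContDiffOn ℝ ∞ a U)
    (hreal : ∀ x ∈ U, star (a x) = a x)
    (hB : ∀ x ∈ U, a x ^ 2 * mink (dz X x) (dzbar X x) = 1 / 2) (hw : w ∈ U) :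
    liftVariation (fun x => a x • X x) (fun x => a x • χ x) w
        + star (liftVariation (fun x => a x • X x) (fun x => a x • χ x) w)
      = conformalVariation X χ w + star (conformalVariation X χ w) := by
  have hdχ := SmoothOn.dz h.isOpen hχ
  have a0 : a w ≠ 0 := by
    intro h0
    have := hB w hw
    rw [h0] at this
    norm_num at this
  have o1 : ∀ x ∈ U, mink (dz χ x) (X x) = -mink (χ x) (dz X x) := fun x hx =>
    mink_dz_of_const h.isOpen hχ h.smooth horth hx
  have o2 : mink (dz (dz χ) w) (X w)
      = -(2 * mink (dz χ w) (dz X w)) - mink (χ w) (dz (dz X) w) := by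
    have e : Set.EqOn (fun x => mink (dz χ x) (X x) + mink (χ x) (dz X x)) (fun _ => 0) U := by
      intro x hx; simp [o1 x hx]
    have := dz_congr h.isOpen e hw
    rw [dz_const, dz_add (h.diff (SmoothOn.mink hdχ h.smooth) hw)
      (h.diff (SmoothOn.mink hχ h.smooth_dz) hw), dz_mink (h.diff hdχ hw) (h.diff h.smooth hw),
      dz_mink (h.diff hχ hw) (h.diff h.smooth_dz hw)] at this
    linear_combination this
  have hBv : mink (dz X w) (dzbar X w) = 1 / (2 * a w ^ 2) := by
    have := hB w hw
    field_simp
    linear_combination 2 * this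
  -- Differentiating $a^2\langle X_z,X_{\bar z}\rangle=\frac12$ trades the derivative of the scale
  -- for a product of jets, since $\langle X_z,X_{z\bar z}\rangle=0$.
  have hβ : mink (dz (dz X) w) (dzbar X w) = -(dz a w / a w ^ 3) := by
    have e := dz_congr h.isOpen hB hw
    have e1 : (fun x => a x ^ 2 * mink (dz X x) (dzbar X x))
        = fun x => (a x * a x) * mink (dz X x) (dzbar X x) := by funext x; ring
    rw [e1, dz_const, dz_mul ((h.diff ha hw).fun_mul (h.diff ha hw))
      (h.diff (SmoothOn.mink h.smooth_dz h.smooth_dzbar) hw),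
      dz_mul (h.diff ha hw) (h.diff ha hw), dz_mink (h.diff h.smooth_dz hw)
      (h.diff h.smooth_dzbar hw), h.dz_dzbar hw, mink_comm (dz X w) (dzbar (dz X) w),
      h.mink_dzbardz_dz hw, hBv] at e
    field_simp at e ⊢
    linear_combination e / 2
  have hda : dzbar a w = star (dz a w) := by
    rw [← dzbar_star (h.diff ha hw)]
    exact dzbar_congr h.isOpen (fun x hx => (hreal x hx).symm) hw
  have s1 : mink (star (dz (dz X) w)) (X w) = 0 := by
    rw [← h.real w hw, ← mink_star, h.mink_dzdz_self hw, star_zero]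
  have s2 : mink (star (dz (dz X) w)) (dzbar X w) = 0 := by
    rw [← h.star_dz hw, ← mink_star, h.mink_dzdz_dz hw, star_zero]
  have s3 : mink (star (dz (dz X) w)) (dz X w) = -(star (dz a w) / a w ^ 3) := by
    rw [← h.star_dzbar hw, ← mink_star, hβ]
    simp [hreal w hw]
  have c1 : mink (χ w) (dzbar X w) = star (mink (χ w) (dz X w)) := by
    rw [mink_star, hχr w hw, h.star_dz hw]
  have c2 : mink (χ w) (star (dz (dz X) w)) = star (mink (χ w) (dz (dz X) w)) := by
    rw [mink_star, hχr w hw]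
  have g1 : star (mink (dz (dz X) w) (star (dz (dz X) w)))
      = mink (dz (dz X) w) (star (dz (dz X) w)) := by
    rw [mink_star, star_star, mink_comm]
  simp only [liftVariation, conformalVariation, h.dz_smul_eq ha h.smooth hw,
    h.dz_smul_eq ha hχ hw, h.dzbar_smul_eq ha h.smooth hw, h.dz_dz_smul_eq ha h.smooth hw,
    h.dz_dz_smul_eq ha hχ hw, h.dzbar_dz_smul_eq ha h.smooth hw, hda, hBv, hβ]
  simp only [star_add, star_smul, h.real w hw, h.star_dz hw, hreal w hw, star_mul', star_ofNat,
    mink_add_left, mink_add_right, mink_smul_left, mink_smul_right, o1 w hw, o2, horth w hw, s1, s2,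
    s3, c1, c2, h.null w hw, h.mink_dzdz_self hw, hβ, hBv,
    mink_comm (X w) (dz X w), mink_comm (X w) (dzbar X w), mink_comm (X w) (dzbar (dz X) w),
    mink_comm (X w) (star _), mink_comm (dz X w) (star _),
    mink_comm (dzbar X w) (dzbar (dz X) w),
    mink_comm (dzbar X w) (dz X w),
    h.mink_dz_self hw, h.mink_dzbar_self hw, h.mink_dzbar_dzbar hw,
    h.mink_dzbardz_self hw, h.mink_dzbardz_dzbar hw]
  simp only [star_add, star_sub, star_neg, star_mul', star_div₀, star_pow, star_star, star_ofNat,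
    star_one, star_zero, hreal w hw, g1]
  field_simp
  ring

end IsConformalLift

/-! ### Lifts of maps into the sphere -/

section SphereLift

variable {n : ℕ}

/-- The inclusion of the Euclidean space as the space-like coordinates. -/
def embL (n : ℕ) : EuclideanSpace ℝ (Fin (n + 1)) →L[ℝ] CMink n :=
  LinearMap.toContinuousLinearMap
    { toFun := fun x => Fin.cons 0 (fun i => ((x i : ℝ) : ℂ))
      map_add' := fun x y => by
        funext i; refine Fin.cases ?_ (fun j => ?_) i <;> simp
      map_smul' := fun c x => by
        funext i; refine Fin.cases ?_ (fun j => ?_) i <;> simp }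

theorem embL_zero (x : EuclideanSpace ℝ (Fin (n + 1))) : embL n x 0 = 0 := rfl

theorem embL_succ (x : EuclideanSpace ℝ (Fin (n + 1))) (i : Fin (n + 1)) :
    embL n x i.succ = ((x i : ℝ) : ℂ) := rfl

theorem star_embL (x : EuclideanSpace ℝ (Fin (n + 1))) : star (embL n x) = embL n x := by
  funext i; refine Fin.cases ?_ (fun j => ?_) i <;> simp [embL_zero, embL_succ]

theorem mink_embL (x y : EuclideanSpace ℝ (Fin (n + 1))) :
    mink (embL n x) (embL n y) = ((inner ℝ x y : ℝ) : ℂ) := by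
  simp [mink, embL_zero, embL_succ, PiLp.inner_apply, mul_comm]

theorem sphereLift_eq (x : EuclideanSpace ℝ (Fin (n + 1))) :
    sphereLift x = Fin.cons 1 (fun _ => 0) + embL n x := by
  funext i; refine Fin.cases ?_ (fun j => ?_) i <;> simp [embL_zero, embL_succ, sphereLift]

theorem mink_sphereLift (x y : EuclideanSpace ℝ (Fin (n + 1))) :
    mink (sphereLift x) (sphereLift y) = ((inner ℝ x y : ℝ) : ℂ) - 1 := by
  simp [mink, sphereLift, PiLp.inner_apply, mul_comm]
  ring

theorem mink_embL_sphereLift (x y : EuclideanSpace ℝ (Fin (n + 1))) :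
    mink (embL n x) (sphereLift y) = ((inner ℝ x y : ℝ) : ℂ) := by
  simp [mink, sphereLift, embL_zero, embL_succ, PiLp.inner_apply, mul_comm]

theorem star_sphereLift (x : EuclideanSpace ℝ (Fin (n + 1))) :
    star (sphereLift x) = sphereLift x := by
  funext i; refine Fin.cases ?_ (fun j => ?_) i <;> simp [sphereLift]

variable {U : Set ℂ} {f V : ℂ → EuclideanSpace ℝ (Fin (n + 1))} {w : ℂ}

theorem smooth_embL (hf : ContDiffOn ℝ ∞ f U) : ContDiffOn ℝ ∞ (fun x => embL n (f x)) U :=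
  (embL n).contDiff.comp_contDiffOn hf

theorem smooth_sphereLift (hf : ContDiffOn ℝ ∞ f U) :
    ContDiffOn ℝ ∞ (fun x => sphereLift (f x)) U := by
  simp only [sphereLift_eq]
  exact contDiffOn_const.add (smooth_embL hf)

theorem pd_sphereLift (hf : DifferentiableAt ℝ f w) (i : Fin 2) :
    pd i (fun x => sphereLift (f x)) w = embL n (pd i f w) := by
  simp only [sphereLift_eq]
  have he : DifferentiableAt ℝ (fun x => embL n (f x)) w := (embL n).differentiableAt.comp w hf
  rw [pd_add (differentiableAt_const _) he, pd_const, pd_clm _ hf, zero_add]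

theorem dz_sphereLift (hf : DifferentiableAt ℝ f w) : dz (fun x => sphereLift (f x)) w
    = (1 / 2 : ℂ) • (embL n (pd 0 f w) - Complex.I • embL n (pd 1 f w)) := by
  rw [dz, pd_sphereLift hf, pd_sphereLift hf]

theorem dzbar_sphereLift (hf : DifferentiableAt ℝ f w) : dzbar (fun x => sphereLift (f x)) w
    = (1 / 2 : ℂ) • (embL n (pd 0 f w) + Complex.I • embL n (pd 1 f w)) := by
  rw [dzbar, pd_sphereLift hf, pd_sphereLift hf]

theorem dz_embL (hf : DifferentiableAt ℝ f w) : dz (fun x => embL n (f x)) w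
    = (1 / 2 : ℂ) • (embL n (pd 0 f w) - Complex.I • embL n (pd 1 f w)) := by
  rw [dz, pd_clm _ hf, pd_clm _ hf]

theorem dzbar_embL (hf : DifferentiableAt ℝ f w) : dzbar (fun x => embL n (f x)) w
    = (1 / 2 : ℂ) • (embL n (pd 0 f w) + Complex.I • embL n (pd 1 f w)) := by
  rw [dzbar, pd_clm _ hf, pd_clm _ hf]

theorem dz_sub_smul {E : Type*} [NormedAddCommGroup E] [NormedSpace ℂ E] {g h : ℂ → E}
    (hg : DifferentiableAt ℝ g w) (hh : DifferentiableAt ℝ h w) :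
    dz (fun x => (1 / 2 : ℂ) • (g x - Complex.I • h x)) w
      = (1 / 2 : ℂ) • (dz g w - Complex.I • dz h w) := by
  have : (fun x => (1 / 2 : ℂ) • (g x - Complex.I • h x))
      = fun x => (1 / 2 : ℂ) • (g x + (-Complex.I) • h x) := by
    funext x; rw [neg_smul, sub_eq_add_neg]
  rw [this, dz_const_smul _ (hg.fun_add (hh.fun_const_smul _)), dz_add hg (hh.fun_const_smul _),
    dz_const_smul _ hh]
  module

theorem dzbar_sub_smul {E : Type*} [NormedAddCommGroup E] [NormedSpace ℂ E] {g h : ℂ → E}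
    (hg : DifferentiableAt ℝ g w) (hh : DifferentiableAt ℝ h w) :
    dzbar (fun x => (1 / 2 : ℂ) • (g x - Complex.I • h x)) w
      = (1 / 2 : ℂ) • (dzbar g w - Complex.I • dzbar h w) := by
  have : (fun x => (1 / 2 : ℂ) • (g x - Complex.I • h x))
      = fun x => (1 / 2 : ℂ) • (g x + (-Complex.I) • h x) := by
    funext x; rw [neg_smul, sub_eq_add_neg]
  rw [this, dzbar_const_smul _ (hg.fun_add (hh.fun_const_smul _)),
    dzbar_add hg (hh.fun_const_smul _), dzbar_const_smul _ hh]
  module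

theorem dz_half_embL (hU : IsOpen U) (hf : ContDiffOn ℝ ∞ f U) (hw : w ∈ U) :
    dz (fun x => (1 / 2 : ℂ) • (embL n (pd 0 f x) - Complex.I • embL n (pd 1 f x))) w
      = (1 / 4 : ℂ) • (embL n (pd 0 (pd 0 f) w) - embL n (pd 1 (pd 1 f) w)
        - (2 * Complex.I) • embL n (pd 0 (pd 1 f) w)) := by
  have h0 := SmoothOn.pd hU hf 0
  have h1 := SmoothOn.pd hU hf 1
  rw [dz_sub_smul (SmoothOn.differentiableAt hU (smooth_embL h0) hw)
    (SmoothOn.differentiableAt hU (smooth_embL h1) hw),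
    dz_embL (SmoothOn.differentiableAt hU h0 hw), dz_embL (SmoothOn.differentiableAt hU h1 hw),
    pd_comm hU hf hw 1 0]
  match_scalars <;> ring_nf
  rw [Complex.I_sq]; ring

theorem dzbar_half_embL (hU : IsOpen U) (hf : ContDiffOn ℝ ∞ f U) (hw : w ∈ U) :
    dzbar (fun x => (1 / 2 : ℂ) • (embL n (pd 0 f x) - Complex.I • embL n (pd 1 f x))) w
      = (1 / 4 : ℂ) • (embL n (pd 0 (pd 0 f) w) + embL n (pd 1 (pd 1 f) w)) := by
  have h0 := SmoothOn.pd hU hf 0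
  have h1 := SmoothOn.pd hU hf 1
  rw [dzbar_sub_smul (SmoothOn.differentiableAt hU (smooth_embL h0) hw)
    (SmoothOn.differentiableAt hU (smooth_embL h1) hw),
    dzbar_embL (SmoothOn.differentiableAt hU h0 hw),
    dzbar_embL (SmoothOn.differentiableAt hU h1 hw), pd_comm hU hf hw 1 0]
  match_scalars <;> ring_nf
  rw [Complex.I_sq]; ring

theorem dz_dz_sphereLift (hU : IsOpen U) (hf : ContDiffOn ℝ ∞ f U) (hw : w ∈ U) :
    dz (dz (fun x => sphereLift (f x))) w
      = (1 / 4 : ℂ) • (embL n (pd 0 (pd 0 f) w) - embL n (pd 1 (pd 1 f) w)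
        - (2 * Complex.I) • embL n (pd 0 (pd 1 f) w)) := by
  rw [← dz_half_embL hU hf hw]
  exact dz_congr hU (fun x hx => dz_sphereLift (SmoothOn.differentiableAt hU hf hx)) hw

theorem dzbar_dz_sphereLift (hU : IsOpen U) (hf : ContDiffOn ℝ ∞ f U) (hw : w ∈ U) :
    dzbar (dz (fun x => sphereLift (f x))) w
      = (1 / 4 : ℂ) • (embL n (pd 0 (pd 0 f) w) + embL n (pd 1 (pd 1 f) w)) := by
  rw [← dzbar_half_embL hU hf hw]
  exact dzbar_congr hU (fun x hx => dz_sphereLift (SmoothOn.differentiableAt hU hf hx)) hw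

theorem dz_dz_embL (hU : IsOpen U) (hf : ContDiffOn ℝ ∞ f U) (hw : w ∈ U) :
    dz (dz (fun x => embL n (f x))) w
      = (1 / 4 : ℂ) • (embL n (pd 0 (pd 0 f) w) - embL n (pd 1 (pd 1 f) w)
        - (2 * Complex.I) • embL n (pd 0 (pd 1 f) w)) := by
  rw [← dz_half_embL hU hf hw]
  exact dz_congr hU (fun x hx => dz_embL (SmoothOn.differentiableAt hU hf hx)) hw

/-- The product of the Wirtinger derivatives of the light-cone lift. -/
theorem mink_dz_sphereLift (hf : DifferentiableAt ℝ f w) :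
    mink (dz (fun x => sphereLift (f x)) w) (dz (fun x => sphereLift (f x)) w)
      = ((‖pd 0 f w‖ ^ 2 - ‖pd 1 f w‖ ^ 2 : ℝ) : ℂ) / 4
        - Complex.I * ((inner ℝ (pd 0 f w) (pd 1 f w) : ℝ) : ℂ) / 2 := by
  rw [dz_sphereLift hf]
  simp only [mink_smul_left, mink_smul_right, mink_sub_left, mink_sub_right, mink_embL,
    real_inner_self_eq_norm_sq, real_inner_comm (pd 0 f w) (pd 1 f w)]
  push_cast
  ring_nf
  rw [Complex.I_sq]; ring

theorem mink_dz_dzbar_sphereLift (hf : DifferentiableAt ℝ f w) :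
    mink (dz (fun x => sphereLift (f x)) w) (dzbar (fun x => sphereLift (f x)) w)
      = ((‖pd 0 f w‖ ^ 2 + ‖pd 1 f w‖ ^ 2 : ℝ) : ℂ) / 4 := by
  rw [dz_sphereLift hf, dzbar_sphereLift hf]
  simp only [mink_smul_left, mink_smul_right, mink_sub_left, mink_add_right, mink_embL,
    real_inner_self_eq_norm_sq, real_inner_comm (pd 0 f w) (pd 1 f w)]
  push_cast
  ring_nf
  rw [Complex.I_sq]; ring

theorem isConformal_iff_mink (hf : DifferentiableAt ℝ f w) :
    mink (dz (fun x => sphereLift (f x)) w) (dz (fun x => sphereLift (f x)) w) = 0 ↔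
      ‖pd 0 f w‖ = ‖pd 1 f w‖ ∧ inner ℝ (pd 0 f w) (pd 1 f w) = 0 := by
  rw [mink_dz_sphereLift hf]
  constructor
  · intro h
    have hre := congrArg Complex.re h
    have him := congrArg Complex.im h
    simp [-Complex.ofReal_sub, -Complex.ofReal_pow] at hre him
    refine ⟨?_, him⟩
    rw [sub_eq_zero, sq_eq_sq₀ (norm_nonneg _) (norm_nonneg _)] at hre
    exact hre
  · rintro ⟨h1, h2⟩
    rw [h1, h2]
    simp

/-- The norm of the differential does not vanish for an immersion. -/
theorem IsImmersionOn.normSq_pos (hf : IsImmersionOn U f) (hw : w ∈ U) :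
    0 < ‖pd 0 f w‖ ^ 2 + ‖pd 1 f w‖ ^ 2 := by
  have : pd 0 f w ≠ 0 := by
    intro h0
    have := hf.injective w hw (a₁ := coordVec 0) (a₂ := 0) (by simpa [pd] using h0)
    simp [coordVec] at this
  positivity

/-- The factor of the canonical lift. -/
def liftScale (f : ℂ → EuclideanSpace ℝ (Fin (n + 1))) (w : ℂ) : ℝ :=
  √(2 / (‖pd 0 f w‖ ^ 2 + ‖pd 1 f w‖ ^ 2))

theorem canonicalLift_eq : canonicalLift f = fun w => (liftScale f w : ℂ) • sphereLift (f w) := rfl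

theorem IsImmersionOn.liftScale_pos (hf : IsImmersionOn U f) (hw : w ∈ U) : 0 < liftScale f w :=
  Real.sqrt_pos.2 (div_pos two_pos (hf.normSq_pos hw))

theorem IsImmersionOn.smooth_liftScale (hU : IsOpen U) (hf : IsImmersionOn U f) :
    ContDiffOn ℝ ∞ (liftScale f) U := by
  have h := fun i => (SmoothOn.pd hU hf.smooth i).norm_sq ℝ
  refine ContDiffOn.sqrt (contDiffOn_const.div ((h 0).add (h 1)) (fun w hw => ?_)) (fun w hw => ?_)
  · exact (hf.normSq_pos hw).ne'
  · exact (div_pos two_pos (hf.normSq_pos hw)).ne'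

theorem smooth_ofReal {g : ℂ → ℝ} (hg : ContDiffOn ℝ ∞ g U) :
    ContDiffOn ℝ ∞ (fun x => (g x : ℂ)) U := Complex.ofRealCLM.contDiff.comp_contDiffOn hg

theorem isConformalLift_sphereLift (hU : IsOpen U) (hf : IsImmersionOn U f)
    (hc : IsConformalOn U f) (hn : ∀ w ∈ U, ‖f w‖ = 1) :
    IsConformalLift U (fun x => sphereLift (f x)) where
  isOpen := hU
  smooth := smooth_sphereLift hf.smooth
  real w _ := star_sphereLift _
  null w hw := by rw [mink_sphereLift, real_inner_self_eq_norm_sq, hn w hw]; simp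
  conformal w hw :=
    (isConformal_iff_mink (SmoothOn.differentiableAt hU hf.smooth hw)).2 (hc w hw)

theorem liftScale_sq_mul (hU : IsOpen U) (hf : IsImmersionOn U f) : ∀ w ∈ U,
    (liftScale f w : ℂ) ^ 2 * mink (dz (fun x => sphereLift (f x)) w)
      (dzbar (fun x => sphereLift (f x)) w) = 1 / 2 := by
  intro w hw
  have hpos := hf.normSq_pos hw
  rw [mink_dz_dzbar_sphereLift (SmoothOn.differentiableAt hU hf.smooth hw)]
  have : liftScale f w ^ 2 * ((‖pd 0 f w‖ ^ 2 + ‖pd 1 f w‖ ^ 2) / 4) = 1 / 2 := by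
    rw [liftScale, Real.sq_sqrt (by positivity)]
    field_simp
    norm_num
  have h2 := congrArg (fun x : ℝ => (x : ℂ)) this
  push_cast at h2 ⊢
  linear_combination h2

theorem star_ofReal (x : ℝ) : star (x : ℂ) = x := Complex.conj_ofReal x

theorem isCanonical_canonicalLift (hU : IsOpen U) (hf : IsImmersionOn U f)
    (hc : IsConformalOn U f) (hn : ∀ w ∈ U, ‖f w‖ = 1) : IsCanonical U (canonicalLift f) :=
  (isConformalLift_sphereLift hU hf hc hn).isCanonical_smul
    (smooth_ofReal (hf.smooth_liftScale hU)) (fun _ _ => star_ofReal _) (liftScale_sq_mul hU hf)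

end SphereLift

/-! ### The derivative of the density along a variation -/

section Variation

variable {E : Type*} [NormedAddCommGroup E] [NormedSpace ℝ E] {U : Set ℂ} {G : ℝ × ℂ → E}

/-- The derivative of `G` in the direction `a`. -/
def dirDeriv (a : ℝ × ℂ) (G : ℝ × ℂ → E) (p : ℝ × ℂ) : E := fderiv ℝ G p a

theorem isOpen_univ_prod (hU : IsOpen U) : IsOpen ((Set.univ : Set ℝ) ×ˢ U) := isOpen_univ.prod hU

theorem smooth_dirDeriv {S : Set (ℝ × ℂ)} (hS : IsOpen S) (hG : ContDiffOn ℝ ∞ G S)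
    (a : ℝ × ℂ) : ContDiffOn ℝ ∞ (dirDeriv a G) S :=
  (hG.fderiv_of_isOpen hS (by simp)).clm_apply contDiffOn_const

theorem differentiableAt_of_smooth {S : Set (ℝ × ℂ)} (hS : IsOpen S)
    (hG : ContDiffOn ℝ ∞ G S) {p : ℝ × ℂ} (hp : p ∈ S) : DifferentiableAt ℝ G p :=
  (hG.contDiffAt (hS.mem_nhds hp)).differentiableAt (by simp)

theorem dirDeriv_comm {S : Set (ℝ × ℂ)} (hS : IsOpen S) (hG : ContDiffOn ℝ ∞ G S)
    {p : ℝ × ℂ} (hp : p ∈ S) (a b : ℝ × ℂ) :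
    dirDeriv a (dirDeriv b G) p = dirDeriv b (dirDeriv a G) p := by
  have hsymm : IsSymmSndFDerivAt ℝ G p :=
    (hG.contDiffAt (hS.mem_nhds hp)).isSymmSndFDerivAt
      (by rw [minSmoothness_of_isRCLikeNormedField]; exact ENat.LEInfty.out)
  have hd : DifferentiableAt ℝ (fderiv ℝ G) p :=
    ((hG.fderiv_of_isOpen hS (m := ∞) (by simp)).contDiffAt (hS.mem_nhds hp)).differentiableAt
      (by simp)
  have key : ∀ a b : ℝ × ℂ,
      fderiv ℝ (fun x => fderiv ℝ G x b) p a = fderiv ℝ (fderiv ℝ G) p a b := by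
    intro a b
    rw [fderiv_clm_apply hd (differentiableAt_const b)]
    simp
  change fderiv ℝ (fun x => fderiv ℝ G x b) p a = fderiv ℝ (fun x => fderiv ℝ G x a) p b
  rw [key, key, hsymm.eq]

theorem hasDerivAt_dirDeriv {p : ℝ × ℂ} (hG : DifferentiableAt ℝ G p) :
    HasDerivAt (fun t => G (t, p.2)) (dirDeriv (1, 0) G p) p.1 := by
  have h1 : HasDerivAt (fun t : ℝ => (t, p.2)) ((1 : ℝ), (0 : ℂ)) p.1 :=
    (hasDerivAt_id p.1).prodMk (hasDerivAt_const p.1 p.2)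
  exact hG.hasFDerivAt.comp_hasDerivAt p.1 h1

theorem pd_slice {p : ℝ × ℂ} (hG : DifferentiableAt ℝ G p) (i : Fin 2) :
    pd i (fun x => G (p.1, x)) p.2 = dirDeriv (0, coordVec i) G p := by
  have h1 : HasFDerivAt (fun x : ℂ => (p.1, x)) (ContinuousLinearMap.inr ℝ ℝ ℂ) p.2 :=
    hasFDerivAt_prodMk_right p.1 p.2
  have h2 : HasFDerivAt (fun x : ℂ => G (p.1, x)) _ p.2 := HasFDerivAt.comp p.2 hG.hasFDerivAt h1
  rw [pd, h2.fderiv]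
  rfl

theorem smooth_slice (hG : ContDiffOn ℝ ∞ G (Set.univ ×ˢ U)) (t : ℝ) :
    ContDiffOn ℝ ∞ (fun x => G (t, x)) U :=
  hG.comp (contDiffOn_const.prodMk contDiffOn_id) (fun _ hx => ⟨Set.mem_univ _, hx⟩)

theorem pd_dirDeriv (hU : IsOpen U) (hG : ContDiffOn ℝ ∞ G (Set.univ ×ˢ U)) {t : ℝ} {w : ℂ}
    (hw : w ∈ U) (i : Fin 2) : pd i (fun x => dirDeriv (1, 0) G (t, x)) w
      = dirDeriv (1, 0) (dirDeriv (0, coordVec i) G) (t, w) := by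
  have hS := isOpen_univ_prod hU
  have hp : ((t, w) : ℝ × ℂ) ∈ (Set.univ : Set ℝ) ×ˢ U := ⟨Set.mem_univ _, hw⟩
  rw [dirDeriv_comm hS hG hp]
  exact pd_slice (p := (t, w))
    (differentiableAt_of_smooth hS (smooth_dirDeriv hS hG (1, 0)) hp) i

theorem pd_pd_slice (hU : IsOpen U) (hG : ContDiffOn ℝ ∞ G (Set.univ ×ˢ U)) {t : ℝ} {w : ℂ}
    (hw : w ∈ U) (i j : Fin 2) : pd i (pd j (fun x => G (t, x))) w
      = dirDeriv (0, coordVec i) (dirDeriv (0, coordVec j) G) (t, w) := by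
  have hS := isOpen_univ_prod hU
  have hp : ∀ x ∈ U, ((t, x) : ℝ × ℂ) ∈ (Set.univ : Set ℝ) ×ˢ U := fun x hx => ⟨Set.mem_univ _, hx⟩
  rw [← pd_slice (p := (t, w))
    (differentiableAt_of_smooth hS (smooth_dirDeriv hS hG _) (hp w hw)) i]
  exact pd_congr hU (fun x hx => pd_slice (p := (t, x))
    (differentiableAt_of_smooth hS hG (hp x hx)) j) hw i

theorem pd_pd_dirDeriv (hU : IsOpen U) (hG : ContDiffOn ℝ ∞ G (Set.univ ×ˢ U)) {t : ℝ} {w : ℂ}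
    (hw : w ∈ U) (i j : Fin 2) : pd i (pd j (fun x => dirDeriv (1, 0) G (t, x))) w
      = dirDeriv (1, 0) (dirDeriv (0, coordVec i) (dirDeriv (0, coordVec j) G)) (t, w) := by
  rw [← pd_dirDeriv hU (smooth_dirDeriv (isOpen_univ_prod hU) hG _) hw]
  exact pd_congr hU (fun x hx => pd_dirDeriv hU hG hx j) hw i

/-- Derivatives in $t$ and in the coordinates commute, so this and the next lemma identify the
$t$-derivative of the two-jet of the slices with the two-jet of the variation field. -/
theorem hasDerivAt_pd_slice (hU : IsOpen U) (hG : ContDiffOn ℝ ∞ G (Set.univ ×ˢ U)) {t : ℝ}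
    {w : ℂ} (hw : w ∈ U) (i : Fin 2) : HasDerivAt (fun t => pd i (fun x => G (t, x)) w)
      (pd i (fun x => dirDeriv (1, 0) G (t, x)) w) t := by
  have hS := isOpen_univ_prod hU
  have hp : ∀ t, ((t, w) : ℝ × ℂ) ∈ (Set.univ : Set ℝ) ×ˢ U := fun t => ⟨Set.mem_univ _, hw⟩
  rw [pd_dirDeriv hU hG hw]
  have : (fun t => pd i (fun x => G (t, x)) w) = fun t => dirDeriv (0, coordVec i) G (t, w) :=
    funext fun t => pd_slice (p := (t, w)) (differentiableAt_of_smooth hS hG (hp t)) i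
  rw [this]
  exact hasDerivAt_dirDeriv (p := (t, w))
    (differentiableAt_of_smooth hS (smooth_dirDeriv hS hG _) (hp t))

theorem hasDerivAt_pd_pd_slice (hU : IsOpen U) (hG : ContDiffOn ℝ ∞ G (Set.univ ×ˢ U)) {t : ℝ}
    {w : ℂ} (hw : w ∈ U) (i j : Fin 2) :
    HasDerivAt (fun t => pd i (pd j (fun x => G (t, x))) w)
      (pd i (pd j (fun x => dirDeriv (1, 0) G (t, x))) w) t := by
  have hS := isOpen_univ_prod hU
  have hp : ∀ t, ((t, w) : ℝ × ℂ) ∈ (Set.univ : Set ℝ) ×ˢ U := fun t => ⟨Set.mem_univ _, hw⟩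
  rw [pd_pd_dirDeriv hU hG hw]
  have : (fun t => pd i (pd j (fun x => G (t, x))) w)
      = fun t => dirDeriv (0, coordVec i) (dirDeriv (0, coordVec j) G) (t, w) :=
    funext fun t => pd_pd_slice hU hG hw i j
  rw [this]
  exact hasDerivAt_dirDeriv (p := (t, w))
    (differentiableAt_of_smooth hS (smooth_dirDeriv hS (smooth_dirDeriv hS hG _) _) (hp t))

end Variation

/-! ### The first variation of the density in complex form -/

section Density

variable {n : ℕ} {U : Set ℂ} {f V : ℂ → EuclideanSpace ℝ (Fin (n + 1))} {w : ℂ}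

theorem pd_inner {f g : ℂ → EuclideanSpace ℝ (Fin (n + 1))} (hf : DifferentiableAt ℝ f w)
    (hg : DifferentiableAt ℝ g w) (i : Fin 2) :
    pd i (fun x => (inner ℝ (f x) (g x) : ℝ)) w
      = inner ℝ (pd i f w) (g w) + inner ℝ (f w) (pd i g w) :=
  pd_bilin (innerSL ℝ) hf hg i

/-- The tangential components of the second derivatives of a conformal immersion. -/
theorem IsConformalOn.second_derivatives (hU : IsOpen U) (hf : ContDiffOn ℝ ∞ f U)
    (hc : IsConformalOn U f) (hw : w ∈ U) :
    inner ℝ (pd 1 (pd 1 f) w) (pd 0 f w) = -(inner ℝ (pd 0 (pd 0 f) w) (pd 0 f w) : ℝ) ∧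
    inner ℝ (pd 0 (pd 0 f) w) (pd 1 f w) = -(inner ℝ (pd 0 (pd 1 f) w) (pd 0 f w) : ℝ) ∧
    inner ℝ (pd 0 (pd 1 f) w) (pd 1 f w) = (inner ℝ (pd 0 (pd 0 f) w) (pd 0 f w) : ℝ) ∧
    inner ℝ (pd 1 (pd 1 f) w) (pd 1 f w) = (inner ℝ (pd 0 (pd 1 f) w) (pd 0 f w) : ℝ) := by
  have d := fun i => SmoothOn.differentiableAt hU (SmoothOn.pd hU hf i) hw
  have e1 : Set.EqOn (fun x => (inner ℝ (pd 0 f x) (pd 0 f x) : ℝ))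
      (fun x => inner ℝ (pd 1 f x) (pd 1 f x)) U := by
    intro x hx
    simp only [real_inner_self_eq_norm_sq, (hc x hx).1]
  have e2 : Set.EqOn (fun x => (inner ℝ (pd 0 f x) (pd 1 f x) : ℝ)) (fun _ => 0) U :=
    fun x hx => (hc x hx).2
  have s := pd_comm hU hf hw 1 0
  have a0 := pd_congr hU e1 hw 0
  have a1 := pd_congr hU e1 hw 1
  have b0 := pd_congr hU e2 hw 0
  have b1 := pd_congr hU e2 hw 1
  rw [pd_inner (d 0) (d 0), pd_inner (d 1) (d 1)] at a0 a1
  rw [pd_inner (d 0) (d 1), pd_const] at b0 b1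
  rw [s] at a1 b1
  rw [real_inner_comm (pd 0 (pd 0 f) w) (pd 0 f w),
    real_inner_comm (pd 0 (pd 1 f) w) (pd 1 f w)] at a0
  rw [real_inner_comm (pd 0 (pd 1 f) w) (pd 0 f w),
    real_inner_comm (pd 1 (pd 1 f) w) (pd 1 f w)] at a1
  rw [real_inner_comm (pd 0 (pd 1 f) w) (pd 0 f w)] at b0
  rw [real_inner_comm (pd 1 (pd 1 f) w) (pd 0 f w)] at b1
  refine ⟨?_, ?_, ?_, ?_⟩ <;> linarith

-- Matches the right side with the derivative in `hasDerivAt_jetDensity`. For $X=(1,f)$ one has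
-- $\langle X_z,X_{\bar z}\rangle=\frac e2$, $\langle X_{zz},X_{\bar z}\rangle=\frac{a-ib}2$ and
-- $X_{zz}=\frac14(r-v-2is)$ in the space-like coordinates; the rest is separation of real parts.
set_option maxHeartbeats 2000000 in
theorem conformalVariation_sphereLift (hU : IsOpen U) (hf : ContDiffOn ℝ ∞ f U)
    (hV : ContDiffOn ℝ ∞ V U) (hw : w ∈ U) {p q r s v p' q' r' s' v' :
      EuclideanSpace ℝ (Fin (n + 1))} {a b e : ℝ} (he : 0 < e)
    (hp : pd 0 f w = p) (hq : pd 1 f w = q) (hr : pd 0 (pd 0 f) w = r)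
    (hs : pd 0 (pd 1 f) w = s) (hv : pd 1 (pd 1 f) w = v)
    (hp' : pd 0 V w = p') (hq' : pd 1 V w = q') (hr' : pd 0 (pd 0 V) w = r')
    (hs' : pd 0 (pd 1 V) w = s') (hv' : pd 1 (pd 1 V) w = v')
    (hpp : inner ℝ p p = e) (hqq : inner ℝ q q = e)
    (hrp : inner ℝ r p = a) (hsp : inner ℝ s p = b) (hvp : inner ℝ v p = -a)
    (hrq : inner ℝ r q = -b) (hsq : inner ℝ s q = a) (hvq : inner ℝ v q = b) :
    2 * (conformalVariation (fun x => sphereLift (f x)) (fun x => embL n (V x)) w).re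
      = -((inner ℝ p' p + inner ℝ q' q) / (16 * e ^ 2)) *
          (inner ℝ r r - 2 * inner ℝ r v + inner ℝ v v
            + 4 * inner ℝ s s - 16 * (a ^ 2 + b ^ 2) / e)
        + (inner ℝ r' r - inner ℝ r' v - inner ℝ v' r + inner ℝ v' v
            + 4 * inner ℝ s' s) / (8 * e)
        - (a * (inner ℝ r' p + inner ℝ r p' - inner ℝ v' p - inner ℝ v p')
            - b * (inner ℝ r' q + inner ℝ r q' - inner ℝ v' q - inner ℝ v q')
            + 2 * b * (inner ℝ s' p + inner ℝ s p')
            + 2 * a * (inner ℝ s' q + inner ℝ s q')) / (4 * e ^ 2)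
        - (inner ℝ p' p - inner ℝ q' q) / (8 * e ^ 2) * (inner ℝ r r - inner ℝ v v)
        - (inner ℝ p' q + inner ℝ q' p) / (4 * e ^ 2) * (inner ℝ r s + inner ℝ s v) := by
  have he' := he.ne'
  have hec : (e : ℂ) ≠ 0 := by exact_mod_cast he'
  have df := SmoothOn.differentiableAt hU hf hw
  have dV := SmoothOn.differentiableAt hU hV hw
  have hB : mink (dz (fun x => sphereLift (f x)) w) (dzbar (fun x => sphereLift (f x)) w)
      = ((e / 2 : ℝ) : ℂ) := by
    rw [mink_dz_dzbar_sphereLift df, hp, hq, ← real_inner_self_eq_norm_sq,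
      ← real_inner_self_eq_norm_sq, hpp, hqq]
    push_cast; ring
  have hβ : mink (dz (dz (fun x => sphereLift (f x))) w) (dzbar (fun x => sphereLift (f x)) w)
      = ((a / 2 : ℝ) : ℂ) - ((b / 2 : ℝ) : ℂ) * Complex.I := by
    rw [dz_dz_sphereLift hU hf hw, dzbar_sphereLift df, hp, hq, hr, hs, hv]
    simp only [mink_smul_left, mink_smul_right, mink_sub_left, mink_add_right, mink_embL, hrp, hrq,
      hsp, hsq, hvp, hvq]
    apply Complex.ext <;> simp <;> ring
  have hβ' : star (((a / 2 : ℝ) : ℂ) - ((b / 2 : ℝ) : ℂ) * Complex.I)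
      = ((a / 2 : ℝ) : ℂ) + ((b / 2 : ℝ) : ℂ) * Complex.I := by
    simp
  have hXbb : star (dz (dz (fun x => sphereLift (f x))) w) = (1 / 4 : ℂ) • (embL n r - embL n v
        + (2 * Complex.I) • embL n s) := by
    rw [dz_dz_sphereLift hU hf hw, hr, hs, hv]
    simp only [star_smul, star_sub, star_embL, star_div₀, star_one, star_ofNat, star_mul']
    simp
  rw [conformalVariation, hB, hβ, hβ', hXbb]
  rw [dz_dz_sphereLift hU hf hw, dz_dz_embL hU hV hw, dzbar_dz_sphereLift hU hf hw,
    dz_sphereLift df, dzbar_sphereLift df, dz_embL dV, hp, hq, hr, hs, hv, hp', hq', hr', hs', hv']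
  simp only [mink_smul_left, mink_smul_right, mink_sub_left, mink_add_right, mink_sub_right,
    mink_add_left, mink_embL, real_inner_comm r p', real_inner_comm s p', real_inner_comm v p',
    real_inner_comm r q', real_inner_comm s q', real_inner_comm v q', real_inner_comm s v,
    real_inner_comm r s, real_inner_comm r v, real_inner_comm p p', real_inner_comm q p',
    real_inner_comm p q', real_inner_comm q q']
  -- All denominators are turned into casts of real numbers, so that taking real parts meets only
  -- products.
  have i1 : (1 : ℂ) / (2 * ((e / 2 : ℝ) : ℂ)) = ((1 / e : ℝ) : ℂ) := by
    push_cast; field_simp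
  have i2 : (1 : ℂ) / (2 * ((e / 2 : ℝ) : ℂ) ^ 2) = ((2 / e ^ 2 : ℝ) : ℂ) := by
    push_cast; field_simp
  have i3 : (1 : ℂ) / (((e / 2 : ℝ) : ℂ) ^ 2) = ((4 / e ^ 2 : ℝ) : ℂ) := by
    push_cast; field_simp; norm_num
  have i4 : ∀ x : ℂ, x / ((e / 2 : ℝ) : ℂ) = x * ((2 / e : ℝ) : ℂ) := by
    intro x; push_cast; field_simp
  have i5 : ∀ x : ℂ, x / ((e / 2 : ℝ) : ℂ) ^ 2 = x * ((4 / e ^ 2 : ℝ) : ℂ) := by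
    intro x; push_cast; field_simp; norm_num
  have i6 : (1 / 4 : ℂ) = ((1 / 4 : ℝ) : ℂ) := by push_cast; rfl
  have i7 : (1 / 2 : ℂ) = ((1 / 2 : ℝ) : ℂ) := by push_cast; rfl
  have i8 : (2 : ℂ) = ((2 : ℝ) : ℂ) := rfl
  rw [i1, i2, i3, i4, i4, i5, i6, i7]
  simp only [i8]
  simp only [Complex.add_re, Complex.sub_re, Complex.mul_re, Complex.add_im, Complex.sub_im,
    Complex.mul_im, Complex.ofReal_re, Complex.ofReal_im, Complex.I_re, Complex.I_im]
  field_simp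
  ring

end Density

/-! ### The density of a variation -/

section JetSmooth

variable {V : Type*} [NormedAddCommGroup V] [InnerProductSpace ℝ V] {X : Type*}
  [NormedAddCommGroup X] [NormedSpace ℝ X] {S : Set X} {p q r s v x y : X → V}

theorem smooth_gramDet (hp : ContDiffOn ℝ ∞ p S) (hq : ContDiffOn ℝ ∞ q S) :
    ContDiffOn ℝ ∞ (fun a => gramDet (p a) (q a)) S :=
  ((hp.inner ℝ hp).mul (hq.inner ℝ hq)).sub ((hp.inner ℝ hq).pow 2)

theorem smooth_projInner (hp : ContDiffOn ℝ ∞ p S) (hq : ContDiffOn ℝ ∞ q S)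
    (hx : ContDiffOn ℝ ∞ x S) (hy : ContDiffOn ℝ ∞ y S)
    (hne : ∀ a ∈ S, gramDet (p a) (q a) ≠ 0) :
    ContDiffOn ℝ ∞ (fun a => projInner (p a) (q a) (x a) (y a)) S :=
  (hx.inner ℝ hy).sub (((((hq.inner ℝ hq).mul ((hx.inner ℝ hp).mul (hy.inner ℝ hp))).sub
    ((hp.inner ℝ hq).mul (((hx.inner ℝ hp).mul (hy.inner ℝ hq)).add
      ((hx.inner ℝ hq).mul (hy.inner ℝ hp))))).add
    ((hp.inner ℝ hp).mul ((hx.inner ℝ hq).mul (hy.inner ℝ hq)))).div (smooth_gramDet hp hq) hne)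

theorem smooth_jetDensity (hp : ContDiffOn ℝ ∞ p S) (hq : ContDiffOn ℝ ∞ q S)
    (hr : ContDiffOn ℝ ∞ r S) (hs : ContDiffOn ℝ ∞ s S) (hv : ContDiffOn ℝ ∞ v S)
    (hne : ∀ a ∈ S, gramDet (p a) (q a) ≠ 0) :
    ContDiffOn ℝ ∞ (fun a => jetDensity (p a) (q a) (r a) (s a) (v a)) S := by
  have P := fun {x y : X → V} (hx : ContDiffOn ℝ ∞ x S) (hy : ContDiffOn ℝ ∞ y S) =>
    smooth_projInner hp hq hx hy hne
  have hd := smooth_gramDet hp hq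
  have hE := hp.inner ℝ hp
  have hF := hp.inner ℝ hq
  have hG := hq.inner ℝ hq
  have c := fun k : ℝ => contDiffOn_const (𝕜 := ℝ) (n := ∞) (s := S) (c := k)
  have hN := ((((((hG.pow 2).mul (P hr hr)).add
    (((c 4).mul (hF.pow 2)).mul (P hs hs))).add
    ((hE.pow 2).mul (P hv hv))).sub
    ((((c 4).mul hF).mul hG).mul (P hr hs))).add
    ((((c 2).mul hE).mul hG).mul (P hr hv))).sub
    ((((c 4).mul hE).mul hF).mul (P hs hv))
  exact ((hd.sqrt hne).div_const 8).mul
    ((hN.div ((c 2).mul (hd.pow 2)) (fun a ha => mul_ne_zero two_ne_zero (pow_ne_zero 2 (hne a ha)))).sub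
      (((c 2).mul ((P hr hv).sub (P hs hs))).div hd hne))

end JetSmooth

/-! ### Immersed slices of a variation -/

section Regular

variable {n : ℕ} {U : Set ℂ} {G : ℝ × ℂ → EuclideanSpace ℝ (Fin (n + 1))}

/-- The points of `ℝ × U` where the slice of `G` is an immersion. -/
def regularSet (U : Set ℂ) (G : ℝ × ℂ → EuclideanSpace ℝ (Fin (n + 1))) : Set (ℝ × ℂ) :=
  (Set.univ ×ˢ U) ∩ {p | gramDet (dirDeriv (0, coordVec 0) G p) (dirDeriv (0, coordVec 1) G p) ≠ 0}

theorem isOpen_regularSet (hU : IsOpen U) (hG : ContDiffOn ℝ ∞ G (Set.univ ×ˢ U)) :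
    IsOpen (regularSet U G) := by
  have hS := isOpen_univ_prod hU
  exact (smooth_gramDet (smooth_dirDeriv hS hG _) (smooth_dirDeriv hS hG _)).continuousOn.isOpen_inter_preimage
    hS isOpen_compl_singleton

theorem mobiusDensity_slice (hU : IsOpen U) (hG : ContDiffOn ℝ ∞ G (Set.univ ×ˢ U)) {p : ℝ × ℂ}
    (hp : p ∈ regularSet U G) : mobiusDensity (fun x => G (p.1, x)) p.2
      = jetDensity (dirDeriv (0, coordVec 0) G p) (dirDeriv (0, coordVec 1) G p)
        (dirDeriv (0, coordVec 0) (dirDeriv (0, coordVec 0) G) p)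
        (dirDeriv (0, coordVec 0) (dirDeriv (0, coordVec 1) G) p)
        (dirDeriv (0, coordVec 1) (dirDeriv (0, coordVec 1) G) p) := by
  have hd := differentiableAt_of_smooth (isOpen_univ_prod hU) hG hp.1
  have hw : p.2 ∈ U := hp.1.2
  have hs := smooth_slice hG p.1
  rw [mobiusDensity_eq _ _ (by rw [pd_slice hd, pd_slice hd]; exact hp.2) (pd_comm hU hs hw 1 0),
    pd_slice hd, pd_slice hd, pd_pd_slice hU hG hw, pd_pd_slice hU hG hw, pd_pd_slice hU hG hw]

theorem smooth_mobiusDensity (hU : IsOpen U) (hG : ContDiffOn ℝ ∞ G (Set.univ ×ˢ U)) :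
    ContDiffOn ℝ ∞ (fun p : ℝ × ℂ => mobiusDensity (fun x => G (p.1, x)) p.2)
      (regularSet U G) := by
  have hS := isOpen_univ_prod hU
  have hsub : regularSet U G ⊆ Set.univ ×ˢ U := Set.inter_subset_left
  have d := fun a => smooth_dirDeriv hS hG a
  have dd := fun a b => (smooth_dirDeriv hS (d a) b).mono hsub
  exact (smooth_jetDensity ((d _).mono hsub) ((d _).mono hsub) (dd _ _) (dd _ _) (dd _ _)
    (fun p hp => hp.2)).congr (fun p hp => mobiusDensity_slice hU hG hp)

variable {f : ℂ → EuclideanSpace ℝ (Fin (n + 1))}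

theorem IsConformalOn.normSq_pos (hc : IsConformalOn U f) (hf : IsImmersionOn U f) {w : ℂ}
    (hw : w ∈ U) : 0 < (inner ℝ (pd 0 f w) (pd 0 f w) : ℝ) := by
  have := hf.normSq_pos hw
  rw [← (hc w hw).1] at this
  rw [real_inner_self_eq_norm_sq]
  linarith

theorem mem_regularSet (hU : IsOpen U) (hG : ContDiffOn ℝ ∞ G (Set.univ ×ˢ U))
    (h0 : ∀ w ∈ U, G (0, w) = f w) (hf : IsImmersionOn U f) (hc : IsConformalOn U f) {w : ℂ}
    (hw : w ∈ U) : ((0, w) : ℝ × ℂ) ∈ regularSet U G := by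
  have hp : ((0, w) : ℝ × ℂ) ∈ (Set.univ : Set ℝ) ×ˢ U := ⟨Set.mem_univ _, hw⟩
  have hd := differentiableAt_of_smooth (isOpen_univ_prod hU) hG hp
  refine ⟨hp, ?_⟩
  have e := fun i => (pd_slice hd i).symm.trans (pd_congr hU h0 hw i)
  have hqq : inner ℝ (pd 1 f w) (pd 1 f w) = (inner ℝ (pd 0 f w) (pd 0 f w) : ℝ) := by
    rw [real_inner_self_eq_norm_sq, real_inner_self_eq_norm_sq, (hc w hw).1]
  rw [Set.mem_ofPred_eq, e, e, gramDet_of_conformal rfl hqq (hc w hw).2]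
  exact pow_ne_zero 2 (hc.normSq_pos hf hw).ne'

/-- The jet formula applies for $t$ near $0$, where the slice is still immersed at $w$; at $t=0$ its
jet is that of the conformal map $f$. -/
theorem hasDerivAt_mobiusDensity (hU : IsOpen U) (hG : ContDiffOn ℝ ∞ G (Set.univ ×ˢ U))
    (h0 : ∀ w ∈ U, G (0, w) = f w) (hf : IsImmersionOn U f) (hc : IsConformalOn U f) {w : ℂ}
    (hw : w ∈ U) : HasDerivAt (fun t => mobiusDensity (fun x => G (t, x)) w)
      (2 * (conformalVariation (fun x => sphereLift (f x))
        (fun x => embL n (dirDeriv (1, 0) G (0, x))) w).re) 0 := by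
  have hS := isOpen_univ_prod hU
  have hV : ContDiffOn ℝ ∞ (fun x => dirDeriv (1, 0) G (0, x)) U :=
    smooth_slice (smooth_dirDeriv hS hG _) 0
  have e1 : ∀ i, pd i (fun x => G (0, x)) w = pd i f w := fun i => pd_congr hU h0 hw i
  have e2 : ∀ i j, pd i (pd j (fun x => G (0, x))) w = pd i (pd j f) w := fun i j =>
    pd_congr hU (fun x hx => pd_congr hU h0 hx j) hw i
  have hqq : inner ℝ (pd 1 f w) (pd 1 f w) = (inner ℝ (pd 0 f w) (pd 0 f w) : ℝ) := by
    rw [real_inner_self_eq_norm_sq, real_inner_self_eq_norm_sq, (hc w hw).1]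
  obtain ⟨c1, c2, c3, c4⟩ := hc.second_derivatives hU hf.smooth hw
  have hpos := hc.normSq_pos hf hw
  have key := hasDerivAt_jetDensity (e := inner ℝ (pd 0 f w) (pd 0 f w)) hpos
    (hasDerivAt_pd_slice hU hG hw 0) (hasDerivAt_pd_slice hU hG hw 1)
    (hasDerivAt_pd_pd_slice hU hG hw 0 0) (hasDerivAt_pd_pd_slice hU hG hw 0 1)
    (hasDerivAt_pd_pd_slice hU hG hw 1 1) (by rw [e1]) (by rw [e1]; exact hqq)
    (by rw [e1, e1]; exact (hc w hw).2) (by rw [e1, e2]) (by rw [e1, e2])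
    (by rw [e1, e2]; exact c1) (by rw [e1, e2]; exact c2) (by rw [e1, e2]; exact c3)
    (by rw [e1, e2]; exact c4)
  have hev : ∀ᶠ t : ℝ in nhds 0, ((t, w) : ℝ × ℂ) ∈ regularSet U G :=
    (Continuous.prodMk_left w).continuousAt.eventually_mem
      ((isOpen_regularSet hU hG).mem_nhds (mem_regularSet hU hG h0 hf hc hw))
  refine (key.congr_of_eventuallyEq ?_).congr_deriv ?_
  · filter_upwards [hev] with t ht
    have hd := differentiableAt_of_smooth hS hG ht.1
    exact mobiusDensity_eq _ _
      (by rw [pd_slice (p := (t, w)) hd, pd_slice (p := (t, w)) hd]; exact ht.2)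
      (pd_comm hU (smooth_slice hG t) hw 1 0)
  · rw [conformalVariation_sphereLift hU hf.smooth hV hw hpos rfl rfl rfl rfl rfl rfl rfl rfl rfl rfl
      rfl hqq rfl rfl c1 c2 c3 c4]
    simp only [e1, e2]

end Regular

/-! ### Differentiation under the integral sign and the divergence theorem -/

section Integration

open MeasureTheory Topology

/-- The integrand is smooth only on an open neighbourhood of $\{0\}\times K$. The tube lemma gives a
common time interval over $K$, and compactness bounds the $t$-derivative there. -/
theorem hasDerivAt_integral_of_compact {D : ℝ × ℂ → ℝ} {Ω : Set (ℝ × ℂ)} {K : Set ℂ}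
    (hΩ : IsOpen Ω) (hD : ContDiffOn ℝ ∞ D Ω) (hK : IsCompact K)
    (hKΩ : ∀ w ∈ K, ((0, w) : ℝ × ℂ) ∈ Ω) :
    HasDerivAt (fun t => ∫ w in K, D (t, w)) (∫ w in K, dirDeriv (1, 0) D (0, w)) 0 := by
  obtain ⟨u, v, hu, -, h0u, hKv, huv⟩ := generalized_tube_lemma (isCompact_singleton (x := (0 : ℝ)))
    hK hΩ (by rintro ⟨t, w⟩ ⟨ht, hw⟩; obtain rfl : t = 0 := ht; exact hKΩ w hw)
  obtain ⟨ε, hε, hεu⟩ := Metric.nhds_basis_closedBall.mem_iff.1 (hu.mem_nhds (h0u rfl))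
  have hB : Metric.closedBall (0 : ℝ) ε ×ˢ K ⊆ Ω := (Set.prod_mono hεu hKv).trans huv
  have hD' := smooth_dirDeriv hΩ hD (1, 0)
  obtain ⟨C, hC⟩ := ((isCompact_closedBall (0 : ℝ) ε).prod hK).exists_bound_of_continuousOn
    (hD'.continuousOn.mono hB)
  have hslice : ∀ {H : ℝ × ℂ → ℝ}, ContDiffOn ℝ ∞ H Ω → ∀ t ∈ Metric.closedBall (0 : ℝ) ε,
      ContinuousOn (fun w => H (t, w)) K := fun hH t ht =>
    hH.continuousOn.comp (Continuous.prodMk_right t).continuousOn (fun w hw => hB ⟨ht, hw⟩)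
  have hball : Metric.closedBall (0 : ℝ) ε ∈ 𝓝 0 := Metric.closedBall_mem_nhds 0 hε
  have hm : (0 : ℝ) ∈ Metric.closedBall (0 : ℝ) ε := Metric.mem_closedBall_self hε.le
  refine (hasDerivAt_integral_of_dominated_loc_of_deriv_le (μ := volume.restrict K)
    (F := fun t w => D (t, w)) (F' := fun t w => dirDeriv (1, 0) D (t, w)) (bound := fun _ => C)
    hball ?_ ((hslice hD 0 hm).integrableOn_compact hK) ?_ ?_ ?_ ?_).2
  · filter_upwards [hball] with t ht
    exact (hslice hD t ht).aestronglyMeasurable hK.measurableSet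
  · exact (hslice hD' 0 hm).aestronglyMeasurable hK.measurableSet
  · filter_upwards [ae_restrict_mem hK.measurableSet] with w hw t ht
    exact hC (t, w) ⟨ht, hw⟩
  · exact integrableOn_const hK.measure_lt_top.ne
  · filter_upwards [ae_restrict_mem hK.measurableSet] with w hw t ht
    exact hasDerivAt_dirDeriv (p := (t, w)) (differentiableAt_of_smooth hΩ hD (hB ⟨ht, hw⟩))

theorem integral_pd_eq_zero {E : Type*} [NormedAddCommGroup E] [NormedSpace ℝ E] {U K : Set ℂ}
    {g : ℂ → E} (hU : IsOpen U) (hg : ContDiffOn ℝ ∞ g U) (hK : IsCompact K) (hKU : K ⊆ U)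
    (h0 : ∀ w ∈ U \ K, g w = 0) (i : Fin 2) : ∫ w in K, pd i g w = 0 := by
  have heq : Set.EqOn (K.indicator g) g U := by
    intro w hw
    by_cases hwK : w ∈ K
    · simp [hwK]
    · simp [hwK, h0 w ⟨hw, hwK⟩]
  have hout : Set.EqOn (K.indicator g) (fun _ => 0) Kᶜ := fun w hw => Set.indicator_of_notMem hw g
  -- Extension by zero is smooth: it is $g$ on $U$ and zero on the complement of $K$, two open sets
  -- that cover the plane.
  have hsm : ContDiff ℝ ∞ (K.indicator g) := by
    rw [contDiff_iff_contDiffAt]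
    intro w
    by_cases hw : w ∈ U
    · exact (hg.contDiffAt (hU.mem_nhds hw)).congr_of_eventuallyEq
        (heq.eventuallyEq_of_mem (hU.mem_nhds hw))
    · exact contDiffAt_const.congr_of_eventuallyEq
        (hout.eventuallyEq_of_mem (hK.isClosed.isOpen_compl.mem_nhds fun h => hw (hKU h)))
  have hpd : ∀ w, w ∉ K → pd i (K.indicator g) w = 0 := fun w hw => by
    rw [pd_congr hK.isClosed.isOpen_compl hout hw, pd_const]
  have hcs : HasCompactSupport (K.indicator g) := HasCompactSupport.intro hK fun w hw => hout hw
  have hpc : Continuous (pd i (K.indicator g)) :=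
    (contDiffOn_univ.1 (SmoothOn.pd isOpen_univ hsm.contDiffOn i)).continuous
  rw [setIntegral_congr_fun hK.measurableSet
      (fun w hw => (pd_congr hU heq (hKU hw) i).symm),
    setIntegral_eq_integral_of_forall_compl_eq_zero hpd]
  -- Integration by parts against the constant function $1$.
  have := integral_bilinear_hasLineDerivAt_right_eq_neg_left_of_integrable (μ := volume)
    (f := fun _ : ℂ => (1 : ℝ)) (f' := fun _ => 0) (g := K.indicator g)
    (g' := pd i (K.indicator g)) (v := coordVec i) (B := ContinuousLinearMap.lsmul ℝ ℝ)
    (by simp) (by simpa using hpc.integrable_of_hasCompactSupport (HasCompactSupport.intro hK hpd))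
    (by simpa using hsm.continuous.integrable_of_hasCompactSupport hcs)
    (fun x _ => (hasFDerivAt_const (1 : ℝ) x).hasLineDerivAt _)
    (fun x _ => ((hsm.differentiable (by simp)) x).hasFDerivAt.hasLineDerivAt _)
  simpa using this

theorem integral_dz_eq_zero {U K : Set ℂ} {g : ℂ → ℂ} (hU : IsOpen U) (hg : ContDiffOn ℝ ∞ g U)
    (hK : IsCompact K) (hKU : K ⊆ U) (h0 : ∀ w ∈ U \ K, g w = 0) : ∫ w in K, dz g w = 0 := by
  have hi : ∀ i, IntegrableOn (pd i g) K := fun i =>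
    ((SmoothOn.pd hU hg i).continuousOn.mono hKU).integrableOn_compact hK
  have hI : IntegrableOn (fun w => Complex.I • pd 1 g w) K := (hi 1).smul Complex.I
  simp only [dz]
  rw [integral_smul, integral_sub (hi 0) hI, integral_smul,
    integral_pd_eq_zero hU hg hK hKU h0, integral_pd_eq_zero hU hg hK hKU h0]
  simp

end Integration

/-! ### The first variation of the Willmore functional -/

section FirstVariation

theorem IsCanonical.smooth_willmoreTensor {n : ℕ} {U : Set ℂ} {Y : ℂ → CMink n}
    (h : IsCanonical U Y) : ContDiffOn ℝ ∞ (willmoreTensor Y) U :=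
  (h.smooth_normalDzbar (h.smooth_normalDzbar h.smooth_hopf)).add
    (SmoothOn.smul ((SmoothOn.star h.smooth_schwarzian).div_const 2) h.smooth_hopf)

open MeasureTheory

variable {n : ℕ} {U K : Set ℂ} {f : ℂ → EuclideanSpace ℝ (Fin (n + 1))}
  {F : ℝ → ℂ → EuclideanSpace ℝ (Fin (n + 1))} {w : ℂ}

/-- The variation field of `F` at `t = 0`. -/
def variationField (F : ℝ → ℂ → EuclideanSpace ℝ (Fin (n + 1))) (w : ℂ) :
    EuclideanSpace ℝ (Fin (n + 1)) :=
  dirDeriv (1, 0) (fun p : ℝ × ℂ => F p.1 p.2) (0, w)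

/-- The variation field in terms of the canonical lift of `f`. -/
def liftedField (f : ℂ → EuclideanSpace ℝ (Fin (n + 1))) (V : ℂ → EuclideanSpace ℝ (Fin (n + 1)))
    (w : ℂ) : CMink n := (liftScale f w : ℂ) • embL n (V w)

namespace IsVariation

variable (hF : IsVariation U K f F)
include hF

theorem hasDerivAt (hU : IsOpen U) (hw : w ∈ U) :
    HasDerivAt (fun t => F t w) (variationField F w) 0 :=
  hasDerivAt_dirDeriv (p := ((0 : ℝ), w))
    (differentiableAt_of_smooth (isOpen_univ_prod hU) hF.smooth ⟨Set.mem_univ _, hw⟩)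

theorem smooth_variationField (hU : IsOpen U) : ContDiffOn ℝ ∞ (variationField F) U :=
  smooth_slice (smooth_dirDeriv (isOpen_univ_prod hU) hF.smooth _) 0

theorem inner_variationField (hU : IsOpen U) (hw : w ∈ U) :
    inner ℝ (variationField F w) (f w) = (0 : ℝ) := by
  have hd := hF.hasDerivAt hU hw
  have h1 := hd.inner ℝ hd
  have h2 : (fun t => (inner ℝ (F t w) (F t w) : ℝ)) = fun _ => 1 := by
    funext t
    rw [real_inner_self_eq_norm_sq, hF.mem_sphere t w hw]; norm_num
  rw [h2] at h1
  have := h1.unique (hasDerivAt_const 0 (1 : ℝ))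
  rw [hF.initial w hw, real_inner_comm (variationField F w) (f w)] at this
  linarith

theorem variationField_eq_zero (hU : IsOpen U) (hw : w ∈ U \ K) : variationField F w = 0 := by
  have hd := hF.hasDerivAt hU hw.1
  have h2 : (fun t => F t w) = fun _ => f w := funext fun t => hF.support t w hw
  rw [h2] at hd
  exact hd.unique (hasDerivAt_const 0 (f w))

/-- The first variation formula for the Willmore functional. -/
theorem hasDerivAt_willmoreFunctional (hU : IsOpen U) (hf : IsImmersionOn U f)
    (hc : IsConformalOn U f) (hn : ∀ w ∈ U, ‖f w‖ = 1) (hK : IsCompact K) (hKU : K ⊆ U) :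
    HasDerivAt (fun t => willmoreFunctional K (F t))
      (∫ w in K, (2 * mink (liftedField f (variationField F) w)
        (willmoreTensor (canonicalLift f) w)).re) 0 := by
  have hG := hF.smooth
  have hV := hF.smooth_variationField hU
  have hψ : ContDiffOn ℝ ∞ (liftedField f (variationField F)) U :=
    SmoothOn.smul (smooth_ofReal (hf.smooth_liftScale hU)) (smooth_embL hV)
  have hcan := isCanonical_canonicalLift hU hf hc hn
  have hconf := isConformalLift_sphereLift hU hf hc hn
  have horth' : ∀ x ∈ U, mink (embL n (variationField F x)) (sphereLift (f x)) = 0 := fun x hx => by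
    rw [mink_embL_sphereLift, hF.inner_variationField hU hx, Complex.ofReal_zero]
  have hreal : ∀ x ∈ U, star (liftedField f (variationField F) x)
      = liftedField f (variationField F) x := fun x _ => by
    rw [liftedField, star_smul, star_ofReal, star_embL]
  have horth : ∀ x ∈ U, mink (liftedField f (variationField F) x) (canonicalLift f x) = 0 :=
    fun x hx => by
      rw [liftedField, canonicalLift_eq, mink_smul_left, mink_smul_right, horth' x hx]; simp
  have hflux := hcan.smooth_variationFlux hψ
  have hflux0 : ∀ w ∈ U \ K, variationFlux (canonicalLift f) (liftedField f (variationField F)) w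
      = 0 := by
    -- Vanishing on the open set $U\setminus K$ also kills the derivative of the field there, so the
    -- flux contributes no boundary term.
    have h0 : Set.EqOn (liftedField f (variationField F)) (fun _ => 0) (U \ K) := fun x hx => by
      rw [liftedField, hF.variationField_eq_zero hU hx, map_zero, smul_zero]
    intro w hw
    rw [variationFlux, dz_congr (hU.sdiff hK.isClosed) h0 hw, dz_const, h0 hw, mink_zero_left,
      mink_zero_left, sub_zero]
  have hmain := hasDerivAt_integral_of_compact (isOpen_regularSet hU hG)
    (smooth_mobiusDensity hU hG) hK (fun w hw => mem_regularSet hU hG hF.initial hf hc (hKU hw))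
  refine hmain.congr_deriv ?_
  -- The density, conformal and canonical-lift forms of the first variation are chained here; only
  -- the divergence and the pairing with $W$ remain.
  have hpt : ∀ w ∈ K, dirDeriv (1, 0)
      (fun p : ℝ × ℂ => mobiusDensity (fun x => F p.1 x) p.2) (0, w)
      = 2 * (dz (variationFlux (canonicalLift f) (liftedField f (variationField F))) w).re
        + (2 * mink (liftedField f (variationField F) w) (willmoreTensor (canonicalLift f) w)).re := by
    intro w hw
    have h1 := hasDerivAt_dirDeriv (p := ((0 : ℝ), w)) (differentiableAt_of_smooth
      (isOpen_regularSet hU hG) (smooth_mobiusDensity hU hG)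
      (mem_regularSet hU hG hF.initial hf hc (hKU hw)))
    have h2 := h1.unique (hasDerivAt_mobiusDensity hU hG hF.initial hf hc (hKU hw))
    have h3 := hconf.liftVariation_smul (smooth_embL hV) (fun x _ => star_embL _) horth'
      (smooth_ofReal (hf.smooth_liftScale hU)) (fun _ _ => star_ofReal _)
      (liftScale_sq_mul hU hf) (hKU hw)
    have h4 : conformalVariation (fun x => sphereLift (f x))
          (fun x => embL n (variationField F x)) w
        + star (conformalVariation (fun x => sphereLift (f x))
          (fun x => embL n (variationField F x)) w)
        = dz (variationFlux (canonicalLift f) (liftedField f (variationField F))) w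
          + star (dz (variationFlux (canonicalLift f) (liftedField f (variationField F))) w)
          + 2 * mink (liftedField f (variationField F) w) (willmoreTensor (canonicalLift f) w) :=
      (h3.symm.trans (hcan.liftVariation_eq hψ hreal horth (hKU hw)))
    have h5 := congrArg Complex.re h4
    simp only [Complex.add_re, ← starRingEnd_apply, Complex.conj_re] at h5
    refine h2.trans ?_
    change 2 * (conformalVariation (fun x => sphereLift (f x))
      (fun x => embL n (variationField F x)) w).re = _
    linarith
  rw [setIntegral_congr_fun hK.measurableSet hpt]
  have i1 : IntegrableOn (dz (variationFlux (canonicalLift f)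
      (liftedField f (variationField F)))) K :=
    ((SmoothOn.dz hU hflux).continuousOn.mono hKU).integrableOn_compact hK
  have i2 : IntegrableOn (fun w => (2 * mink (liftedField f (variationField F) w)
      (willmoreTensor (canonicalLift f) w)).re) K := by
    have hs := (contDiffOn_const (c := (2 : ℂ))).mul (SmoothOn.mink hψ hcan.smooth_willmoreTensor)
    exact ((Complex.continuous_re.comp_continuousOn hs.continuousOn).mono hKU).integrableOn_compact
      hK
  have i3 : IntegrableOn (fun w => 2 * (dz (variationFlux (canonicalLift f)
      (liftedField f (variationField F))) w).re) K := i1.re.const_mul 2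
  rw [integral_add i3 i2, integral_const_mul]
  have := integral_dz_eq_zero hU hflux hK hKU hflux0
  have h6 := congrArg Complex.re this
  rw [← Complex.reCLM_apply, ← ContinuousLinearMap.integral_comp_comm _ i1] at h6
  simp only [Complex.reCLM_apply, Complex.zero_re] at h6
  rw [h6, mul_zero, zero_add]

end IsVariation

end FirstVariation

/-! ### The Euler-Lagrange equation -/

section EulerLagrange

open MeasureTheory Topology

variable {n : ℕ} {U : Set ℂ} {f : ℂ → EuclideanSpace ℝ (Fin (n + 1))}

/-- The tangential part of the constant vector `a` along `f`. -/
def tangentialPart (f : ℂ → EuclideanSpace ℝ (Fin (n + 1))) (a : EuclideanSpace ℝ (Fin (n + 1)))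
    (w : ℂ) : EuclideanSpace ℝ (Fin (n + 1)) := a - (inner ℝ a (f w) : ℝ) • f w

/-- The normalization of `f + t φ ξ`, where `ξ` is the tangential part of `a`. -/
def bumpVariation (f : ℂ → EuclideanSpace ℝ (Fin (n + 1))) (a : EuclideanSpace ℝ (Fin (n + 1)))
    (φ : ℂ → ℝ) (t : ℝ) (w : ℂ) : EuclideanSpace ℝ (Fin (n + 1)) :=
  (√(1 + (t * φ w) ^ 2 * ‖tangentialPart f a w‖ ^ 2))⁻¹ •
    (f w + (t * φ w) • tangentialPart f a w)

theorem inner_tangentialPart {w : ℂ} (hn : ‖f w‖ = 1) (a : EuclideanSpace ℝ (Fin (n + 1))) :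
    inner ℝ (f w) (tangentialPart f a w) = (0 : ℝ) := by
  rw [tangentialPart, inner_sub_right, real_inner_smul_right, real_inner_self_eq_norm_sq, hn,
    real_inner_comm a (f w)]
  ring

theorem smooth_tangentialPart (hf : ContDiffOn ℝ ∞ f U) (a : EuclideanSpace ℝ (Fin (n + 1))) :
    ContDiffOn ℝ ∞ (tangentialPart f a) U :=
  contDiffOn_const.sub (ContDiffOn.smul (contDiffOn_const.inner ℝ hf) hf)

theorem isVariation_bumpVariation (hf : ContDiffOn ℝ ∞ f U) (hn : ∀ w ∈ U, ‖f w‖ = 1)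
    (a : EuclideanSpace ℝ (Fin (n + 1))) {φ : ℂ → ℝ} (hφ : ContDiff ℝ ∞ φ) :
    IsVariation U (tsupport φ) f (bumpVariation f a φ) where
  smooth := by
    have hsnd : ContDiffOn ℝ ∞ (fun p : ℝ × ℂ => p.2) (Set.univ ×ˢ U) := contDiff_snd.contDiffOn
    have hm : Set.MapsTo (fun p : ℝ × ℂ => p.2) (Set.univ ×ˢ U) U := fun p hp => hp.2
    have h1 : ContDiffOn ℝ ∞ (fun p : ℝ × ℂ => f p.2) (Set.univ ×ˢ U) := hf.comp hsnd hm
    have h2 : ContDiffOn ℝ ∞ (fun p : ℝ × ℂ => tangentialPart f a p.2) (Set.univ ×ˢ U) :=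
      (smooth_tangentialPart hf a).comp hsnd hm
    have h3 : ContDiffOn ℝ ∞ (fun p : ℝ × ℂ => p.1 * φ p.2) (Set.univ ×ˢ U) :=
      (contDiff_fst.mul (hφ.comp contDiff_snd)).contDiffOn
    have h4 : ContDiffOn ℝ ∞ (fun p : ℝ × ℂ =>
        1 + (p.1 * φ p.2) ^ 2 * ‖tangentialPart f a p.2‖ ^ 2) (Set.univ ×ˢ U) :=
      contDiffOn_const.add ((h3.pow 2).mul (h2.norm_sq ℝ))
    exact ((h4.sqrt fun p _ => by positivity).inv
      fun p _ => (Real.sqrt_pos.2 (by positivity)).ne').smul (h1.add (h3.smul h2))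
  mem_sphere t w hw := by
    have hpos : 0 < 1 + (t * φ w) ^ 2 * ‖tangentialPart f a w‖ ^ 2 := by positivity
    have h1 : ‖f w + (t * φ w) • tangentialPart f a w‖
        = √(1 + (t * φ w) ^ 2 * ‖tangentialPart f a w‖ ^ 2) := by
      rw [eq_comm, Real.sqrt_eq_iff_eq_sq hpos.le (norm_nonneg _), norm_add_sq_real,
        real_inner_smul_right, inner_tangentialPart (hn w hw), hn w hw, norm_smul,
        Real.norm_eq_abs, mul_pow |t * φ w|, sq_abs]
      ring
    rw [bumpVariation, norm_smul, h1, norm_inv, Real.norm_eq_abs,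
      abs_of_pos (Real.sqrt_pos.2 hpos), inv_mul_cancel₀ (Real.sqrt_pos.2 hpos).ne']
  initial w _ := by simp [bumpVariation]
  support t w hw := by simp [bumpVariation, image_eq_zero_of_notMem_tsupport hw.2]

theorem variationField_bumpVariation (hU : IsOpen U) (hf : ContDiffOn ℝ ∞ f U)
    (hn : ∀ w ∈ U, ‖f w‖ = 1) (a : EuclideanSpace ℝ (Fin (n + 1))) {φ : ℂ → ℝ}
    (hφ : ContDiff ℝ ∞ φ) {w : ℂ} (hw : w ∈ U) :
    variationField (bumpVariation f a φ) w = φ w • tangentialPart f a w := by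
  refine ((isVariation_bumpVariation hf hn a hφ).hasDerivAt hU hw).unique ?_
  have h1 : HasDerivAt (fun t : ℝ => t * φ w) (φ w) 0 := by
    simpa using (hasDerivAt_id (0 : ℝ)).mul_const (φ w)
  -- The normalizing factor is $1$ to first order, since $t$ enters it only through its square.
  have h2 : HasDerivAt (fun t : ℝ => 1 + (t * φ w) ^ 2 * ‖tangentialPart f a w‖ ^ 2) 0 0 := by
    simpa using ((h1.fun_pow 2).mul_const (‖tangentialPart f a w‖ ^ 2)).const_add 1
  have h3 := (h2.sqrt (by simp)).fun_inv (by simp)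
  have h4 := (h1.smul_const (tangentialPart f a w)).const_add (f w)
  exact (h3.fun_smul h4).congr_deriv (by simp)

theorem canonicalLift_apply (w : ℂ) :
    canonicalLift f w = (liftScale f w : ℂ) • sphereLift (f w) := rfl

/-- The vector $(1,x)$ and the vectors $(0,\xi)$ with $\xi\perp x$ span the orthogonal complement of
$(1,x)$, and the complement of that is again the line of $(1,x)$. -/
theorem eq_smul_sphereLift {x : EuclideanSpace ℝ (Fin (n + 1))} {W : CMink n}
    (h0 : mink (sphereLift x) W = 0)
    (h : ∀ a, mink (embL n (a - (inner ℝ a x : ℝ) • x)) W = 0) : W = W 0 • sphereLift x := by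
  have h1 : mink (embL n x) W = W 0 := by
    simp only [mink, sphereLift, embL_zero, embL_succ, Fin.cons_zero, Fin.cons_succ] at h0 ⊢
    linear_combination h0
  funext i
  refine Fin.cases ?_ (fun j => ?_) i
  · simp [sphereLift]
  · have h2 := h (EuclideanSpace.single j 1)
    have h3 : mink (embL n (EuclideanSpace.single j 1)) W = W j.succ := by
      simp [mink, embL_zero, embL_succ, apply_ite (fun r : ℝ => (r : ℂ))]
    rw [map_sub, map_smul, mink_sub_left, h3, ← Complex.coe_smul, mink_smul_left, h1] at h2
    have h4 : (inner ℝ (EuclideanSpace.single j (1 : ℝ)) x : ℝ) = x j := by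
      simp [EuclideanSpace.inner_single_left]
    rw [h4] at h2
    simp only [sphereLift, Pi.smul_apply, smul_eq_mul, Fin.cons_succ]
    linear_combination h2

/-- A conformal immersion is Willmore if and only if its Willmore tensor vanishes. -/
theorem isWillmoreCriticalOn_iff (hU : IsOpen U) (hf : IsImmersionOn U f) (hc : IsConformalOn U f)
    (hn : ∀ w ∈ U, ‖f w‖ = 1) :
    IsWillmoreCriticalOn U f ↔ ∀ w ∈ U, willmoreTensor (canonicalLift f) w = 0 := by
  have hcan := isCanonical_canonicalLift hU hf hc hn
  have hW := hcan.smooth_willmoreTensor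
  constructor
  · intro hcrit
    have key : ∀ a, ∀ w ∈ U, (2 * mink ((liftScale f w : ℂ) • embL n (tangentialPart f a w))
        (willmoreTensor (canonicalLift f) w)).re = 0 := by
      intro a
      have hs := Complex.continuous_re.comp_continuousOn
        ((contDiffOn_const (c := (2 : ℂ))).mul (SmoothOn.mink (SmoothOn.smul
          (smooth_ofReal (hf.smooth_liftScale hU))
          (smooth_embL (smooth_tangentialPart hf.smooth a))) hW)).continuousOn
      -- Fundamental lemma of the calculus of variations, tested with bump functions times the
      -- tangential part of a fixed vector; continuity then upgrades almost everywhere to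
      -- everywhere.
      have hae := hU.ae_eq_zero_of_integral_contDiff_smul_eq_zero (μ := volume)
        (hs.locallyIntegrableOn hU.measurableSet) (fun φ hφ hφc hφU => by
          have hF := isVariation_bumpVariation hf.smooth hn a hφ
          have h1 := (hF.hasDerivAt_willmoreFunctional hU hf hc hn hφc hφU).unique
            (hcrit _ _ hφc hφU hF)
          rw [← setIntegral_eq_integral_of_forall_compl_eq_zero (s := tsupport φ)
            (fun x hx => by rw [image_eq_zero_of_notMem_tsupport hx, zero_smul]), ← h1]
          refine setIntegral_congr_fun hφc.measurableSet fun w hw => ?_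
          simp only [liftedField,
            variationField_bumpVariation hU hf.smooth hn a hφ (hφU hw), map_smul,
            Function.comp_apply, smul_eq_mul, ← Complex.coe_smul (φ w), mink_smul_left]
          rw [← Complex.re_ofReal_mul]
          congr 1
          ring)
      exact Measure.eqOn_open_of_ae_eq (μ := volume)
        ((ae_restrict_iff' hU.measurableSet).2 hae) hU hs continuousOn_const
    intro w hw
    have hpos : (liftScale f w : ℂ) ≠ 0 := by exact_mod_cast (hf.liftScale_pos hw).ne'
    have hreal := hcan.star_willmoreTensor hw
    have h1 : mink (canonicalLift f w) (willmoreTensor (canonicalLift f) w) = 0 := by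
      rw [mink_comm, willmoreTensor, mink_add_left, mink_smul_left, hcan.mink_hopf_self hw,
        normalDzbar, hcan.mink_normalProj_self hw, mul_zero, add_zero]
    have h2 : mink (frameN (canonicalLift f) w) (willmoreTensor (canonicalLift f) w) = 0 := by
      rw [mink_comm, willmoreTensor, mink_add_left, mink_smul_left, hcan.mink_hopf_frameN hw,
        normalDzbar, hcan.mink_normalProj_frameN hw, mul_zero, add_zero]
    have h3 := hcan.mink_self_frameN hw
    rw [canonicalLift_apply, mink_smul_left] at h1 h3
    rw [mul_eq_zero, or_iff_right hpos] at h1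
    -- The first variation controls only the real part of the pairing. Since $W$ is real, the
    -- pairing itself vanishes, leaving $W$ on the line of $Y$; orthogonality to $N$ with $\langle
    -- Y,N\rangle=-1$ finishes.
    have h4 := eq_smul_sphereLift h1 (fun a => by
      have h5 := key a w hw
      have h6 : star (mink (embL n (tangentialPart f a w)) (willmoreTensor (canonicalLift f) w))
          = mink (embL n (tangentialPart f a w)) (willmoreTensor (canonicalLift f) w) := by
        rw [mink_star, star_embL, hreal]
      obtain ⟨r, hr⟩ := Complex.conj_eq_iff_real.1 h6
      rw [mink_smul_left, hr] at h5
      have h7 : 2 * (liftScale f w * r) = 0 := by exact_mod_cast h5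
      have h8 : r = 0 := by
        have := (hf.liftScale_pos hw).ne'
        simpa [this] using h7
      exact hr.trans (by rw [h8, Complex.ofReal_zero]))
    rw [h4, mink_smul_right, mink_comm, mul_eq_zero] at h2
    rcases h2 with h2 | h2
    · rw [h4, h2, zero_smul]
    · exact absurd h3 (by
        change _ * mink (sphereLift (f w)) (frameN (canonicalLift f) w) ≠ -1
        rw [h2]; simp)
  · intro hW0 K F hK hKU hF
    refine (hF.hasDerivAt_willmoreFunctional hU hf hc hn hK hKU).congr_deriv ?_
    rw [setIntegral_congr_fun (g := fun _ => (0 : ℝ)) hK.measurableSet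
      (fun w hw => by simp only [hW0 w (hKU hw), mink_zero_right, mul_zero, Complex.zero_re])]
    simp

end EulerLagrange

/-! ### Adjoint transforms in a coordinate domain -/

section AdjointTransform

variable {n : ℕ} {U : Set ℂ} {f fh : ℂ → EuclideanSpace ℝ (Fin (n + 1))} {μ ν : ℂ → ℂ} {w : ℂ}

/-- The positive function `σ` with `Ŷ = σ Ỹ`. -/
def adjointScale (f fh : ℂ → EuclideanSpace ℝ (Fin (n + 1))) (μ : ℂ → ℂ) (w : ℂ) : ℝ :=
  (adjointLift (canonicalLift f) μ w 0).re / liftScale fh w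

namespace IsAdjointTransformOn

theorem adjointLift_eq_smul_sphereLift (h : IsAdjointTransformOn U f fh μ) (hw : w ∈ U) :
    adjointLift (canonicalLift f) μ w
      = (adjointLift (canonicalLift f) μ w 0) • sphereLift (fh w) := by
  obtain ⟨c, hc⟩ := h.represents w hw
  have : adjointLift (canonicalLift f) μ w 0 = c := by rw [hc]; simp [sphereLift]
  rw [this, hc]

theorem ofReal_re (h : IsCanonical U (canonicalLift f)) (hw : w ∈ U) :
    ((adjointLift (canonicalLift f) μ w 0).re : ℂ) = adjointLift (canonicalLift f) μ w 0 :=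
  Complex.conj_eq_iff_re.1 (congrFun (h.star_adjointLift (μ := μ) hw) 0)

/-- The relation $\langle Y,\hat Y\rangle=-1$ written in terms of the two points of the sphere. It
fixes the scale of $\hat Y$ and shows that the points are distinct. -/
theorem scale_mul (h : IsAdjointTransformOn U f fh μ) (hcan : IsCanonical U (canonicalLift f))
    (hw : w ∈ U) : (adjointLift (canonicalLift f) μ w 0).re
      * (liftScale f w * (1 - inner ℝ (f w) (fh w))) = 1 := by
  have h1 := hcan.mink_self_adjointLift (μ := μ) hw
  rw [h.adjointLift_eq_smul_sphereLift hw, ← ofReal_re hcan hw, canonicalLift_apply, mink_smul_left,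
    mink_smul_right, mink_sphereLift] at h1
  have h2 : liftScale f w * ((adjointLift (canonicalLift f) μ w 0).re
      * (inner ℝ (f w) (fh w) - 1)) = -1 := by exact_mod_cast h1
  linarith

/-- The function `μ` is determined by the two maps. -/
theorem eqOn (h : IsAdjointTransformOn U f fh μ) (h' : IsAdjointTransformOn U f fh ν)
    (hcan : IsCanonical U (canonicalLift f)) : Set.EqOn μ ν U := by
  intro w hw
  have e1 := h.scale_mul hcan hw
  have e2 := h'.scale_mul hcan hw
  -- The maps determine $\hat Y$ including its scale, and $\mu=2\langle Y_z,\hat Y\rangle$ then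
  -- recovers the parameter.
  have e3 := mul_right_cancel₀ (right_ne_zero_of_mul_eq_one e1) (e1.trans e2.symm)
  have e4 : adjointLift (canonicalLift f) μ w = adjointLift (canonicalLift f) ν w := by
    rw [h.adjointLift_eq_smul_sphereLift hw, h'.adjointLift_eq_smul_sphereLift hw,
      ← ofReal_re hcan hw, e3, ofReal_re hcan hw]
  have e5 := hcan.mink_dz_adjointLift (μ := μ) hw
  rw [e4, hcan.mink_dz_adjointLift hw] at e5
  linear_combination -2 * e5

/-- By Cauchy–Schwarz $1-\langle f,\hat f\rangle\ge0$, so `scale_mul` forces the sign. -/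
theorem re_pos (h : IsAdjointTransformOn U f fh μ) (hU : IsOpen U) (hf : IsImmersionOn U f)
    (hc : IsConformalOn U f) (hn : ∀ w ∈ U, ‖f w‖ = 1) (hn' : ∀ w ∈ U, ‖fh w‖ = 1) (hw : w ∈ U) :
    0 < (adjointLift (canonicalLift f) μ w 0).re := by
  have h1 := h.scale_mul (isCanonical_canonicalLift hU hf hc hn) hw
  have h2 : (inner ℝ (f w) (fh w) : ℝ) ≤ 1 := by
    simpa [hn w hw, hn' w hw] using real_inner_le_norm (f w) (fh w)
  have h3 : 0 ≤ liftScale f w * (1 - inner ℝ (f w) (fh w)) :=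
    mul_nonneg (hf.liftScale_pos hw).le (sub_nonneg.2 h2)
  exact pos_of_mul_pos_left (by rw [h1]; exact one_pos) h3

theorem smooth_re (h : IsAdjointTransformOn U f fh μ) (hcan : IsCanonical U (canonicalLift f)) :
    ContDiffOn ℝ ∞ (fun w => (adjointLift (canonicalLift f) μ w 0).re) U :=
  Complex.reCLM.contDiff.comp_contDiffOn
    ((contDiffOn_pi (𝕜 := ℝ)).1 (hcan.smooth_adjointLift h.smooth) 0)

theorem adjointScale_pos (h : IsAdjointTransformOn U f fh μ) (hU : IsOpen U)
    (hf : IsImmersionOn U f) (hc : IsConformalOn U f) (hn : ∀ w ∈ U, ‖f w‖ = 1)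
    (hf' : IsImmersionOn U fh) (hn' : ∀ w ∈ U, ‖fh w‖ = 1) (hw : w ∈ U) :
    0 < adjointScale f fh μ w :=
  div_pos (h.re_pos hU hf hc hn hn' hw) (hf'.liftScale_pos hw)

theorem smooth_adjointScale (h : IsAdjointTransformOn U f fh μ) (hU : IsOpen U)
    (hf' : IsImmersionOn U fh) (hcan : IsCanonical U (canonicalLift f)) :
    ContDiffOn ℝ ∞ (adjointScale f fh μ) U :=
  (h.smooth_re hcan).div (hf'.smooth_liftScale hU) fun _ hw => (hf'.liftScale_pos hw).ne'

variable (h : IsAdjointTransformOn U f fh μ) (hU : IsOpen U) (hf : IsImmersionOn U f)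
  (hc : IsConformalOn U f) (hn : ∀ w ∈ U, ‖f w‖ = 1) (hf' : IsImmersionOn U fh)
  (hn' : ∀ w ∈ U, ‖fh w‖ = 1)
include h hU hf hc hn hf' hn'

/-- $Z$ is a positive multiple of the $z$-derivative of $(1,\tilde f)$ modulo that null vector, so
$\langle Z,Z\rangle=\theta\rho+4\langle\eta,\eta\rangle=0$ transfers to $\tilde f$. -/
theorem isConformalOn : IsConformalOn U fh := by
  have hcan := isCanonical_canonicalLift hU hf hc hn
  have hX := smooth_sphereLift hf'.smooth
  obtain ⟨c, hcs, hcpos, hY⟩ : ∃ c : ℂ → ℝ, ContDiffOn ℝ ∞ c U ∧ (∀ x ∈ U, 0 < c x) ∧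
      ∀ x ∈ U, adjointLift (canonicalLift f) μ x = (c x : ℂ) • sphereLift (fh x) :=
    ⟨_, h.smooth_re hcan, fun x hx => h.re_pos hU hf hc hn hn' hx, fun x hx => by
      rw [ofReal_re hcan hx]; exact h.adjointLift_eq_smul_sphereLift hx⟩
  intro w hw
  have dX := SmoothOn.differentiableAt hU hX hw
  have hnull : ∀ x ∈ U, mink (sphereLift (fh x)) (sphereLift (fh x)) = 0 := fun x hx => by
    rw [mink_sphereLift, real_inner_self_eq_norm_sq, hn' x hx]; norm_num
  have hdnull : mink (dz (fun x => sphereLift (fh x)) w) (sphereLift (fh w)) = 0 := by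
    have e := dz_congr hU hnull hw
    rw [dz_mink dX dX, dz_const, mink_comm (sphereLift (fh w))] at e
    linear_combination e / 2
  have key := hcan.mink_adjointTangent_adjointTangent h.smooth hw
  rw [h.coTouching w hw, h.conformality w hw, adjointTangent, dz_congr hU hY hw,
    dz_smul (SmoothOn.differentiableAt hU (smooth_ofReal hcs) hw) dX, hY w hw] at key
  simp only [mink_add_left, mink_add_right, mink_smul_left, mink_smul_right, hnull w hw, hdnull,
    mink_comm (sphereLift (fh w)) (dz _ w)] at key
  rw [← isConformal_iff_mink (SmoothOn.differentiableAt hU hf'.smooth hw)]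
  have hne : (c w : ℂ) ≠ 0 := by exact_mod_cast (hcpos w hw).ne'
  have h0 : (c w : ℂ) ^ 2
      * mink (dz (fun x => sphereLift (fh x)) w) (dz (fun x => sphereLift (fh x)) w) = 0 := by
    linear_combination key
  simpa [hne] using h0

theorem isAdjointPair (hW : ∀ w ∈ U, willmoreTensor (canonicalLift f) w = 0) :
    IsAdjointPair U (canonicalLift f) (canonicalLift fh) μ (fun w => (adjointScale f fh μ w : ℂ)) where
  canonical := isCanonical_canonicalLift hU hf hc hn
  canonical_adjoint := isCanonical_canonicalLift hU hf' (h.isConformalOn hU hf hc hn hf' hn') hn'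
  smooth_μ := h.smooth
  smooth_σ := smooth_ofReal (h.smooth_adjointScale hU hf' (isCanonical_canonicalLift hU hf hc hn))
  ne_zero w hw := by exact_mod_cast (h.adjointScale_pos hU hf hc hn hf' hn' hw).ne'
  real _ _ := star_ofReal _
  adjoint w hw := by
    have h0 : (liftScale fh w : ℂ) ≠ 0 := by exact_mod_cast (hf'.liftScale_pos hw).ne'
    rw [canonicalLift_apply (f := fh), smul_smul, adjointScale, Complex.ofReal_div,
      div_mul_cancel₀ _ h0, ofReal_re (isCanonical_canonicalLift hU hf hc hn) hw]
    exact h.adjointLift_eq_smul_sphereLift hw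
  coTouching := h.coTouching
  willmore := hW

theorem dual (hW : ∀ w ∈ U, willmoreTensor (canonicalLift f) w = 0) :
    IsAdjointTransformOn U fh f (dualParam μ (fun w => (adjointScale f fh μ w : ℂ))) where
  smooth := (h.isAdjointPair hU hf hc hn hf' hn' hW).smooth_dualParam
  represents w hw := ⟨_, by
    rw [(h.isAdjointPair hU hf hc hn hf' hn' hW).adjointLift_dual hw, canonicalLift_apply, smul_smul]⟩
  coTouching _ hw := (h.isAdjointPair hU hf hc hn hf' hn' hW).theta_dual hw
  conformality _ hw := (h.isAdjointPair hU hf hc hn hf' hn' hW).eta_dual hw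

end IsAdjointTransformOn

theorem norm_inCoord {M : Type*} [TopologicalSpace M] (φ : OpenPartialHomeomorph M ℂ)
    (f : M → Sph n) (w : ℂ) : ‖inCoord φ f w‖ = 1 := by
  simp [inCoord]

end AdjointTransform

end MobiusSurface

end

/-! ### Assembly over the coordinates of the Riemann surface -/

theorem theorem2 {n : ℕ} (hn : 3 ≤ n) {M : Type*} [TopologicalSpace M] [ChartedSpace ℂ M]
    [IsManifold 𝓘(ℂ) ω M] (f fh : M → Sph n)
    (hf : IsWillmoreSurface f) (hadj : IsAdjointTransform f fh) (himm : IsImmersion fh) :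
    IsWillmoreSurface fh ∧ IsAdjointTransform fh f ∧
      ∀ φ ∈ coords M, ∀ μ μt : ℂ → ℂ,
        IsAdjointTransformOn φ.target (inCoord φ f) (inCoord φ fh) μ →
        IsAdjointTransformOn φ.target (inCoord φ fh) (inCoord φ f) μt →
        ∃ σ : ℂ → ℝ, ContDiffOn ℝ ∞ σ φ.target ∧ ∀ w ∈ φ.target, 0 < σ w ∧
          adjointLift (canonicalLift (inCoord φ f)) μ w
            = (σ w : ℂ) • canonicalLift (inCoord φ fh) w ∧
          -1 / (σ w : ℂ)
            = mink (canonicalLift (inCoord φ fh) w) (canonicalLift (inCoord φ f) w) ∧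
          2 * dz (fun x => (σ x : ℂ)) w / (σ w : ℂ) = μt w + μ w ∧
          rho (canonicalLift (inCoord φ fh)) μt w
            = conj (rho (canonicalLift (inCoord φ f)) μ w) := by
  have hU : ∀ φ ∈ coords M, IsOpen φ.target := fun φ _ => φ.open_target
  have hn' : ∀ (φ : OpenPartialHomeomorph M ℂ) (g : M → Sph n), ∀ w ∈ φ.target,
      ‖inCoord φ g w‖ = 1 := fun φ g w _ => norm_inCoord φ g w
  have hW : ∀ φ ∈ coords M, ∀ w ∈ φ.target, willmoreTensor (canonicalLift (inCoord φ f)) w = 0 :=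
    fun φ hφ => (isWillmoreCriticalOn_iff (hU φ hφ) (hf.immersion φ hφ) (hf.conformal φ hφ)
      (hn' φ f)).1 (hf.critical φ hφ)
  have hc : IsConformal fh := fun φ hφ => by
    obtain ⟨μ, hμ⟩ := hadj φ hφ
    exact hμ.isConformalOn (hU φ hφ) (hf.immersion φ hφ) (hf.conformal φ hφ) (hn' φ f)
      (himm φ hφ) (hn' φ fh)
  have hpair := fun φ (hφ : φ ∈ coords M) (μ : ℂ → ℂ)
      (hμ : IsAdjointTransformOn φ.target (inCoord φ f) (inCoord φ fh) μ) =>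
    hμ.isAdjointPair (hU φ hφ) (hf.immersion φ hφ) (hf.conformal φ hφ) (hn' φ f)
      (himm φ hφ) (hn' φ fh) (hW φ hφ)
  have hdual := fun φ (hφ : φ ∈ coords M) (μ : ℂ → ℂ)
      (hμ : IsAdjointTransformOn φ.target (inCoord φ f) (inCoord φ fh) μ) =>
    hμ.dual (hU φ hφ) (hf.immersion φ hφ) (hf.conformal φ hφ) (hn' φ f)
      (himm φ hφ) (hn' φ fh) (hW φ hφ)
  refine ⟨⟨himm, hc, fun φ hφ => ?_⟩, fun φ hφ => ?_, fun φ hφ μ μt hμ hμt => ?_⟩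
  · obtain ⟨μ, hμ⟩ := hadj φ hφ
    exact (isWillmoreCriticalOn_iff (hU φ hφ) (himm φ hφ) (hc φ hφ) (hn' φ fh)).2
      fun w hw => (hpair φ hφ μ hμ).willmoreTensor_dual hw
  · obtain ⟨μ, hμ⟩ := hadj φ hφ
    exact ⟨_, hdual φ hφ μ hμ⟩
  · have hp := hpair φ hφ μ hμ
    -- The given parameter of $\tilde f$ is arbitrary; uniqueness identifies it with
    -- $2\sigma_z/\sigma-\mu$, for which the formulas are known.
    have heq := hμt.eqOn (hdual φ hφ μ hμ) hp.canonical_adjoint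
    refine ⟨adjointScale (inCoord φ f) (inCoord φ fh) μ,
      hμ.smooth_adjointScale (hU φ hφ) (himm φ hφ) hp.canonical, fun w hw => ⟨?_, ?_, ?_, ?_, ?_⟩⟩
    · exact hμ.adjointScale_pos (hU φ hφ) (hf.immersion φ hφ) (hf.conformal φ hφ) (hn' φ f)
        (himm φ hφ) (hn' φ fh) hw
    · exact hp.adjoint w hw
    · have h0 := hp.ne_zero w hw
      have h1 := hp.canonical.mink_self_adjointLift (μ := μ) hw
      rw [hp.adjoint w hw, mink_smul_right, mink_comm] at h1
      rw [← h1]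
      field_simp
    · rw [heq hw, dualParam, sub_add_cancel]
    · rw [starRingEnd_apply, ← hp.rho_dual hw, rho, rho]
      congr 1
      exact dz_congr (hU φ hφ) (fun x hx => congrArg _ (heq hx)) hw
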